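/- **Setting.** Let $(\mathbb X,\mathcal X)$ be an arbitrary measurable space with a $\sigma$-finite measure $\lambda$. Let $\mathbf N$ be the set of integer-valued ($\{0,1,2,\dots\}\cup\{\infty\}$-valued) $\sigma$-finite measures on $\mathbb X$, with the smallest $\sigma$-field making all maps $\mu\mapsto\mu(B)$, $B\in\mathcal X$, measurable. Let $\eta$ be a Poisson process on $\mathbb X$ with intensity measure $\lambda$, defined on a probability space $(\Omega,\mathcal F,\mathbb P)$ and viewed as a random element of $\mathbf N$. Write $L^2_\eta$ for the set of $F\in L^2(\mathbb P)$ such that $F=f(\eta)$ a.s. for some measurable $f:\mathbf N\to\mathbb R$, called a representative of $F$. *Difference operators.* For measurable $f:\mathbf N\to\mathbb R$ put $D^n_{x_1,\dots,x_n}f(\mu)=\sum_{J\subset\{1,\dots,n\}}(-1)^{n-|J|}f\big(\mu+\sum_{j\in J}\delta_{x_j}\big)$, and for $F\in L^2_\eta$ with representative $f$ put $D^nF=D^nf(\eta)$, $D=D^1$; up to $\mathbb P\otimes\lambda^n$-null sets this does not depend on $f$. *Wiener–Itô integrals.* For bounded measurable $g:\mathbb X^n\to\mathbb R$ vanishing outside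 $B^n$ for some $B\in\mathcal X$ with $\lambda(B)<\infty$, put $$I_n(g)=\sum_{J\subset\{1,\dots,n\}}(-1)^{n-|J|}\iint g(x_1,\dots,x_n)\,\eta^{(|J|)}(dx_J)\,\lambda^{n-|J|}(dx_{J^c}),$$ where $\eta^{(m)}$ is the $m$-th factorial measure of $\eta$; $I_n$ is extended by $L^2$-continuity to all symmetric $g\in L^2(\lambda^n)$. *Inverse Ornstein–Uhlenbeck generator.* For $F\in L^2_\eta$ let $f_n(x_1,\dots,x_n)=\frac1{n!}\mathbb E\,D^n_{x_1,\dots,x_n}F$ and $$L^{-1}F=-\sum_{n=1}^\infty \frac1n I_n(f_n),\qquad\text{with convergence in }L^2(\mathbb P).$$ *The operators $P_s$.* For $s\in[0,1]$ and a functional $F=f(\eta)$, integrable in the sense that $\mathbb E|F|<\infty$, let $$P_sF=\int \mathbb E\big[f(\eta^{(s)}+\chi)\,\big|\,\eta\big]\,\Pi_{(1-s)\lambda}(d\chi),$$ where $\eta^{(s)}$ is an $s$-thinning of $\eta$ (given $\eta$, each of its points is kept independently with probability $s$) and $\Pi_{\lambda'}$ is the distribution of a Poisson process with intensity measure $\lambda'$.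 The version of $P_sF$ used below is the one given by the conditional distribution of the thinning, so that it is jointly measurable in $(\omega,s)$. **Theorem.** Let $F\in L^2_\eta$. 1. For every $n\ge1$, $\mathbb E|D^n_{x_1,\dots,x_n}F|<\infty$ for $\lambda^n$-a.e. $(x_1,\dots,x_n)$, $f_n\in L^2(\lambda^n)$, and the $L^2(\mathbb P)$-limit defining $I_n(f_n)$ exists. The series defining $L^{-1}F$ converges in $L^2(\mathbb P)$, and $L^{-1}F\in L^2_\eta$. 2. If $\mathbb E F=0$, then the following hold, where all integrals over $[0,1]$ converge absolutely: $$L^{-1}F=-\int_0^1 s^{-1}P_sF\,ds\qquad \mathbb P\text{-a.s.},$$ $$-D_xL^{-1}F=\int_0^1 P_sD_xF\,ds\qquad \mathbb P\otimes\lambda\text{-a.e.},$$ $$-D^2_{x,y}L^{-1}F=\int_0^1 s\,P_sD^2_{x,y}F\,ds\qquad \mathbb P\otimes\lambda^2\text{-a.e.}$$ 3. (Without assuming $\mathbb EF=0$.) For every real $p\ge1$, as an inequality in $[0,\infty]$, $$\mathbb E|D_xL^{-1}F|^p\le\mathbb E|D_xF|^p\quad\text{for }\lambda\text{-a.e. }x,\qquad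 \mathbb E|D^2_{x,y}L^{-1}F|^p\le\mathbb E|D^2_{x,y}F|^p\quad\text{for }\lambda^2\text{-a.e. }(x,y).$$ -/

import Mathlib

open MeasureTheory ProbabilityTheory Filter Topology
open scoped ENNReal NNReal unitInterval

noncomputable section

namespace PoissonMehler

variable {X : Type*} [MeasurableSpace X] {Ω : Type*} [MeasurableSpace Ω]

/-! ### Integer-valued measures and their points -/

/-- `μ` is an integer-valued `σ`-finite measure (values in `{0, 1, 2, …} ∪ {∞}`), that is, an
element of the configuration space `𝐍`.  The `σ`-field on `Measure X` is Mathlib's, the smallest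
one that makes all evaluations `μ ↦ μ B` at measurable sets `B` measurable. -/
structure IsConfiguration (μ : Measure X) : Prop where
  sigmaFinite : SigmaFinite μ
  integerValued : ∀ B : Set X, MeasurableSet B → ∃ n : ℕ∞, μ B = (n : ℝ≥0∞)

/-- A point, or no point at all: a `{0, 1}`-valued measure.  Every Dirac measure is of this kind,
and so is the zero measure.  On standard Borel spaces there are no others; on an
arbitrary measurable space these measures replace the Dirac measures as the summands of a general
integer-valued measure, see `IsConfiguration.exists_points`. -/
def IsPoint (ν : Measure X) : Prop :=
  ∀ B : Set X, MeasurableSet B → ν B = 0 ∨ ν B = 1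

/-- `μ` is a countable sum of points. -/
def HasPoints (μ : Measure X) : Prop :=
  ∃ ν : ℕ → Measure X, (∀ i, IsPoint (ν i)) ∧ Measure.sum ν = μ

lemma HasPoints.sum {μ : ℕ → Measure X} (h : ∀ k, HasPoints (μ k)) :
    HasPoints (Measure.sum μ) := by
  choose ν hν hs using h
  refine ⟨fun n => ν n.unpair.1 n.unpair.2, fun n => hν _ _, ?_⟩
  ext B hB
  rw [Measure.sum_apply _ hB, Measure.sum_apply _ hB]
  rw [show (∑' n : ℕ, ν n.unpair.1 n.unpair.2 B)
      = ∑' n : ℕ, (fun p : ℕ × ℕ => ν p.1 p.2 B) (Nat.pairEquiv.symm n) from rfl,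
    Nat.pairEquiv.symm.tsum_eq (fun p : ℕ × ℕ => ν p.1 p.2 B),
    ENNReal.tsum_prod (f := fun a b => ν a b B)]
  exact tsum_congr fun k => by rw [← hs k, Measure.sum_apply _ hB]

lemma HasPoints.zero : HasPoints (0 : Measure X) :=
  ⟨fun _ => 0, fun _ _ _ => Or.inl rfl, by simp⟩

lemma IsPoint.hasPoints {ν : Measure X} (h : IsPoint ν) : HasPoints ν := by
  refine ⟨fun i => if i = 0 then ν else 0, fun i => ?_, ?_⟩
  · by_cases hi : i = 0
    · simpa [hi] using h
    · simp only [hi, if_false]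
      exact fun B _ => Or.inl rfl
  · ext B hB
    rw [Measure.sum_apply _ hB, tsum_eq_single 0 (fun i hi => by simp [hi])]
    simp

lemma HasPoints.add {μ ν : Measure X} (hμ : HasPoints μ) (hν : HasPoints ν) :
    HasPoints (μ + ν) := by
  have h := HasPoints.sum (μ := fun k => if k = 0 then μ else if k = 1 then ν else 0) (fun k => by
    by_cases h0 : k = 0
    · simpa [h0] using hμ
    · by_cases h1 : k = 1
      · simpa [h1] using hν
      · simpa [h0, h1] using HasPoints.zero)
  convert h using 1
  ext B hB
  rw [Measure.sum_apply _ hB, tsum_eq_sum (s := {0, 1}) (fun i hi => by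
    simp only [Finset.mem_insert, Finset.mem_singleton, not_or] at hi
    simp [hi.1, hi.2])]
  simp

lemma HasPoints.nsmul {μ : Measure X} (hμ : HasPoints μ) (c : ℕ) : HasPoints (c • μ) := by
  induction c with
  | zero => simpa using HasPoints.zero
  | succ c ih => rw [succ_nsmul]; exact ih.add hμ

lemma IsConfiguration.restrict {μ : Measure X} (h : IsConfiguration μ) {A : Set X}
    (hA : MeasurableSet A) : IsConfiguration (μ.restrict A) := by
  have := h.sigmaFinite
  refine ⟨inferInstance, fun B hB => ?_⟩
  rw [Measure.restrict_apply hB]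
  exact h.integerValued _ (hB.inter hA)

lemma IsConfiguration.hasPoints_of_finite (n : ℕ) : ∀ μ : Measure X, IsConfiguration μ →
    μ Set.univ = n → HasPoints μ := by
  induction n using Nat.strong_induction_on with
  | _ n ih =>
    intro μ hμ hn
    rcases Nat.eq_zero_or_pos n with rfl | hpos
    · have h0 : μ = 0 := Measure.measure_univ_eq_zero.1 (by simpa using hn)
      rw [h0]
      exact HasPoints.zero
    have hnat : ∀ B, MeasurableSet B → ∃ k : ℕ, μ B = k := by
      intro B hB
      obtain ⟨k, hk⟩ := hμ.integerValued B hB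
      have hk' : k ≠ ⊤ := by
        rintro rfl
        have : μ B ≤ n := hn ▸ measure_mono (Set.subset_univ B)
        rw [hk] at this
        simp at this
      lift k to ℕ using hk'
      exact ⟨k, by simpa using hk⟩
    have hex : ∃ c : ℕ, 0 < c ∧ ∃ A, MeasurableSet A ∧ μ A = c :=
      ⟨n, hpos, Set.univ, MeasurableSet.univ, hn⟩
    classical
    obtain ⟨hc, A, hA, hAc⟩ := Nat.find_spec hex
    set c := Nat.find hex with hcdef
    have hmin : ∀ B, MeasurableSet B → μ (B ∩ A) = 0 ∨ μ (B ∩ A) = c := by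
      intro B hB
      obtain ⟨k, hk⟩ := hnat _ (hB.inter hA)
      rcases Nat.eq_zero_or_pos k with rfl | hk0
      · left; simpa using hk
      · right
        have h1 : c ≤ k := Nat.find_min' hex ⟨hk0, _, hB.inter hA, hk⟩
        have h2 : (k : ℝ≥0∞) ≤ c := by
          rw [← hk, ← hAc]; exact measure_mono Set.inter_subset_right
        have h3 : k ≤ c := by exact_mod_cast h2
        rw [hk, le_antisymm h3 h1]
    have hc0 : (c : ℝ≥0∞) ≠ 0 := by exact_mod_cast hc.ne'
    have hpt : IsPoint ((c : ℝ≥0∞)⁻¹ • μ.restrict A) := by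
      intro B hB
      rw [Measure.smul_apply, Measure.restrict_apply hB, smul_eq_mul]
      rcases hmin B hB with h | h
      · left; simp [h]
      · right; rw [h, ENNReal.inv_mul_cancel hc0 (by simp)]
    obtain ⟨m, hm⟩ := hnat _ hA.compl
    have hmn : c + m = n := by
      have := measure_add_measure_compl (μ := μ) hA
      rw [hAc, hm, hn] at this
      exact_mod_cast this
    have hrest : HasPoints (μ.restrict Aᶜ) :=
      ih m (by omega) _ (hμ.restrict hA.compl) (by simpa using hm)
    have := (hpt.hasPoints.nsmul c).add hrest
    convert this using 1
    rw [← Nat.cast_smul_eq_nsmul ℝ≥0∞ c, smul_smul, ENNReal.mul_inv_cancel hc0 (by simp), one_smul,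
      Measure.restrict_add_restrict_compl hA]

/-- Every integer-valued `σ`-finite measure is a countable sum of points. -/
theorem IsConfiguration.exists_points {μ : Measure X} (h : IsConfiguration μ) : HasPoints μ := by
  have := h.sigmaFinite
  have hm : ∀ k, MeasurableSet (disjointed (spanningSets μ) k) :=
    fun k => MeasurableSet.disjointed (measurableSet_spanningSets μ) k
  have hsum : Measure.sum (fun k => μ.restrict (disjointed (spanningSets μ) k)) = μ := by
    rw [← Measure.restrict_iUnion (disjoint_disjointed _) hm, iUnion_disjointed,
      iUnion_spanningSets, Measure.restrict_univ]
  rw [← hsum]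
  refine HasPoints.sum fun k => ?_
  have hfin : μ (disjointed (spanningSets μ) k) < ∞ :=
    (measure_mono (disjointed_subset _ _)).trans_lt (measure_spanningSets_lt_top μ k)
  obtain ⟨n, hn⟩ := h.integerValued _ (hm k)
  have hn' : n ≠ ⊤ := by
    rintro rfl
    rw [hn] at hfin
    simp at hfin
  lift n to ℕ using hn'
  exact IsConfiguration.hasPoints_of_finite n _ (h.restrict (hm k)) (by simpa using hn)

open Classical in
/-- An enumeration `μ = ∑ i, points μ i` of the points of an integer-valued `σ`-finite measure
(padded by zero measures).  What is built from it below does not depend on the enumeration. -/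
def points (μ : Measure X) : ℕ → Measure X :=
  if h : HasPoints μ then h.choose else 0

/-! ### Poisson processes -/

/-- `η` is a Poisson process on `X` with intensity measure `lam` under `P`: a random
integer-valued `σ`-finite measure such that `η(B)` has the Poisson distribution with mean `lam(B)`
whenever `lam(B) < ∞`, and `η(B₁), …, η(Bₖ)` are independent for pairwise disjoint sets. -/
structure IsPoissonProcess (P : Measure Ω) (η : Ω → Measure X) (lam : Measure X) : Prop where
  measurable : Measurable η
  isConfiguration : ∀ ω, IsConfiguration (η ω)
  poisson : ∀ B : Set X, MeasurableSet B → lam B ≠ ∞ →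
    P.map (fun ω => η ω B) = (poissonMeasure (lam B).toNNReal).map (fun n : ℕ => (n : ℝ≥0∞))
  indep : ∀ (k : ℕ) (B : Fin k → Set X), (∀ i, MeasurableSet (B i)) →
    Pairwise (Function.onFun Disjoint B) → iIndepFun (fun i ω => η ω (B i)) P

/-- The distribution of a Poisson process with finite intensity measure `ν`: the sum of
a Poisson number (mean `ν(X)`) of Dirac measures at independent points with distribution
`ν / ν(X)`. -/
def finitePoissonLaw (ν : Measure X) : Measure (Measure X) :=
  ENNReal.ofReal (Real.exp (-(ν Set.univ).toReal)) •
    Measure.sum fun k : ℕ => ((k.factorial : ℝ≥0∞)⁻¹) •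
      (Measure.pi fun _ : Fin k => ν).map fun x => ∑ j, Measure.dirac (x j)

lemma measurable_sum_dirac (k : ℕ) :
    Measurable fun x : Fin k → X => ∑ j, Measure.dirac (x j) := by
  refine Finset.measurable_fun_sum _ fun j _ => ?_
  exact Measure.measurable_dirac.comp (measurable_pi_apply j)

instance isProbabilityMeasure_finitePoissonLaw (ν : Measure X) [IsFiniteMeasure ν] :
    IsProbabilityMeasure (finitePoissonLaw ν) := by
  constructor
  have h : ∀ k : ℕ, ((k.factorial : ℝ≥0∞)⁻¹ • (Measure.pi fun _ : Fin k => ν).map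
      fun x => ∑ j, Measure.dirac (x j)) Set.univ
      = ENNReal.ofReal ((ν Set.univ).toReal ^ k / k.factorial) := by
    intro k
    rw [Measure.smul_apply, Measure.map_apply (measurable_sum_dirac k) MeasurableSet.univ,
      Set.preimage_univ, Measure.pi_univ, Finset.prod_const, Finset.card_univ, Fintype.card_fin,
      ENNReal.ofReal_div_of_pos (by positivity), ENNReal.ofReal_pow ENNReal.toReal_nonneg,
      ENNReal.ofReal_toReal (measure_ne_top _ _), ENNReal.ofReal_natCast, smul_eq_mul,
      ENNReal.div_eq_inv_mul]
  have hs := NormedSpace.expSeries_div_hasSum_exp (ν Set.univ).toReal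
  rw [← Real.exp_eq_exp_ℝ] at hs
  rw [finitePoissonLaw, Measure.smul_apply, Measure.sum_apply _ MeasurableSet.univ,
    tsum_congr h, ← ENNReal.ofReal_tsum_of_nonneg (fun k => by positivity) hs.summable, hs.tsum_eq,
    smul_eq_mul, ← ENNReal.ofReal_mul (Real.exp_pos _).le, ← Real.exp_add]
  simp

/-- The distribution `Π_ν` of a Poisson process with `σ`-finite (more generally, `s`-finite)
intensity measure `ν`: write `ν` as a countable sum of finite measures and superpose independent
Poisson processes with these intensity measures. -/
def poissonLaw (ν : Measure X) [SFinite ν] : Measure (Measure X) :=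
  (Measure.infinitePi fun n : ℕ => finitePoissonLaw (sfiniteSeq ν n)).map
    fun χ : ℕ → Measure X => Measure.sum χ

/-! ### Thinning and the operators `P_s` -/

/-- The distribution of the `s`-thinning of the configuration `μ`: every point of `μ` is
retained with probability `s`, and removed with probability `1 - s`, independently of the other
points.  For a Poisson process `η`, this with `μ = η(ω)` is the conditional distribution of the
thinning `η^{(s)}` given `η`. -/
def thinningLaw (s : I) (μ : Measure X) : Measure (Measure X) :=
  (setBernoulli (Set.univ : Set ℕ) s).map
    fun S : Set ℕ => Measure.sum fun i : S => points μ i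

/-- The operator `P_s`, acting on a functional `f` of configurations: `mehlerOp lam s f (η ω)` is
`∫ 𝔼[f(η^{(s)} + χ) ∣ η] Π_{(1-s)lam}(dχ)` evaluated at `ω`. -/
def mehlerOp (lam : Measure X) [SFinite lam] (s : I) (f : Measure X → ℝ) (μ : Measure X) : ℝ :=
  ∫ χ, ∫ ξ, f (ξ + χ) ∂(thinningLaw s μ) ∂(poissonLaw (ENNReal.ofReal (1 - (s : ℝ)) • lam))

/-! ### Difference operators and functionals of `η` -/

/-- The difference operator
`D^n_{x_1,…,x_n} f(μ) = ∑_{J ⊆ {1,…,n}} (-1)^{n-|J|} f(μ + ∑_{j ∈ J} δ_{x_j})`. -/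
def diffOp {n : ℕ} (x : Fin n → X) (f : Measure X → ℝ) (μ : Measure X) : ℝ :=
  ∑ J : Finset (Fin n), (-1 : ℝ) ^ (n - J.card) * f (μ + ∑ j ∈ J, Measure.dirac (x j))

/-- `f` is a representative of the random variable `F`: `f` is measurable and `F = f(η)` almost
surely.  (The measurable functions on the subspace `𝐍` of `Measure X` are exactly the restrictions
of the measurable functions on `Measure X`, and only the values of `f` on `𝐍` matter.) -/
structure IsRepresentative (P : Measure Ω) (η : Ω → Measure X) (f : Measure X → ℝ)
    (F : Ω → ℝ) : Prop where
  measurable : Measurable f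
  ae_eq : F =ᵐ[P] fun ω => f (η ω)

/-! ### Wiener–Itô integrals -/

/-- `Y` is the limit of the sequence `Z` in `L²(P)`. -/
def IsL2Limit (P : Measure Ω) (Z : ℕ → Ω → ℝ) (Y : Ω → ℝ) : Prop :=
  MemLp Y 2 P ∧ Tendsto (fun k => eLpNorm (Z k - Y) 2 P) atTop (𝓝 0)

open Classical in
/-- The limit of a sequence in `L²(P)` (and `0` if there is none). -/
def l2Limit (P : Measure Ω) (Z : ℕ → Ω → ℝ) : Ω → ℝ :=
  if h : ∃ Y, IsL2Limit P Z Y then h.choose else 0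

/-- The measure `μ^{(|J|)}(dx_J) lam^{n-|J|}(dx_{Jᶜ})` on `X^n`, where `μ^{(m)}` is the `m`-th
factorial measure of `μ`, that is, the sum of `ν_{i_1} ⊗ … ⊗ ν_{i_m}` over all `m`-tuples of
pairwise distinct indices of points `ν_i` of `μ`. -/
def factorialProd (lam μ : Measure X) {n : ℕ} (J : Finset (Fin n)) : Measure (Fin n → X) :=
  Measure.sum fun i : J ↪ ℕ =>
    Measure.pi fun j : Fin n => if h : j ∈ J then points μ (i ⟨j, h⟩) else lam

/-- The `n`-fold integral of `g` with respect to the compensated measure `μ - lam`, off the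
diagonals of `μ`:
`∑_{J ⊆ {1,…,n}} (-1)^{n-|J|} ∬ g(x_1,…,x_n) μ^{(|J|)}(dx_J) lam^{n-|J|}(dx_{Jᶜ})`. -/
def compensatedIntegral (lam μ : Measure X) {n : ℕ} (g : (Fin n → X) → ℝ) : ℝ :=
  ∑ J : Finset (Fin n), (-1 : ℝ) ^ (n - J.card) * ∫ x, g x ∂(factorialProd lam μ J)

open Classical in
/-- The function `g` cut down to a bounded function supported by `B_k^n`, where the sets
`B_k ↑ X` are measurable with `lam(B_k) < ∞`. -/
def truncate (lam : Measure X) [SigmaFinite lam] (k : ℕ) {n : ℕ} (g : (Fin n → X) → ℝ) :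
    (Fin n → X) → ℝ :=
  fun x => if (∀ j, x j ∈ spanningSets lam k) ∧ |g x| ≤ k then g x else 0

/-- The integrals with respect to `η - lam` of the truncations of `g`. -/
def wienerItoApprox (lam : Measure X) [SigmaFinite lam] (η : Ω → Measure X) {n : ℕ}
    (g : (Fin n → X) → ℝ) (k : ℕ) (ω : Ω) : ℝ :=
  compensatedIntegral lam (η ω) (truncate lam k g)

/-- The `n`-th order Wiener–Itô integral `I_n(g)` with respect to `η - lam`: the pathwise
integral, extended by `L²`-continuity to all (symmetric) `g ∈ L²(lam^n)`. -/
def wienerIto (P : Measure Ω) (lam : Measure X) [SigmaFinite lam] (η : Ω → Measure X) {n : ℕ}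
    (g : (Fin n → X) → ℝ) : Ω → ℝ :=
  l2Limit P (wienerItoApprox lam η g)

/-! ### Chaos expansion and the inverse Ornstein–Uhlenbeck generator -/

/-- The kernel `f_n = (1 / n!) 𝔼 D^n F` of the chaos expansion of `F = f(η)`. -/
def chaosKernel (P : Measure Ω) (η : Ω → Measure X) (f : Measure X → ℝ) (n : ℕ)
    (x : Fin n → X) : ℝ :=
  (n.factorial : ℝ)⁻¹ * ∫ ω, diffOp x f (η ω) ∂P

/-- The partial sums `-∑_{n=1}^m (1/n) I_n(f_n)`. -/
def invOUPartial (P : Measure Ω) (lam : Measure X) [SigmaFinite lam] (η : Ω → Measure X)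
    (f : Measure X → ℝ) (m : ℕ) (ω : Ω) : ℝ :=
  -∑ n ∈ Finset.Icc 1 m, (n : ℝ)⁻¹ * wienerIto P lam η (chaosKernel P η f n) ω

/-- The (pseudo) inverse of the Ornstein–Uhlenbeck generator,
`L⁻¹F = -∑_{n=1}^∞ (1/n) I_n(f_n)` with convergence in `L²(P)`, for `F = f(η)`. -/
def invOU (P : Measure Ω) (lam : Measure X) [SigmaFinite lam] (η : Ω → Measure X)
    (f : Measure X → ℝ) : Ω → ℝ :=
  l2Limit P (invOUPartial P lam η f)

end PoissonMehler

end

open PoissonMehler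

/-!
The operators in the theorem are diagonalized simultaneously by the Fock space. The map
`f ↦ (𝔼 D^n f(η))_n` is an isometry `fockIso` from `L²` of the law of `η` into `L²(fockMeasure lam)`,
where `fockMeasure lam = ∑ lam^n / n!` lives on the disjoint union of the powers `X^n`. Its adjoint
`fockAdj` is, up to the factor `1 / n!` in degree `n`, the multiple Wiener–Itô integral
(`wienerItoApprox_ae_eq`, `wienerIto_ae_eq`), so that `L⁻¹` acts on the kernel of
degree `n` as multiplication by `-1/n` (`invOU_ae_eq`), while `P_s` acts as multiplication by `s ^ n`
(`inner_jointMehler`, `integral_mehlerOp_mul`). Since `∫₀¹ s⁻¹ s ^ n ds = 1/n` for `n ≥ 1`, Mehler's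
formula `L⁻¹ F = -∫₀¹ s⁻¹ P_s F ds` follows for centred `F` (`invOU_ae_eq_mehlerIntegral`); absolute
convergence at `s = 0` holds because `‖P_s F‖ ≤ s ‖F‖` for such `F`, in the sense of
`lintegral_enorm_mehlerOp_le`.

All of these identities are checked on the exponential functionals `expFun v μ = exp (-∫ v dμ)`, with
`v` a simple function whose support has finite intensity. They form a multiplicative class that
generates the σ-field of the space of measures, so they determine laws (`ext_of_expFun`) and are total
in `L²` (`ae_eq_zero_of_expFun`, `dense_span_expLp`), and everything can be computed on them. The
Laplace functional `exp (-∫ (1 - e^{-v}) dlam)` characterizes the Poisson law (`IsPoissonLaw`), and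
its derivative gives the Mecke equation (`IsPoissonLaw.mecke`). Thinning with added noise maps
`expFun v` to a multiple of `expFun (thin s v)` with `1 - e^{-thin s v} = s (1 - e^{-v})`, and
`𝔼 D^n expFun v (η)` is a multiple of the product of the functions `-(1 - e^{-v})`. The pathwise
integrals with respect to the factorial measures are handled by the multivariate Mecke equation
(`IsPoissonProcess.multivariate_mecke`), which also shows that the expected differences of an `L²`
functional exist and depend continuously on it.

The formulas for `D_x L⁻¹ F` and `D²_{x,y} L⁻¹ F` follow pathwise from Mehler's formula. A point added
to the configuration is retained by the thinning with probability `s`, independently of everything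
else (`mehlerMeasure_add_dirac`), whence `D_x P_s = s P_s D_x` (`integrable_diffOp_mehlerMeasure`).
Adding points distributed according to `lam` preserves the null sets of the law of `η`, so the formula
for `L⁻¹ F` may be used at `η`, `η + δ_x`, `η + δ_y` and `η + δ_x + δ_y`, whatever the representatives.

The moment inequalities are Jensen's inequality applied to these formulas, together with the
invariance of the law of `η` under thinning with added noise (`lintegral_mehlerMeasure`). Subtracting
`𝔼 F` changes neither the differences nor `L⁻¹ F`, so that `F` need not be centred.
-/

noncomputable section

namespace PoissonMehler

section

variable {X : Type*} [MeasurableSpace X] {Ω : Type*} [MeasurableSpace Ω]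

/-! ### A functional monotone class theorem -/

/-- The functional monotone class theorem: a class of functions that is closed under linear
combinations and bounded pointwise limits, and contains a multiplicative class `C` of `[0,
1]`-valued functions generating the σ-field, contains all indicator functions. The indicators that
are bounded limits of polynomials in elements of `C` form a generating π-system. -/
theorem multiplicative_class {E : Type*} [m : MeasurableSpace E] (C : Submonoid (E → ℝ))
    (hmeas : ∀ f ∈ C, Measurable f) (h01 : ∀ f ∈ C, ∀ x, f x ∈ Set.Icc (0 : ℝ) 1)
    (hgen : m ≤ ⨆ f ∈ C, (borel ℝ).comap f) (V : (E → ℝ) → Prop)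
    (hC : ∀ f ∈ C, V f) (hadd : ∀ f g, V f → V g → V (f + g)) (hsmul : ∀ (c : ℝ) f, V f → V (c • f))
    (hlim : ∀ (u : ℕ → E → ℝ) (g : E → ℝ) (M : ℝ), (∀ n, Measurable (u n)) → (∀ n, V (u n)) →
      (∀ n x, |u n x| ≤ M) → (∀ x, Tendsto (fun n => u n x) atTop (𝓝 (g x))) → V g)
    {A : Set E} (hA : MeasurableSet A) : V (A.indicator 1) := by
  have hspan : (Algebra.adjoin ℝ (C : Set (E → ℝ))).toSubmodule = Submodule.span ℝ C := by
    rw [Algebra.adjoin_eq_span, Submonoid.closure_eq]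
  have hV : ∀ f ∈ Algebra.adjoin ℝ (C : Set (E → ℝ)), V f ∧ Measurable f := by
    intro f hf
    have hf' : f ∈ Submodule.span ℝ (C : Set (E → ℝ)) := by rw [← hspan]; exact hf
    induction hf' using Submodule.span_induction with
    | mem x h => exact ⟨hC x h, hmeas x h⟩
    | zero => exact ⟨by simpa using hsmul 0 1 (hC 1 C.one_mem), measurable_zero⟩
    | add x y hx hy h1 h2 =>
      have h1 := h1 (by rwa [← Subalgebra.mem_toSubmodule, hspan])
      have h2 := h2 (by rwa [← Subalgebra.mem_toSubmodule, hspan])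
      exact ⟨hadd _ _ h1.1 h2.1, h1.2.add h2.2⟩
    | smul a x hx h1 =>
      have h1 := h1 (by rwa [← Subalgebra.mem_toSubmodule, hspan])
      exact ⟨hsmul _ _ h1.1, h1.2.const_smul a⟩
  let S : Set (Set E) := {A | ∃ (u : ℕ → E → ℝ) (M : ℝ),
    (∀ n, u n ∈ Algebra.adjoin ℝ (C : Set (E → ℝ))) ∧ (∀ n x, |u n x| ≤ M) ∧
    ∀ x, Tendsto (fun n => u n x) atTop (𝓝 (A.indicator 1 x))}
  have hS : IsPiSystem S := by
    rintro A ⟨u, M, hu, hM, hl⟩ B ⟨w, N, hw, hN, hl'⟩ -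
    refine ⟨fun n => u n * w n, M * N, fun n => mul_mem (hu n) (hw n), fun n x => ?_, fun x => ?_⟩
    · change |u n x * w n x| ≤ _
      rw [abs_mul]
      exact mul_le_mul (hM n x) (hN n x) (abs_nonneg _) ((abs_nonneg _).trans (hM n x))
    · rw [Set.inter_indicator_one]
      exact (hl x).mul (hl' x)
  have hSm : ∀ A ∈ S, MeasurableSet A := by
    rintro A ⟨u, M, hu, -, hl⟩
    have : Measurable (A.indicator (1 : E → ℝ)) :=
      measurable_of_tendsto_metrizable (fun n => (hV _ (hu n)).2) (tendsto_pi_nhds.2 hl)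
    exact (measurable_indicator_const_iff (1 : ℝ)).1 this
  -- The indicator of `{f > t}` is the limit of `min 1 (n * (f - t)⁺)`, and on `[0, 1]` each of
  -- these continuous functions of `f` is uniformly close to a polynomial, by Weierstrass.
  have hgt : ∀ f ∈ C, ∀ t : ℝ, f ⁻¹' Set.Ioi t ∈ S := by
    intro f hf t
    have hp : ∀ n : ℕ, ∃ p : Polynomial ℝ, ∀ y ∈ Set.Icc (0 : ℝ) 1,
        |p.eval y - min 1 (n * max (y - t) 0)| < 1 / ((n : ℝ) + 1) := by
      intro n
      exact exists_polynomial_near_of_continuousOn 0 1 _ (by fun_prop) _ (by positivity)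
    choose p hp using hp
    refine ⟨fun n => Polynomial.aeval f (p n), 2, fun n => ?_, fun n x => ?_, fun x => ?_⟩
    · exact Algebra.adjoin_mono (Set.singleton_subset_iff.2 hf)
        (Polynomial.aeval_mem_adjoin_singleton ℝ f)
    · change |(Polynomial.aeval f) (p n) x| ≤ 2
      rw [Polynomial.aeval_fn_apply]
      have h1 := hp n (f x) (h01 f hf x)
      have h2 : |min 1 ((n : ℝ) * max (f x - t) 0)| ≤ 1 := by
        rw [abs_of_nonneg (le_min zero_le_one (by positivity))]
        exact min_le_left _ _
      have h3 : 1 / ((n : ℝ) + 1) ≤ 1 := by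
        rw [div_le_one (by positivity)]; linarith [n.cast_nonneg (α := ℝ)]
      simp only [Polynomial.coe_aeval_eq_eval]
      have := abs_sub_abs_le_abs_sub ((p n).eval (f x)) (min 1 ((n : ℝ) * max (f x - t) 0))
      linarith
    · have h1 : Tendsto (fun n : ℕ => min 1 ((n : ℝ) * max (f x - t) 0)) atTop
          (𝓝 ((f ⁻¹' Set.Ioi t).indicator 1 x)) := by
        by_cases hx : t < f x
        · rw [Set.indicator_of_mem (by simpa using hx), Pi.one_apply]
          have : Tendsto (fun n : ℕ => (n : ℝ) * max (f x - t) 0) atTop atTop :=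
            Tendsto.atTop_mul_const (lt_max_of_lt_left (by linarith)) tendsto_natCast_atTop_atTop
          refine tendsto_const_nhds.congr' ?_
          filter_upwards [this.eventually_ge_atTop 1] with n hn
          exact (min_eq_left hn).symm
        · rw [Set.indicator_of_notMem (by simpa using hx)]
          simp [max_eq_right (sub_nonpos.2 (not_lt.1 hx))]
      have h2 : Tendsto (fun n : ℕ => (p n).eval (f x) - min 1 ((n : ℝ) * max (f x - t) 0)) atTop
          (𝓝 0) :=
        squeeze_zero_norm (fun n => (hp n (f x) (h01 f hf x)).le)
          tendsto_one_div_add_atTop_nhds_zero_nat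
      have := h2.add h1
      simp only [sub_add_cancel, zero_add] at this
      refine this.congr fun n => ?_
      change _ = (Polynomial.aeval f) (p n) x
      rw [Polynomial.aeval_fn_apply, Polynomial.coe_aeval_eq_eval]
  have hgenS : m = MeasurableSpace.generateFrom S := by
    refine le_antisymm (hgen.trans (iSup₂_le fun f hf => ?_))
      (MeasurableSpace.generateFrom_le hSm)
    rw [borel_eq_generateFrom_Ioi, MeasurableSpace.comap_generateFrom]
    refine MeasurableSpace.generateFrom_mono ?_
    rintro _ ⟨_, ⟨t, rfl⟩, rfl⟩
    exact hgt f hf t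
  induction A, hA using MeasurableSpace.induction_on_inter hgenS hS with
  | empty =>
    rw [Set.indicator_empty']
    simpa using hsmul 0 1 (hC 1 C.one_mem)
  | basic A hA =>
    obtain ⟨u, M, hu, hM, hl⟩ := hA
    exact hlim u _ M (fun n => (hV _ (hu n)).2) (fun n => (hV _ (hu n)).1) hM hl
  | compl A hA ih =>
    have := hadd _ _ (hC 1 C.one_mem) (hsmul (-1) _ ih)
    rw [Set.indicator_compl]
    convert this using 1
    ext x; simp [sub_eq_add_neg]
  | iUnion A hd hA ih =>
    have hfin : ∀ n : ℕ, V (∑ i ∈ Finset.range n, (A i).indicator 1) := by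
      intro n
      induction n with
      | zero => simpa using hsmul 0 1 (hC 1 C.one_mem)
      | succ n ihn => rw [Finset.sum_range_succ]; exact hadd _ _ ihn (ih n)
    have hun : ∀ n : ℕ, ∑ i ∈ Finset.range n, (A i).indicator (1 : E → ℝ)
        = (⋃ i ∈ Finset.range n, A i).indicator 1 := by
      intro n
      ext x
      rw [Finset.indicator_biUnion (Finset.range n) A (fun i _ j _ hij => hd hij)]
      simp
    refine hlim _ _ 1 (fun n => ?_) hfin (fun n x => ?_) (fun x => ?_)
    · rw [hun]
      exact measurable_one.indicator (Finset.measurableSet_biUnion _ fun i _ => hA i)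
    · rw [hun]
      by_cases hx : x ∈ ⋃ i ∈ Finset.range n, A i
      · rw [Set.indicator_of_mem hx]; simp
      · rw [Set.indicator_of_notMem hx]; simp
    · by_cases hx : ∃ i, x ∈ A i
      · obtain ⟨i, hi⟩ := hx
        rw [Set.indicator_of_mem (Set.mem_iUnion.2 ⟨i, hi⟩)]
        refine tendsto_const_nhds.congr' ?_
        filter_upwards [eventually_gt_atTop i] with n hn
        rw [hun, Set.indicator_of_mem]
        simp only [Finset.mem_range, Set.mem_iUnion]
        exact ⟨i, hn, hi⟩
      · rw [Set.indicator_of_notMem (by simpa using hx)]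
        refine tendsto_const_nhds.congr fun n => ?_
        rw [hun, Set.indicator_of_notMem]
        simp only [Set.mem_iUnion, not_exists]
        exact fun i _ hi => hx ⟨i, hi⟩

/-! ### The exponential `a ↦ e^{-a}` on `[0, ∞]` -/

/-- The function `a ↦ e^{-a}` on `[0, ∞]`, with `e^{-∞} = 0`. -/
def expNeg (a : ℝ≥0∞) : ℝ := (EReal.exp (-(a : EReal))).toReal

lemma exp_neg_coe_ne_top (a : ℝ≥0∞) : EReal.exp (-(a : EReal)) ≠ ∞ := by
  simp

lemma expNeg_add (a b : ℝ≥0∞) : expNeg (a + b) = expNeg a * expNeg b := by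
  rw [expNeg, expNeg, expNeg, ← ENNReal.toReal_mul, ← EReal.exp_add, EReal.coe_ennreal_add,
    EReal.neg_add (by simp) (by simp), sub_eq_add_neg]

lemma expNeg_coe (r : ℝ≥0) : expNeg r = Real.exp (-r) := by
  rw [expNeg, show ((r : ℝ≥0∞) : EReal) = ((r : ℝ) : EReal) from rfl, ← EReal.coe_neg, EReal.exp_coe,
    ENNReal.toReal_ofReal (Real.exp_pos _).le]

lemma expNeg_of_ne_top {a : ℝ≥0∞} (h : a ≠ ∞) : expNeg a = Real.exp (-a.toReal) := by
  lift a to ℝ≥0 using h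
  simpa using expNeg_coe a

@[simp] lemma expNeg_zero : expNeg 0 = 1 := by simp [expNeg]

@[simp] lemma expNeg_top : expNeg ∞ = 0 := by simp [expNeg]

lemma continuous_expNeg : Continuous expNeg := by
  have h : Continuous fun a : ℝ≥0∞ => EReal.exp (-(a : EReal)) :=
    ENNReal.continuous_exp.comp (continuous_neg.comp continuous_coe_ennreal_ereal)
  exact ENNReal.continuousOn_toReal.comp_continuous h exp_neg_coe_ne_top

@[fun_prop] lemma measurable_expNeg : Measurable expNeg := continuous_expNeg.measurable

lemma expNeg_nonneg (a : ℝ≥0∞) : 0 ≤ expNeg a := ENNReal.toReal_nonneg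

lemma expNeg_le_one (a : ℝ≥0∞) : expNeg a ≤ 1 := by
  by_cases h : a = ∞
  · simp [h]
  · rw [expNeg_of_ne_top h]
    simp

lemma expNeg_sum {ι : Type*} (s : Finset ι) (a : ι → ℝ≥0∞) :
    expNeg (∑ i ∈ s, a i) = ∏ i ∈ s, expNeg (a i) := by
  classical
  induction s using Finset.induction_on with
  | empty => simp
  | insert i s hi ih => rw [Finset.sum_insert hi, Finset.prod_insert hi, expNeg_add, ih]

lemma measurable_of_measurable_expNeg {E : Type*} [MeasurableSpace E] {g : E → ℝ≥0∞}
    (h : Measurable fun x => expNeg (g x)) : Measurable g := by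
  have hψ : Measurable fun y : ℝ => if y = 0 then ∞ else ENNReal.ofReal (-Real.log y) :=
    Measurable.ite (measurableSet_singleton 0) measurable_const (by fun_prop)
  convert hψ.comp h using 1
  ext x
  simp only [Function.comp]
  by_cases hx : g x = ∞
  · simp [hx]
  · rw [expNeg_of_ne_top hx, if_neg (Real.exp_pos _).ne', Real.log_exp, neg_neg,
      ENNReal.ofReal_toReal hx]

/-! ### Exponential functionals of configurations -/

/-- The exponential functional `μ ↦ exp(-∫ v dμ)`. -/
def expFun (v : SimpleFunc X ℝ≥0) (μ : Measure X) : ℝ := expNeg (∫⁻ x, v x ∂μ)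

/-- The support of `v` has finite measure. -/
def FinSupp (lam : Measure X) (v : SimpleFunc X ℝ≥0) : Prop := lam (Function.support v) ≠ ∞

lemma expFun_nonneg (v : SimpleFunc X ℝ≥0) (μ : Measure X) : 0 ≤ expFun v μ := expNeg_nonneg _

lemma expFun_le_one (v : SimpleFunc X ℝ≥0) (μ : Measure X) : expFun v μ ≤ 1 := expNeg_le_one _

lemma abs_expFun_le_one (v : SimpleFunc X ℝ≥0) (μ : Measure X) : |expFun v μ| ≤ 1 := by
  rw [abs_of_nonneg (expFun_nonneg v μ)]; exact expFun_le_one v μ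

@[fun_prop] lemma measurable_expFun (v : SimpleFunc X ℝ≥0) : Measurable (expFun v) :=
  measurable_expNeg.comp (Measure.measurable_lintegral (by fun_prop))

lemma expFun_add_measure (v : SimpleFunc X ℝ≥0) (μ ν : Measure X) :
    expFun v (μ + ν) = expFun v μ * expFun v ν := by
  rw [expFun, lintegral_add_measure, expNeg_add]; rfl

lemma expFun_dirac (v : SimpleFunc X ℝ≥0) (x : X) :
    expFun v (Measure.dirac x) = Real.exp (-(v x : ℝ)) := by
  rw [expFun, lintegral_dirac' _ (by fun_prop), expNeg_coe]

lemma expFun_sum_dirac (v : SimpleFunc X ℝ≥0) {ι : Type*} (s : Finset ι) (x : ι → X) :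
    expFun v (∑ j ∈ s, Measure.dirac (x j)) = ∏ j ∈ s, Real.exp (-(v (x j) : ℝ)) := by
  rw [expFun, lintegral_finsetSum_measure, expNeg_sum]
  exact Finset.prod_congr rfl fun j _ => expFun_dirac v (x j)

lemma expFun_mul (v w : SimpleFunc X ℝ≥0) : expFun v * expFun w = expFun (v + w) := by
  ext μ
  rw [Pi.mul_apply, expFun, expFun, ← expNeg_add, ← lintegral_add_left (by fun_prop)]
  simp [expFun]

lemma FinSupp.add {lam : Measure X} {v w : SimpleFunc X ℝ≥0} (hv : FinSupp lam v)
    (hw : FinSupp lam w) : FinSupp lam (v + w) := by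
  refine ne_top_of_le_ne_top (ENNReal.add_ne_top.2 ⟨hv, hw⟩)
    ((measure_mono ?_).trans (measure_union_le _ _))
  rw [SimpleFunc.coe_add]
  exact Function.support_add _ _

lemma finSupp_restrict_const {lam : Measure X} {B : Set X} (hB : MeasurableSet B) (h : lam B ≠ ∞)
    (c : ℝ≥0) : FinSupp lam ((SimpleFunc.const X c).restrict B) := by
  refine ne_top_of_le_ne_top h (measure_mono fun x hx => ?_)
  rw [Function.mem_support, SimpleFunc.restrict_apply _ hB] at hx
  exact Set.mem_of_indicator_ne_zero hx

lemma expFun_restrict_const {B : Set X} (hB : MeasurableSet B) (c : ℝ≥0) (μ : Measure X) :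
    expFun ((SimpleFunc.const X c).restrict B) μ = expNeg (c * μ B) := by
  have : ∀ x, (((SimpleFunc.const X c).restrict B x : ℝ≥0) : ℝ≥0∞)
      = B.indicator (fun _ => (c : ℝ≥0∞)) x := by
    intro x
    rw [SimpleFunc.restrict_apply _ hB]
    by_cases hx : x ∈ B <;> simp [hx]
  simp_rw [expFun, this]
  rw [lintegral_indicator_const hB]

/-- The exponential functionals whose test function has a support of finite measure. -/
def expClass (lam : Measure X) : Submonoid (Measure X → ℝ) where
  carrier := {f | ∃ v, FinSupp lam v ∧ f = expFun v}
  one_mem' := ⟨0, by simp [FinSupp], by ext μ; simp [expFun]⟩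
  mul_mem' := by
    rintro _ _ ⟨v, hv, rfl⟩ ⟨w, hw, rfl⟩
    exact ⟨v + w, hv.add hw, expFun_mul v w⟩

/-- The count of points in `B ∩ B_k`, for an exhausting sequence `B_k` of sets of finite measure, is
a measurable function of the exponential functional of its indicator; monotone limits give the count
in `B`. -/
lemma generate_expClass (lam : Measure X) [SigmaFinite lam] :
    (inferInstance : MeasurableSpace (Measure X)) ≤ ⨆ f ∈ expClass lam, (borel ℝ).comap f := by
  refine iSup₂_le fun B hB => ?_
  rw [← measurable_iff_comap_le]
  let m' : MeasurableSpace (Measure X) := ⨆ f ∈ expClass lam, (borel ℝ).comap f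
  have h : ∀ k, Measurable[m', borel ℝ≥0∞] fun μ : Measure X => μ (B ∩ spanningSets lam k) := by
    intro k
    have hBk := hB.inter (measurableSet_spanningSets lam k)
    let v : SimpleFunc X ℝ≥0 := (SimpleFunc.const X 1).restrict (B ∩ spanningSets lam k)
    have hv : FinSupp lam v :=
      finSupp_restrict_const hBk
        ((measure_mono Set.inter_subset_right).trans_lt (measure_spanningSets_lt_top lam k)).ne 1
    have hm : Measurable[m'] (expFun v) := by
      rw [measurable_iff_comap_le]
      have := le_iSup₂ (f := fun f (_ : f ∈ expClass lam) => (borel ℝ).comap f) (expFun v)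
        ⟨v, hv, rfl⟩
      rwa [← BorelSpace.measurable_eq (α := ℝ)] at this
    rw [← BorelSpace.measurable_eq (α := ℝ≥0∞)]
    refine @measurable_of_measurable_expNeg _ m' _ ?_
    convert hm using 1
    ext μ
    rw [expFun_restrict_const hBk]
    simp
  have h2 : (fun μ : Measure X => μ B) = fun μ => ⨆ k, μ (B ∩ spanningSets lam k) := by
    ext μ
    rw [← Monotone.measure_iUnion, ← Set.inter_iUnion, iUnion_spanningSets, Set.inter_univ]
    exact fun i j hij => Set.inter_subset_inter_right _ (monotone_spanningSets lam hij)
  rw [h2]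
  rw [← BorelSpace.measurable_eq (α := ℝ≥0∞)] at h ⊢
  exact Measurable.iSup h

/-- The monotone class theorem for exponential functionals. -/
theorem expFun_induction (lam : Measure X) [SigmaFinite lam] (V : (Measure X → ℝ) → Prop)
    (hC : ∀ v, FinSupp lam v → V (expFun v)) (hadd : ∀ f g, V f → V g → V (f + g))
    (hsmul : ∀ (c : ℝ) f, V f → V (c • f))
    (hlim : ∀ (u : ℕ → Measure X → ℝ) (g : Measure X → ℝ) (M : ℝ), (∀ n, Measurable (u n)) →
      (∀ n, V (u n)) → (∀ n x, |u n x| ≤ M) →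
      (∀ x, Tendsto (fun n => u n x) atTop (𝓝 (g x))) → V g)
    {A : Set (Measure X)} (hA : MeasurableSet A) : V (A.indicator 1) := by
  refine multiplicative_class (expClass lam) ?_ ?_ (generate_expClass lam) V ?_ hadd hsmul hlim hA
  · rintro _ ⟨v, -, rfl⟩; exact measurable_expFun v
  · rintro _ ⟨v, -, rfl⟩ μ; exact ⟨expFun_nonneg v μ, expFun_le_one v μ⟩
  · rintro _ ⟨v, hv, rfl⟩; exact hC v hv

lemma tendsto_integral_of_bounded {E : Type*} [MeasurableSpace E] (ρ : Measure E)
    {h : E → ℝ} (hh : Integrable h ρ) (u : ℕ → E → ℝ) (g : E → ℝ) (M : ℝ)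
    (hu : ∀ n, Measurable (u n)) (hM : ∀ n x, |u n x| ≤ M)
    (hl : ∀ x, Tendsto (fun n => u n x) atTop (𝓝 (g x))) :
    Integrable (fun x => h x * g x) ρ ∧
    Tendsto (fun n => ∫ x, h x * u n x ∂ρ) atTop (𝓝 (∫ x, h x * g x ∂ρ)) := by
  have hg : Measurable g := measurable_of_tendsto_metrizable hu (tendsto_pi_nhds.2 hl)
  refine ⟨hh.mul_bdd (c := M) hg.aestronglyMeasurable (ae_of_all _ fun x => ?_),
    tendsto_integral_of_dominated_convergence (fun x => ‖h x‖ * M)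
    (fun n => hh.aestronglyMeasurable.mul (hu n).aestronglyMeasurable) (hh.norm.mul_const M)
    (fun n => ae_of_all _ fun x => ?_) (ae_of_all _ fun x => (hl x).const_mul (h x))⟩
  · exact le_of_tendsto (hl x).norm (Eventually.of_forall fun n => hM n x)
  · rw [norm_mul]
    exact mul_le_mul_of_nonneg_left (hM n x) (norm_nonneg _)

/-- Two integrable densities with the same integrals against exponential functionals have the same
integrals over all measurable sets. -/
lemma setIntegral_eq_of_expFun (lam : Measure X) [SigmaFinite lam] {ρ₁ ρ₂ : Measure (Measure X)}
    {h₁ h₂ : Measure X → ℝ} (hi₁ : Integrable h₁ ρ₁) (hi₂ : Integrable h₂ ρ₂)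
    (h : ∀ v, FinSupp lam v → ∫ μ, h₁ μ * expFun v μ ∂ρ₁ = ∫ μ, h₂ μ * expFun v μ ∂ρ₂)
    {A : Set (Measure X)} (hA : MeasurableSet A) : ∫ μ in A, h₁ μ ∂ρ₁ = ∫ μ in A, h₂ μ ∂ρ₂ := by
  have hmul : ∀ (h : Measure X → ℝ) (μ), h μ * A.indicator 1 μ = A.indicator h μ := by
    intro h μ; by_cases hμ : μ ∈ A <;> simp [hμ]
  have := (expFun_induction lam (fun f => Integrable (fun μ => h₁ μ * f μ) ρ₁ ∧
    Integrable (fun μ => h₂ μ * f μ) ρ₂ ∧ ∫ μ, h₁ μ * f μ ∂ρ₁ = ∫ μ, h₂ μ * f μ ∂ρ₂)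
    ?_ ?_ ?_ ?_ hA).2.2
  · simp_rw [hmul, integral_indicator hA] at this
    exact this
  · intro v hv
    refine ⟨?_, ?_, h v hv⟩
    · exact hi₁.mul_bdd (c := 1) (measurable_expFun v).aestronglyMeasurable
        (ae_of_all _ fun μ => abs_expFun_le_one v μ)
    · exact hi₂.mul_bdd (c := 1) (measurable_expFun v).aestronglyMeasurable
        (ae_of_all _ fun μ => abs_expFun_le_one v μ)
  · rintro f g ⟨a1, a2, a3⟩ ⟨b1, b2, b3⟩
    simp only [Pi.add_apply, mul_add]
    exact ⟨a1.add b1, a2.add b2, by rw [integral_add a1 b1, integral_add a2 b2, a3, b3]⟩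
  · rintro c f ⟨a1, a2, a3⟩
    simp only [Pi.smul_apply, mul_smul_comm]
    exact ⟨a1.smul c, a2.smul c, by rw [integral_smul, integral_smul, a3]⟩
  · intro u g M hu hV hM hl
    obtain ⟨i1, l1⟩ := tendsto_integral_of_bounded ρ₁ hi₁ u g M hu hM hl
    obtain ⟨i2, l2⟩ := tendsto_integral_of_bounded ρ₂ hi₂ u g M hu hM hl
    refine ⟨i1, i2, tendsto_nhds_unique l1 (l2.congr fun n => ?_)⟩
    exact (hV n).2.2.symm

/-- A finite measure on the space of configurations is determined by its Laplace functional. -/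
theorem ext_of_expFun (lam : Measure X) [SigmaFinite lam] {ρ₁ ρ₂ : Measure (Measure X)}
    [IsFiniteMeasure ρ₁] [IsFiniteMeasure ρ₂]
    (h : ∀ v, FinSupp lam v → ∫ μ, expFun v μ ∂ρ₁ = ∫ μ, expFun v μ ∂ρ₂) : ρ₁ = ρ₂ := by
  ext A hA
  have := setIntegral_eq_of_expFun lam (integrable_const (μ := ρ₁) (1 : ℝ))
    (integrable_const (μ := ρ₂) (1 : ℝ)) (by simpa using h) hA
  simp only [setIntegral_const, smul_eq_mul, mul_one] at this
  rwa [measureReal_def, measureReal_def,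
    ENNReal.toReal_eq_toReal_iff' (measure_ne_top _ _) (measure_ne_top _ _)] at this

/-- An integrable functional that is orthogonal to all exponential functionals vanishes. -/
theorem ae_eq_zero_of_expFun (lam : Measure X) [SigmaFinite lam] {ρ : Measure (Measure X)}
    {h : Measure X → ℝ} (hi : Integrable h ρ)
    (h0 : ∀ v, FinSupp lam v → ∫ μ, h μ * expFun v μ ∂ρ = 0) : h =ᵐ[ρ] 0 := by
  refine hi.ae_eq_zero_of_forall_setIntegral_eq_zero fun A hA _ => ?_
  rw [setIntegral_eq_of_expFun lam hi (integrable_zero _ ℝ ρ) (by simpa using h0) hA]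
  simp

/-- A family of probability measures on the space of configurations depends measurably on
a parameter if its Laplace functionals do. -/
theorem measurable_of_expFun (lam : Measure X) [SigmaFinite lam] {T : Type*} [MeasurableSpace T]
    (κ : T → Measure (Measure X)) [∀ t, IsProbabilityMeasure (κ t)]
    (h : ∀ v, FinSupp lam v → Measurable fun t => ∫ μ, expFun v μ ∂(κ t)) : Measurable κ := by
  refine Measure.measurable_of_measurable_coe _ fun A hA => ?_
  have := (expFun_induction lam (fun f => (∀ t, Integrable f (κ t)) ∧
    Measurable fun t => ∫ μ, f μ ∂(κ t)) ?_ ?_ ?_ ?_ hA).2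
  · simp_rw [integral_indicator_one hA, measureReal_def] at this
    have h2 := this.ennreal_ofReal
    simpa only [ENNReal.ofReal_toReal (measure_ne_top _ _)] using h2
  · exact fun v hv => ⟨fun t => Integrable.of_bound (measurable_expFun v).aestronglyMeasurable 1
      (ae_of_all _ fun μ => abs_expFun_le_one v μ), h v hv⟩
  · rintro f g ⟨a1, a2⟩ ⟨b1, b2⟩
    refine ⟨fun t => (a1 t).add (b1 t), ?_⟩
    convert a2.add b2 using 1
    ext t; exact integral_add (a1 t) (b1 t)
  · rintro c f ⟨a1, a2⟩
    refine ⟨fun t => (a1 t).smul c, ?_⟩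
    convert a2.const_smul c using 1
    ext t; exact integral_smul c f
  · intro u g M hu hV hM hl
    have := fun t => tendsto_integral_of_bounded (κ t) (integrable_const (1 : ℝ)) u g M hu hM hl
    simp only [one_mul] at this
    exact ⟨fun t => (this t).1, measurable_of_tendsto_metrizable (fun n => (hV n).2)
      (tendsto_pi_nhds.2 fun t => (this t).2)⟩

end

section

variable {X : Type*} [MeasurableSpace X] {Ω : Type*} [MeasurableSpace Ω]

/-! ### Laplace functionals -/

/-- The function `1 - e^{-v}`. -/
def decay (v : SimpleFunc X ℝ≥0) (x : X) : ℝ := 1 - Real.exp (-(v x : ℝ))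

@[fun_prop] lemma measurable_decay (v : SimpleFunc X ℝ≥0) : Measurable (decay v) := by
  have : Measurable fun x => (v x : ℝ) := v.measurable.coe_nnreal_real
  unfold decay
  fun_prop

lemma decay_nonneg (v : SimpleFunc X ℝ≥0) (x : X) : 0 ≤ decay v x := by simp [decay]

lemma decay_le_one (v : SimpleFunc X ℝ≥0) (x : X) : decay v x ≤ 1 := by
  simp [decay, (Real.exp_pos _).le]

lemma abs_decay_le_one (v : SimpleFunc X ℝ≥0) (x : X) : |decay v x| ≤ 1 := by
  rw [abs_of_nonneg (decay_nonneg v x)]; exact decay_le_one v x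

lemma support_decay_subset (v : SimpleFunc X ℝ≥0) :
    Function.support (decay v) ⊆ Function.support v := by
  intro x hx hv
  simp [decay, hv] at hx

lemma FinSupp.integrable_of_bounded {lam : Measure X} {v : SimpleFunc X ℝ≥0} (hv : FinSupp lam v)
    {g : X → ℝ} (hg : Measurable g) (M : ℝ) (hM : ∀ x, |g x| ≤ M)
    (hs : Function.support g ⊆ Function.support v) : Integrable g lam := by
  rw [← integrableOn_iff_integrable_of_support_subset hs]
  exact Measure.integrableOn_of_bounded hv hg.aestronglyMeasurable (ae_of_all _ hM)

lemma FinSupp.integrable_decay {lam : Measure X} {v : SimpleFunc X ℝ≥0} (hv : FinSupp lam v) :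
    Integrable (decay v) lam :=
  hv.integrable_of_bounded (measurable_decay v) 1 (abs_decay_le_one v) (support_decay_subset v)

lemma FinSupp.integral_decay {lam : Measure X} {v : SimpleFunc X ℝ≥0} (hv : FinSupp lam v) :
    ∫ x, decay v x ∂lam = ∑ c ∈ v.range, lam.real (v ⁻¹' {c}) * (1 - Real.exp (-(c : ℝ))) := by
  have h : ∀ x, decay v x
      = ∑ c ∈ v.range, (v ⁻¹' {c}).indicator (fun _ => 1 - Real.exp (-(c : ℝ))) x := by
    intro x
    rw [Finset.sum_eq_single_of_mem (v x) (v.mem_range_self x)]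
    · simp [decay]
    · intro c _ hc
      exact Set.indicator_of_notMem (fun hx => hc hx.symm) _
  simp_rw [h]
  rw [integral_finsetSum]
  · exact Finset.sum_congr rfl fun c _ => by
      rw [integral_indicator_const _ (v.measurableSet_preimage _), smul_eq_mul]
  · intro c _
    by_cases hc : c = 0
    · simp [hc]
    · rw [integrable_indicator_iff (v.measurableSet_preimage _)]
      refine integrableOn_const (ne_top_of_le_ne_top hv (measure_mono fun x hx => ?_)) (by simp)
      rw [Function.mem_support, show v x = c from hx]
      exact hc

/-- `Q` is the distribution of a Poisson process with intensity measure `lam`, expressed by its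
Laplace functional. -/
structure IsPoissonLaw (lam : Measure X) (Q : Measure (Measure X)) : Prop where
  isProbabilityMeasure : IsProbabilityMeasure Q
  integral_expFun : ∀ v, FinSupp lam v → ∫ μ, expFun v μ ∂Q = Real.exp (-∫ x, decay v x ∂lam)

lemma integrable_expFun {ρ : Measure (Measure X)} [IsFiniteMeasure ρ] (v : SimpleFunc X ℝ≥0) :
    Integrable (expFun v) ρ :=
  Integrable.of_bound (measurable_expFun v).aestronglyMeasurable 1
    (ae_of_all _ fun μ => abs_expFun_le_one v μ)

lemma integral_poisson_expNeg (r a : ℝ≥0) :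
    ∫ n : ℕ, expNeg (a * n) ∂(poissonMeasure r) = Real.exp (-(r * (1 - Real.exp (-(a : ℝ))))) := by
  rw [integral_poissonMeasure]
  have h : ∀ n : ℕ, expNeg (a * n) = Real.exp (-(a : ℝ)) ^ n := by
    intro n
    rw [show (a : ℝ≥0∞) * n = ((a * n : ℝ≥0) : ℝ≥0∞) by push_cast; rfl, expNeg_coe,
      ← Real.exp_nat_mul]
    push_cast
    ring_nf
  simp_rw [h]
  have hs := (NormedSpace.expSeries_div_hasSum_exp ((r : ℝ) * Real.exp (-(a : ℝ)))).mul_left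
    (Real.exp (-(r : ℝ)))
  rw [← Real.exp_eq_exp_ℝ, ← Real.exp_add] at hs
  rw [show -((r : ℝ) * (1 - Real.exp (-(a : ℝ)))) = -r + r * Real.exp (-(a : ℝ)) by ring,
    ← hs.tsum_eq]
  refine tsum_congr fun n => ?_
  rw [smul_eq_mul, mul_pow]
  ring

/-- The Laplace functional of a Poisson process factorizes over the level sets of a simple function,
since the counts in these disjoint sets are independent Poisson variables. -/
theorem IsPoissonProcess.isPoissonLaw {P : Measure Ω} [IsProbabilityMeasure P]
    {η : Ω → Measure X} {lam : Measure X} (h : IsPoissonProcess P η lam) :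
    IsPoissonLaw lam (P.map η) := by
  refine ⟨Measure.isProbabilityMeasure_map h.measurable.aemeasurable, fun v hv => ?_⟩
  rw [integral_map h.measurable.aemeasurable (measurable_expFun v).aestronglyMeasurable]
  let e := v.range.equivFin
  let B : Fin v.range.card → Set X := fun i => v ⁻¹' {((e.symm i : v.range) : ℝ≥0)}
  let a : Fin v.range.card → ℝ≥0 := fun i => ((e.symm i : v.range) : ℝ≥0)
  have hB : ∀ i, MeasurableSet (B i) := fun i => v.measurableSet_preimage _
  have hd : Pairwise (Function.onFun Disjoint B) := by
    intro i j hij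
    refine Disjoint.preimage _ (Set.disjoint_singleton.2 fun hc => hij ?_)
    exact e.symm.injective (Subtype.ext hc)
  have hsum : ∀ (g : ℝ≥0 → ℝ≥0∞) (ν : Measure X),
      ∑ c ∈ v.range, g c * ν (v ⁻¹' {c}) = ∑ i, g (a i) * ν (B i) := by
    intro g ν
    rw [← Finset.sum_coe_sort]
    exact (Equiv.sum_comp e.symm fun c : v.range => g c * ν (v ⁻¹' {(c : ℝ≥0)})).symm
  have hexp : ∀ ω, expFun v (η ω) = ∏ i, expNeg (a i * η ω (B i)) := by
    intro ω
    rw [← expNeg_sum, ← hsum (fun c => (c : ℝ≥0∞)), expFun, ← SimpleFunc.map_lintegral,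
      ← SimpleFunc.lintegral_eq_lintegral]
    rfl
  simp_rw [hexp]
  have hind := h.indep _ B hB hd
  have hind' : iIndepFun (fun i ω => expNeg (a i * η ω (B i))) P :=
    hind.comp (fun i y => expNeg (a i * y)) (fun i => by fun_prop)
  have hmeas : ∀ i, Measurable fun ω => η ω (B i) :=
    fun i => (Measure.measurable_coe (hB i)).comp h.measurable
  rw [hind'.integral_fun_prod_eq_prod_integral
    (fun i => (measurable_expNeg.comp ((hmeas i).const_mul _)).aestronglyMeasurable)]
  have hma : ∀ i, Measurable fun y => expNeg (a i * y) :=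
    fun i => measurable_expNeg.comp (measurable_id.const_mul _)
  have hone : ∀ i, ∫ ω, expNeg (a i * η ω (B i)) ∂P
      = Real.exp (-((lam.real (B i)) * (1 - Real.exp (-(a i : ℝ))))) := by
    intro i
    by_cases ha : a i = 0
    · simp [ha]
    · have hfin : lam (B i) ≠ ∞ := by
        refine ne_top_of_le_ne_top hv (measure_mono fun x hx => ?_)
        rw [Function.mem_support, show v x = a i from hx]
        exact ha
      have := h.poisson (B i) (hB i) hfin
      rw [← integral_map (f := fun y => expNeg (a i * y)) (hmeas i).aemeasurable
        (hma i).aestronglyMeasurable, this, integral_map (by fun_prop)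
        (hma i).aestronglyMeasurable, integral_poisson_expNeg]
      rfl
  simp_rw [hone]
  rw [← Real.exp_sum, Finset.sum_neg_distrib]
  congr 2
  rw [hv.integral_decay, ← Finset.sum_coe_sort v.range]
  exact (Equiv.sum_comp e.symm fun c : v.range =>
    lam.real (v ⁻¹' {(c : ℝ≥0)}) * (1 - Real.exp (-((c : ℝ≥0) : ℝ))))

/-! ### Superpositions of independent configurations -/

/-- The Laplace functional of a countable superposition of independent configurations is the product
of the Laplace functionals. -/
lemma tendsto_integral_expFun_sum {E : ℕ → Type*} [∀ i, MeasurableSpace (E i)]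
    (m : ∀ i, Measure (E i)) [∀ i, IsProbabilityMeasure (m i)] (χ : ∀ i, E i → Measure X)
    (hχ : ∀ i, Measurable (χ i)) (v : SimpleFunc X ℝ≥0) :
    Tendsto (fun n => ∏ i ∈ Finset.range n, ∫ y, expFun v (χ i y) ∂(m i)) atTop
      (𝓝 (∫ y, expFun v (Measure.sum fun i => χ i (y i)) ∂(Measure.infinitePi m))) := by
  have hm : ∀ i, Measurable fun y => expFun v (χ i y) := fun i => (measurable_expFun v).comp (hχ i)
  have hfin : ∀ n, ∫ y, ∏ i ∈ Finset.range n, expFun v (χ i (y i)) ∂(Measure.infinitePi m)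
      = ∏ i ∈ Finset.range n, ∫ y, expFun v (χ i y) ∂(m i) := by
    intro n
    have h1 := integral_restrict_infinitePi (μ := m) (s := Finset.range n)
      (f := fun y => ∏ i : Finset.range n, expFun v (χ i (y i)))
      (Finset.measurable_prod _ fun (i : Finset.range n) _ =>
        (hm i).comp (measurable_pi_apply i)).aestronglyMeasurable
    rw [integral_fintype_prod_eq_prod (f := fun (i : Finset.range n) y => expFun v (χ i y)),
      Finset.prod_coe_sort (Finset.range n) (fun i => ∫ y, expFun v (χ i y) ∂(m i))] at h1
    rw [← h1]
    congr 1
    ext y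
    rw [← Finset.prod_coe_sort]
    rfl
  simp_rw [← hfin]
  refine tendsto_integral_of_dominated_convergence (fun _ => 1) (fun n => ?_) (integrable_const _)
    (fun n => ae_of_all _ fun y => ?_) (ae_of_all _ fun y => ?_)
  · exact (Finset.measurable_prod _ fun i _ =>
      (hm i).comp (measurable_pi_apply i)).aestronglyMeasurable
  · rw [Real.norm_eq_abs, Finset.abs_prod]
    exact Finset.prod_le_one (fun i _ => abs_nonneg _) fun i _ => abs_expFun_le_one _ _
  · simp_rw [expFun, ← expNeg_sum, lintegral_sum_measure]
    exact (continuous_expNeg.tendsto _).comp (ENNReal.tendsto_nat_tsum _)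

lemma measurable_measure_sum : Measurable fun χ : ℕ → Measure X => Measure.sum χ := by
  refine Measure.measurable_of_measurable_coe _ fun B hB => ?_
  simp_rw [Measure.sum_apply _ hB]
  exact Measurable.tsum fun i => (Measure.measurable_coe hB).comp (measurable_pi_apply i)

/-- A Poisson number of independent points: the sum over the number of points is an exponential
series. -/
lemma integral_expFun_finitePoissonLaw (ν : Measure X) [IsFiniteMeasure ν] (v : SimpleFunc X ℝ≥0) :
    ∫ μ, expFun v μ ∂(finitePoissonLaw ν) = Real.exp (-∫ x, decay v x ∂ν) := by
  have hi : Integrable (expFun v) (finitePoissonLaw ν) := integrable_expFun v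
  have hme : Measurable fun x => Real.exp (-(v x : ℝ)) := by
    have : Measurable fun x => (v x : ℝ) := v.measurable.coe_nnreal_real
    fun_prop
  have hie : Integrable (fun x => Real.exp (-(v x : ℝ))) ν :=
    Integrable.of_bound hme.aestronglyMeasurable 1 (ae_of_all _ fun x => by simp)
  rw [finitePoissonLaw, integrable_smul_measure (by simp [Real.exp_pos]) (by simp)] at hi
  rw [finitePoissonLaw, integral_smul_measure, ← (hasSum_integral_measure hi).tsum_eq]
  have hk : ∀ k : ℕ, ∫ μ, expFun v μ ∂((k.factorial : ℝ≥0∞)⁻¹ • (Measure.pi fun _ : Fin k => ν).map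
      fun x => ∑ j, Measure.dirac (x j)) = (∫ x, Real.exp (-(v x : ℝ)) ∂ν) ^ k / k.factorial := by
    intro k
    rw [integral_smul_measure, integral_map (measurable_sum_dirac k).aemeasurable
      (measurable_expFun v).aestronglyMeasurable]
    simp_rw [expFun_sum_dirac]
    rw [integral_fintype_prod_eq_pow (ι := Fin k) (fun x => Real.exp (-(v x : ℝ))), Fintype.card_fin]
    simp [div_eq_inv_mul]
  simp_rw [hk]
  have hs := NormedSpace.expSeries_div_hasSum_exp (∫ x, Real.exp (-(v x : ℝ)) ∂ν)
  rw [← Real.exp_eq_exp_ℝ] at hs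
  rw [hs.tsum_eq, ENNReal.toReal_ofReal (Real.exp_pos _).le, smul_eq_mul, ← Real.exp_add]
  congr 1
  simp only [decay]
  rw [integral_sub (integrable_const _) hie]
  simp [measureReal_def, sub_eq_add_neg, add_comm]

instance isProbabilityMeasure_poissonLaw (ν : Measure X) [SFinite ν] :
    IsProbabilityMeasure (poissonLaw ν) :=
  Measure.isProbabilityMeasure_map measurable_measure_sum.aemeasurable

theorem isPoissonLaw_poissonLaw (ν : Measure X) [SFinite ν] : IsPoissonLaw ν (poissonLaw ν) := by
  refine ⟨inferInstance, fun v hv => ?_⟩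
  rw [poissonLaw, integral_map measurable_measure_sum.aemeasurable
    (measurable_expFun v).aestronglyMeasurable]
  have h1 := tendsto_integral_expFun_sum (fun n => finitePoissonLaw (sfiniteSeq ν n))
    (fun _ => id) (fun _ => measurable_id) v
  refine tendsto_nhds_unique h1 ?_
  simp only [id, integral_expFun_finitePoissonLaw]
  simp_rw [← Real.exp_sum]
  refine (Real.continuous_exp.tendsto _).comp ?_
  simp_rw [Finset.sum_neg_distrib]
  have hi : Integrable (decay v) (Measure.sum (sfiniteSeq ν)) := by
    rw [sum_sfiniteSeq]; exact hv.integrable_decay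
  have := (hasSum_integral_measure hi).tendsto_sum_nat
  rw [sum_sfiniteSeq] at this
  exact this.neg

/-! ### Thinning -/

/-- The value of `-log (1 - s + s e^{-c})`. -/
def thinVal (s : I) (c : ℝ≥0) : ℝ≥0 := (-Real.log (1 - s + s * Real.exp (-(c : ℝ)))).toNNReal

lemma thin_aux (s : I) (c : ℝ≥0) :
    0 < 1 - (s : ℝ) + s * Real.exp (-(c : ℝ)) ∧ 1 - (s : ℝ) + s * Real.exp (-(c : ℝ)) ≤ 1 := by
  have h0 := s.2.1
  have h1 := s.2.2
  have h2 : Real.exp (-(c : ℝ)) ≤ 1 := by simp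
  have h3 := Real.exp_pos (-(c : ℝ))
  refine ⟨?_, by nlinarith⟩
  rcases h0.eq_or_lt with h | h
  · rw [← h]; norm_num
  · nlinarith

lemma exp_neg_thinVal (s : I) (c : ℝ≥0) :
    Real.exp (-(thinVal s c : ℝ)) = 1 - s + s * Real.exp (-(c : ℝ)) := by
  obtain ⟨h1, h2⟩ := thin_aux s c
  rw [thinVal, Real.coe_toNNReal _ (neg_nonneg.2 (Real.log_nonpos h1.le h2)), neg_neg,
    Real.exp_log h1]

@[simp] lemma thinVal_zero (s : I) : thinVal s 0 = 0 := by simp [thinVal]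

/-- The test function `-log (1 - s + s e^{-v})`, whose exponential functional is the conditional
expectation of the exponential functional of `v` under `s`-thinning. -/
def thin (s : I) (v : SimpleFunc X ℝ≥0) : SimpleFunc X ℝ≥0 := v.map (thinVal s)

lemma decay_thin (s : I) (v : SimpleFunc X ℝ≥0) (x : X) : decay (thin s v) x = s * decay v x := by
  simp only [decay, thin, SimpleFunc.map_apply, exp_neg_thinVal]
  ring

lemma FinSupp.thin {lam : Measure X} {v : SimpleFunc X ℝ≥0} (hv : FinSupp lam v) (s : I) :
    FinSupp lam (thin s v) := by
  refine ne_top_of_le_ne_top hv (measure_mono fun x hx hx' => hx ?_)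
  simp [PoissonMehler.thin, hx']

lemma measurable_expFun_thin (v : SimpleFunc X ℝ≥0) :
    Measurable fun z : I × Measure X => expFun (thin z.1 v) z.2 := by
  have h : ∀ z : I × Measure X, ∫⁻ x, thin z.1 v x ∂z.2
      = ∑ c ∈ v.range, (thinVal z.1 c : ℝ≥0∞) * z.2 (v ⁻¹' {c}) := by
    intro z
    rw [← SimpleFunc.map_lintegral (fun c => (thinVal z.1 c : ℝ≥0∞)),
      ← SimpleFunc.lintegral_eq_lintegral]
    rfl
  simp_rw [expFun, h]
  refine measurable_expNeg.comp (Finset.measurable_fun_sum _ fun c _ => ?_)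
  refine Measurable.mul ?_ ((Measure.measurable_coe (v.measurableSet_preimage _)).comp
    measurable_snd)
  unfold thinVal
  have : Measurable fun z : I × Measure X => (z.1 : ℝ) := measurable_subtype_coe.comp measurable_fst
  fun_prop

lemma IsPoint.eq_zero_or_ae_eq {ν : Measure X} (hν : IsPoint ν) (v : SimpleFunc X ℝ≥0) :
    ν = 0 ∨ ν Set.univ = 1 ∧ ∃ c, ∀ᵐ x ∂ν, v x = c := by
  rcases hν _ MeasurableSet.univ with h0 | h1
  · exact Or.inl (Measure.measure_univ_eq_zero.1 h0)
  · refine Or.inr ⟨h1, ?_⟩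
    by_contra! hcon
    have hz : ∀ c, ν (v ⁻¹' {c}) = 0 := by
      intro c
      refine (hν _ (v.measurableSet_preimage _)).resolve_right fun hc => hcon c ?_
      have : ν (v ⁻¹' {c})ᶜ = 0 := by
        rw [measure_compl (v.measurableSet_preimage _) (by simp [hc]), hc, h1, tsub_self]
      filter_upwards [measure_eq_zero_iff_ae_notMem.1 this] with x hx hx'
      exact hx (by simpa using hx')
    have : ν Set.univ ≤ ∑ c ∈ v.range, ν (v ⁻¹' {c}) := by
      refine (measure_mono fun x _ => ?_).trans (measure_biUnion_finset_le _ _)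
      exact Set.mem_biUnion (v.mem_range_self x) rfl
    simp [hz, h1] at this

/-- Retaining a single point with probability `s` replaces the test function `v` by `thin s v`. -/
lemma IsPoint.thinned {ν : Measure X} (hν : IsPoint ν) (s : I) (v : SimpleFunc X ℝ≥0) :
    s * expFun v ν + (1 - s) = expFun (thin s v) ν := by
  rcases hν.eq_zero_or_ae_eq v with rfl | ⟨h1, c, hc⟩
  · simp [expFun]
  · have h2 : ∀ φ : ℝ≥0 → ℝ≥0, ∫⁻ x, (v.map φ x : ℝ≥0∞) ∂ν = φ c := by
      intro φ
      rw [lintegral_congr_ae (g := fun _ => (φ c : ℝ≥0∞))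
        (hc.mono fun x hx => by simp only [SimpleFunc.map_apply, hx])]
      simp [h1]
    have h3 : ∫⁻ x, (v x : ℝ≥0∞) ∂ν = c := h2 id
    rw [expFun, expFun, h3, thin, h2 (thinVal s), expNeg_coe, expNeg_coe, exp_neg_thinVal]
    ring

lemma IsConfiguration.isPoint_points {μ : Measure X} (h : IsConfiguration μ) (i : ℕ) :
    IsPoint (points μ i) := by
  rw [points, dif_pos h.exists_points]
  exact h.exists_points.choose_spec.1 i

lemma IsConfiguration.sum_points {μ : Measure X} (h : IsConfiguration μ) :
    Measure.sum (points μ) = μ := by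
  rw [points, dif_pos h.exists_points]
  exact h.exists_points.choose_spec.2

lemma measurable_sum_subtype (p : ℕ → Measure X) :
    Measurable fun S : Set ℕ => Measure.sum fun i : S => p i := by
  classical
  refine Measure.measurable_of_measurable_coe _ fun B hB => ?_
  have : ∀ S : Set ℕ, (Measure.sum fun i : S => p i) B = ∑' i : ℕ, if i ∈ S then p i B else 0 := by
    intro S
    rw [Measure.sum_apply _ hB, tsum_subtype S (fun i => p i B)]
    simp [Set.indicator_apply]
  simp_rw [this]
  refine Measurable.tsum fun i => Measurable.ite ?_ measurable_const measurable_const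
  exact measurableSet_setOfPred.2 (measurable_set_mem i)

instance isProbabilityMeasure_thinningLaw (s : I) (μ : Measure X) :
    IsProbabilityMeasure (thinningLaw s μ) :=
  Measure.isProbabilityMeasure_map (measurable_sum_subtype _).aemeasurable

/-- The points of `μ` are retained independently, so the Laplace functional of the thinning is the
product of the contributions `IsPoint.thinned` of the points. -/
theorem integral_expFun_thinningLaw (s : I) {μ : Measure X} (h : IsConfiguration μ)
    (v : SimpleFunc X ℝ≥0) : ∫ ξ, expFun v ξ ∂(thinningLaw s μ) = expFun (thin s v) μ := by
  classical
  rw [thinningLaw, integral_map (measurable_sum_subtype _).aemeasurable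
    (measurable_expFun v).aestronglyMeasurable, setBernoulli_eq_map,
    integral_map (f := fun S : Set ℕ => expFun v (Measure.sum fun i : S => points μ i))
      (by fun_prop) ((measurable_expFun v).comp (measurable_sum_subtype _)).aestronglyMeasurable]
  have hprob : ∀ i : ℕ, IsProbabilityMeasure (unitInterval.toNNReal s •
      Measure.dirac (i ∈ Set.univ) + unitInterval.toNNReal (unitInterval.symm s) •
      Measure.dirac False : Measure Prop) := by
    intro i; infer_instance
  have h1 := tendsto_integral_expFun_sum (fun i : ℕ => (unitInterval.toNNReal s •
      Measure.dirac (i ∈ Set.univ) + unitInterval.toNNReal (unitInterval.symm s) •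
      Measure.dirac False : Measure Prop)) (fun i b => if b then points μ i else 0)
      (fun i => measurable_from_top) v
  have h2 : ∀ i : ℕ, ∫ b, expFun v (if b then points μ i else 0) ∂(unitInterval.toNNReal s •
      Measure.dirac (i ∈ Set.univ) + unitInterval.toNNReal (unitInterval.symm s) •
      Measure.dirac False : Measure Prop) = expFun (thin s v) (points μ i) := by
    intro i
    rw [← (h.isPoint_points i).thinned s v, integral_add_measure, integral_smul_nnreal_measure,
      integral_smul_nnreal_measure, integral_dirac, integral_dirac]
    · simp [expFun, NNReal.smul_def]
    · exact Integrable.of_finite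
    · exact Integrable.of_finite
  simp_rw [h2] at h1
  have h3 : Tendsto (fun n => ∏ i ∈ Finset.range n, expFun (thin s v) (points μ i)) atTop
      (𝓝 (expFun (thin s v) μ)) := by
    conv => enter [3, 1, 2]; rw [← h.sum_points]
    simp_rw [expFun, ← expNeg_sum, lintegral_sum_measure]
    exact (continuous_expNeg.tendsto _).comp (ENNReal.tendsto_nat_tsum _)
  rw [← tendsto_nhds_unique h1 h3]
  congr 1
  ext b
  congr 1
  ext B hB
  rw [Measure.sum_apply _ hB, Measure.sum_apply _ hB,
    tsum_subtype {i | b i} (fun i => points μ i B)]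
  refine tsum_congr fun i => ?_
  by_cases hb : b i <;> simp [hb]

end

section

variable {X : Type*} [MeasurableSpace X] {Ω : Type*} [MeasurableSpace Ω]

/-! ### The space of configurations -/

variable (X) in
/-- The configuration space `𝐍`, a subspace of the space of all measures. -/
abbrev Conf : Type _ := {μ : Measure X // IsConfiguration μ}

lemma IsConfiguration.add_dirac {μ : Measure X} (h : IsConfiguration μ) (x : X) :
    IsConfiguration (μ + Measure.dirac x) := by
  have := h.sigmaFinite
  refine ⟨inferInstance, fun B hB => ?_⟩
  obtain ⟨n, hn⟩ := h.integerValued B hB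
  rw [Measure.add_apply, hn, Measure.dirac_apply' _ hB]
  by_cases hx : x ∈ B
  · exact ⟨n + 1, by simp [hx]⟩
  · exact ⟨n, by simp [hx]⟩

/-- A measurable function on the configuration space extends to all measures. -/
lemma exists_measurable_extension {Z : Type*} [MeasurableSpace Z] [Nonempty Z]
    [StandardBorelSpace Z] {Φ : Conf X → Z} (h : Measurable Φ) :
    ∃ g : Measure X → Z, Measurable g ∧ ∀ μ : Conf X, g μ = Φ μ := by
  obtain ⟨g, hg, he⟩ := h.exists_eq_measurable_comp (f := (Subtype.val : Conf X → Measure X))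
  exact ⟨g, hg, fun μ => (congrFun he μ).symm⟩

/-! ### The Mehler kernel -/

lemma measurable_thinningLaw : Measurable fun z : I × Conf X => thinningLaw z.1 (z.2 : Measure X) := by
  refine measurable_of_expFun 0 _ fun v _ => ?_
  simp_rw [fun z : I × Conf X => integral_expFun_thinningLaw z.1 z.2.2 v]
  exact (measurable_expFun_thin v).comp
    (measurable_fst.prodMk (measurable_subtype_coe.comp measurable_snd))

variable (X) in
/-- Thinning, as a Markov kernel. -/
def thinKernel : Kernel (I × Conf X) (Measure X) where
  toFun z := thinningLaw z.1 (z.2 : Measure X)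
  measurable' := measurable_thinningLaw

instance : IsMarkovKernel (thinKernel X) :=
  ⟨fun z => inferInstanceAs (IsProbabilityMeasure (thinningLaw z.1 (z.2 : Measure X)))⟩

lemma integral_decay_smul (lam : Measure X) (s : I) (v : SimpleFunc X ℝ≥0) :
    ∫ x, decay v x ∂(ENNReal.ofReal (1 - (s : ℝ)) • lam) = (1 - s) * ∫ x, decay v x ∂lam := by
  rw [integral_smul_measure, ENNReal.toReal_ofReal (by linarith [s.2.2]), smul_eq_mul]

lemma FinSupp.smul {lam : Measure X} {v : SimpleFunc X ℝ≥0} (hv : FinSupp lam v) (c : ℝ) :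
    FinSupp (ENNReal.ofReal c • lam) v := by
  rw [FinSupp, Measure.smul_apply, smul_eq_mul]
  exact ENNReal.mul_ne_top (by simp) hv

lemma integral_expFun_poissonLaw_smul (lam : Measure X) [SFinite lam] (s : I)
    {v : SimpleFunc X ℝ≥0} (hv : FinSupp lam v) :
    ∫ χ, expFun v χ ∂(poissonLaw (ENNReal.ofReal (1 - (s : ℝ)) • lam))
      = Real.exp (-((1 - s) * ∫ x, decay v x ∂lam)) := by
  rw [(isPoissonLaw_poissonLaw _).integral_expFun v (hv.smul _), integral_decay_smul]

lemma measurable_poissonLaw_smul (lam : Measure X) [SigmaFinite lam] :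
    Measurable fun s : I => poissonLaw (ENNReal.ofReal (1 - (s : ℝ)) • lam) := by
  refine measurable_of_expFun lam _ fun v hv => ?_
  simp_rw [fun s => integral_expFun_poissonLaw_smul lam s hv]
  have : Measurable fun s : I => (s : ℝ) := measurable_subtype_coe
  fun_prop

/-- The Poisson process that is added to the thinning, as a Markov kernel. -/
def noiseKernel (lam : Measure X) [SigmaFinite lam] : Kernel I (Measure X) :=
  ⟨fun s => poissonLaw (ENNReal.ofReal (1 - (s : ℝ)) • lam), measurable_poissonLaw_smul lam⟩

instance (lam : Measure X) [SigmaFinite lam] : IsMarkovKernel (noiseKernel lam) :=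
  ⟨fun s => inferInstanceAs
    (IsProbabilityMeasure (poissonLaw (ENNReal.ofReal (1 - (s : ℝ)) • lam)))⟩

/-- The distribution of `ξ + χ`, where `ξ` is an `s`-thinning of `μ` and `χ` is an independent
Poisson process with intensity measure `(1 - s) lam`. -/
def mehlerMeasure (lam : Measure X) [SFinite lam] (s : I) (μ : Measure X) : Measure (Measure X) :=
  ((thinningLaw s μ).prod (poissonLaw (ENNReal.ofReal (1 - (s : ℝ)) • lam))).map
    fun z => z.1 + z.2

lemma measurable_add_measure : Measurable fun z : Measure X × Measure X => z.1 + z.2 :=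
  measurable_fst.add measurable_snd

instance (lam : Measure X) [SFinite lam] (s : I) (μ : Measure X) :
    IsProbabilityMeasure (mehlerMeasure lam s μ) :=
  Measure.isProbabilityMeasure_map measurable_add_measure.aemeasurable

lemma integral_expFun_mehlerMeasure (lam : Measure X) [SFinite lam] (s : I) {μ : Measure X}
    (h : IsConfiguration μ) {v : SimpleFunc X ℝ≥0} (hv : FinSupp lam v) :
    ∫ ξ, expFun v ξ ∂(mehlerMeasure lam s μ)
      = Real.exp (-((1 - s) * ∫ x, decay v x ∂lam)) * expFun (thin s v) μ := by
  rw [mehlerMeasure, integral_map measurable_add_measure.aemeasurable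
    (measurable_expFun v).aestronglyMeasurable]
  simp_rw [expFun_add_measure]
  rw [integral_prod_mul, integral_expFun_thinningLaw s h, integral_expFun_poissonLaw_smul lam s hv,
    mul_comm]

lemma measurable_mehlerMeasure (lam : Measure X) [SigmaFinite lam] :
    Measurable fun z : I × Conf X => mehlerMeasure lam z.1 (z.2 : Measure X) := by
  refine measurable_of_expFun lam _ fun v hv => ?_
  simp_rw [fun z : I × Conf X => integral_expFun_mehlerMeasure lam z.1 z.2.2 hv]
  have : Measurable fun z : I × Conf X => (z.1 : ℝ) := measurable_subtype_coe.comp measurable_fst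
  refine Measurable.mul (by fun_prop) ((measurable_expFun_thin v).comp
    (measurable_fst.prodMk (measurable_subtype_coe.comp measurable_snd)))

/-- The distribution of a thinning with added noise, as a Markov kernel. -/
def mehlerKernel (lam : Measure X) [SigmaFinite lam] : Kernel (I × Conf X) (Measure X) :=
  ⟨fun z => mehlerMeasure lam z.1 (z.2 : Measure X), measurable_mehlerMeasure lam⟩

instance (lam : Measure X) [SigmaFinite lam] : IsMarkovKernel (mehlerKernel lam) :=
  ⟨fun z => inferInstanceAs (IsProbabilityMeasure (mehlerMeasure lam z.1 z.2))⟩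

/-- Thinning acts on an additional point separately: the point is retained with probability `s`. -/
lemma mehlerMeasure_add_dirac (lam : Measure X) [SigmaFinite lam] (s : I) {μ : Measure X}
    (h : IsConfiguration μ) (x : X) :
    mehlerMeasure lam s (μ + Measure.dirac x)
      = ENNReal.ofReal s • (mehlerMeasure lam s μ).map (fun ξ => ξ + Measure.dirac x)
        + ENNReal.ofReal (1 - s) • mehlerMeasure lam s μ := by
  have hmx : Measurable fun ξ : Measure X => ξ + Measure.dirac x := measurable_id.add_const _
  have : IsProbabilityMeasure ((mehlerMeasure lam s μ).map (fun ξ => ξ + Measure.dirac x)) :=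
    Measure.isProbabilityMeasure_map hmx.aemeasurable
  have : IsFiniteMeasure (ENNReal.ofReal s • (mehlerMeasure lam s μ).map
      (fun ξ => ξ + Measure.dirac x)) := Measure.smul_finite _ (by simp)
  have : IsFiniteMeasure (ENNReal.ofReal (1 - s) • mehlerMeasure lam s μ) :=
    Measure.smul_finite _ (by simp)
  refine ext_of_expFun lam fun v hv => ?_
  rw [integral_add_measure (integrable_expFun v) (integrable_expFun v), integral_smul_measure,
    integral_smul_measure, integral_map hmx.aemeasurable (measurable_expFun v).aestronglyMeasurable]
  simp_rw [expFun_add_measure, integral_mul_const]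
  rw [integral_expFun_mehlerMeasure lam s h hv,
    integral_expFun_mehlerMeasure lam s (h.add_dirac x) hv, expFun_add_measure,
    ENNReal.toReal_ofReal s.2.1, ENNReal.toReal_ofReal (by linarith [s.2.2]), expFun_dirac,
    expFun_dirac, thin, SimpleFunc.map_apply, exp_neg_thinVal]
  simp only [smul_eq_mul]
  ring

/-- The distribution of a Poisson process is invariant under thinning with added noise. -/
lemma lintegral_mehlerMeasure {lam : Measure X} [SigmaFinite lam] {P : Measure Ω}
    [IsProbabilityMeasure P] {η : Ω → Measure X} (hη : IsPoissonProcess P η lam) (s : I)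
    {h : Measure X → ℝ≥0∞} (hh : Measurable h) :
    ∫⁻ ω, ∫⁻ ξ, h ξ ∂(mehlerMeasure lam s (η ω)) ∂P = ∫⁻ μ, h μ ∂(P.map η) := by
  let ηc : Ω → Conf X := fun ω => ⟨η ω, hη.isConfiguration ω⟩
  have hηc : Measurable ηc := hη.measurable.subtype_mk
  let κ : Kernel Ω (Measure X) := (mehlerKernel lam).comap (fun ω => (s, ηc ω))
    (measurable_const.prodMk hηc)
  have hκ : κ ∘ₘ P = P.map η := by
    have := Measure.isProbabilityMeasure_map (μ := P) hη.measurable.aemeasurable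
    refine ext_of_expFun lam fun v hv => ?_
    have hc := Kernel.integral_comp (κ := Kernel.const Unit P) (η := κ) (a := ())
      (integrable_expFun v)
    rw [Kernel.comp_apply, Kernel.const_apply] at hc
    rw [hc]
    change ∫ ω, ∫ ξ, expFun v ξ ∂(mehlerMeasure lam s (η ω)) ∂P = _
    simp_rw [fun ω => integral_expFun_mehlerMeasure lam s (hη.isConfiguration ω) hv]
    rw [integral_const_mul, ← integral_map (f := expFun (thin s v)) hη.measurable.aemeasurable
      (measurable_expFun _).aestronglyMeasurable, hη.isPoissonLaw.integral_expFun _ (hv.thin s),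
      hη.isPoissonLaw.integral_expFun _ hv, ← Real.exp_add]
    simp_rw [decay_thin]
    rw [integral_const_mul]
    ring_nf
  rw [← hκ, Measure.lintegral_bind κ.measurable.aemeasurable hh.aemeasurable]
  rfl

lemma measurable_mehlerOp (lam : Measure X) [SigmaFinite lam] {f : Measure X → ℝ}
    (hf : Measurable f) : Measurable fun z : I × Conf X => mehlerOp lam z.1 f (z.2 : Measure X) := by
  have h1 : StronglyMeasurable fun z : (I × Conf X) × Measure X =>
      ∫ ξ, f (ξ + z.2) ∂(thinningLaw z.1.1 (z.1.2 : Measure X)) := by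
    have hf' : StronglyMeasurable fun p : ((I × Conf X) × Measure X) × Measure X =>
        f (p.2 + p.1.2) :=
      (hf.comp (measurable_snd.add (measurable_snd.comp measurable_fst))).stronglyMeasurable
    exact StronglyMeasurable.integral_kernel_prod_right'
      (κ := (thinKernel X).comap Prod.fst measurable_fst) hf'
  have h2 := StronglyMeasurable.integral_kernel_prod_right'
    (κ := (noiseKernel lam).comap (Prod.fst : I × Conf X → I) measurable_fst) h1
  exact h2.measurable

lemma enorm_mehlerOp_le (lam : Measure X) [SigmaFinite lam] {f : Measure X → ℝ}
    (hf : Measurable f) (s : I) (μ : Measure X) :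
    ‖mehlerOp lam s f μ‖ₑ ≤ ∫⁻ ξ, ‖f ξ‖ₑ ∂(mehlerMeasure lam s μ) := by
  rw [mehlerMeasure, lintegral_map hf.enorm measurable_add_measure,
    lintegral_prod_symm (fun z : Measure X × Measure X => ‖f (z.1 + z.2)‖ₑ)
      (hf.enorm.comp measurable_add_measure).aemeasurable]
  refine (enorm_integral_le_lintegral_enorm _).trans (lintegral_mono fun χ => ?_)
  exact enorm_integral_le_lintegral_enorm _

lemma mehlerOp_eq_integral (lam : Measure X) [SigmaFinite lam] {f : Measure X → ℝ} {s : I}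
    {μ : Measure X} (hi : Integrable f (mehlerMeasure lam s μ)) :
    mehlerOp lam s f μ = ∫ ξ, f ξ ∂(mehlerMeasure lam s μ) := by
  rw [mehlerMeasure, integral_map measurable_add_measure.aemeasurable hi.aestronglyMeasurable,
    integral_prod_symm]
  · rfl
  · exact hi.comp_measurable measurable_add_measure

/-! ### The Mecke equation -/

/-- A right derivative at `0`, taken along the sequence `1 / (n + 1)`. -/
lemma tendsto_nat_mul_sub {ψ : ℝ → ℝ} {d : ℝ} (h : HasDerivAt ψ d 0) :
    Tendsto (fun n : ℕ => ((n : ℝ) + 1) * (ψ 0 - ψ (1 / ((n : ℝ) + 1)))) atTop (𝓝 (-d)) := by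
  have h1 := h.tendsto_slope_zero_right
  have h2 : Tendsto (fun n : ℕ => 1 / ((n : ℝ) + 1)) atTop (𝓝[>] 0) :=
    tendsto_nhdsWithin_iff.2 ⟨tendsto_one_div_add_atTop_nhds_zero_nat,
      Eventually.of_forall fun n => by simp only [Set.mem_Ioi]; positivity⟩
  refine ((h1.comp h2).neg).congr fun n => ?_
  simp only [Function.comp, zero_add, smul_eq_mul, one_div, inv_inv]
  ring

lemma tendsto_nat_mul_one_sub_expNeg {a : ℝ≥0∞} (ha : a ≠ ∞) :
    Tendsto (fun n : ℕ => ((n : ℝ) + 1) * (1 - expNeg ((1 / ((n : ℝ≥0) + 1) : ℝ≥0) * a))) atTop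
      (𝓝 a.toReal) := by
  have h : HasDerivAt (fun t : ℝ => Real.exp (-(t * a.toReal))) (-a.toReal) 0 := by
    have h1 : HasDerivAt (fun t : ℝ => -(t * a.toReal)) (-(1 * a.toReal)) 0 :=
      ((hasDerivAt_id (0 : ℝ)).mul_const a.toReal).neg
    simpa using h1.exp
  have := tendsto_nat_mul_sub h
  rw [neg_neg] at this
  refine this.congr fun n => ?_
  rw [expNeg_of_ne_top (ENNReal.mul_ne_top ENNReal.coe_ne_top ha), ENNReal.toReal_mul]
  simp only [zero_mul, neg_zero, Real.exp_zero, ENNReal.coe_toReal]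
  push_cast
  rfl

variable {lam : Measure X} {Q : Measure (Measure X)}

/-- The derivative of the Laplace functional at `v` in the direction `1_B`, as a limit of difference
quotients. Both sides of the Mecke equation, tested against `expFun v`, are this limit. -/
lemma IsPoissonLaw.tendsto_expFun [SigmaFinite lam] (hQ : IsPoissonLaw lam Q) {B : Set X}
    (hB : MeasurableSet B) (hlB : lam B ≠ ∞) {v : SimpleFunc X ℝ≥0} (hv : FinSupp lam v) :
    Tendsto (fun n : ℕ => ∫ μ, ((n : ℝ) + 1) *
        (1 - expNeg ((1 / ((n : ℝ≥0) + 1) : ℝ≥0) * μ B)) * expFun v μ ∂Q) atTop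
      (𝓝 ((∫ x in B, Real.exp (-(v x : ℝ)) ∂lam) * Real.exp (-∫ x, decay v x ∂lam))) := by
  have := hQ.isProbabilityMeasure
  set b := ∫ x in B, Real.exp (-(v x : ℝ)) ∂lam with hb
  set c := ∫ x, decay v x ∂lam with hc
  have hie : IntegrableOn (fun x => Real.exp (-(v x : ℝ))) B lam := by
    have : Measurable fun x => (v x : ℝ) := v.measurable.coe_nnreal_real
    exact Measure.integrableOn_of_bounded (M := 1) hlB (by fun_prop) (ae_of_all _ fun x => by simp)
  -- The Laplace functional at `v + t 1_B`.
  have hφ : ∀ t : ℝ≥0, ∫ μ, expNeg (t * μ B) * expFun v μ ∂Q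
      = Real.exp (-(c + (1 - Real.exp (-(t : ℝ))) * b)) := by
    intro t
    have hw : FinSupp lam ((SimpleFunc.const X t).restrict B + v) :=
      (finSupp_restrict_const hB hlB t).add hv
    have h1 := hQ.integral_expFun _ hw
    rw [← expFun_mul] at h1
    simp_rw [Pi.mul_apply, expFun_restrict_const hB] at h1
    rw [h1]
    congr 2
    rw [hc, hb, ← integral_indicator hB, ← integral_const_mul,
      ← integral_add hv.integrable_decay ((hie.integrable_indicator hB).const_mul _)]
    refine integral_congr_ae (ae_of_all _ fun x => ?_)
    simp only [decay, SimpleFunc.coe_add, Pi.add_apply, SimpleFunc.restrict_apply _ hB]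
    by_cases hx : x ∈ B
    · simp only [Set.indicator_of_mem hx, SimpleFunc.const_apply, NNReal.coe_add, neg_add,
        Real.exp_add]
      ring
    · simp [Set.indicator_of_notMem hx]
  have hder : HasDerivAt (fun t : ℝ => Real.exp (-(c + (1 - Real.exp (-t)) * b)))
      (-(b * Real.exp (-c))) 0 := by
    have h1 : HasDerivAt (fun t : ℝ => Real.exp (-t)) (-1) 0 := by
      simpa using (hasDerivAt_neg (0 : ℝ)).exp
    have h2 := ((((h1.const_sub 1).mul_const b).const_add c).neg).exp
    refine h2.congr_deriv ?_
    change Real.exp (-(c + (1 - Real.exp (-0)) * b)) * -(-(-1) * b) = _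
    simp only [neg_zero, Real.exp_zero, sub_self, zero_mul, add_zero]
    ring
  have h3 := tendsto_nat_mul_sub hder
  rw [neg_neg] at h3
  refine h3.congr fun n => ?_
  have hi : ∀ t : ℝ≥0, Integrable (fun μ : Measure X => expNeg (t * μ B) * expFun v μ) Q := by
    intro t
    refine Integrable.of_bound (C := 1) ((measurable_expNeg.comp
      ((Measure.measurable_coe hB).const_mul _)).mul (measurable_expFun v)).aestronglyMeasurable
      (ae_of_all _ fun μ => ?_)
    rw [norm_mul, Real.norm_of_nonneg (expNeg_nonneg _), Real.norm_of_nonneg (expFun_nonneg _ _)]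
    exact mul_le_one₀ (expNeg_le_one _) (expFun_nonneg _ _) (expFun_le_one _ _)
  have h4 := hφ (1 / ((n : ℝ≥0) + 1))
  have h5 := hφ 0
  simp only [ENNReal.coe_zero, zero_mul, expNeg_zero] at h5
  push_cast at h4
  simp_rw [mul_assoc, sub_mul, integral_const_mul]
  rw [integral_sub (by simpa using hi 0) (hi _), h4, h5]
  norm_num
  left
  ring

/-- The expected number of points in a set of finite intensity is finite, by Fatou's lemma applied
to the difference quotients of `IsPoissonLaw.tendsto_expFun` at `v = 0`. -/
lemma IsPoissonLaw.lintegral_apply_lt_top [SigmaFinite lam] (hQ : IsPoissonLaw lam Q) {B : Set X}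
    (hB : MeasurableSet B) (hlB : lam B ≠ ∞) : ∫⁻ μ, μ B ∂Q < ∞ := by
  have := hQ.isProbabilityMeasure
  let u : ℕ → Measure X → ℝ := fun n μ =>
    ((n : ℝ) + 1) * (1 - expNeg ((1 / ((n : ℝ≥0) + 1) : ℝ≥0) * μ B))
  have hum : ∀ n, Measurable (u n) := fun n => ((measurable_const.sub (measurable_expNeg.comp
      ((Measure.measurable_coe hB).const_mul _))).const_mul _)
  have hu0 : ∀ n μ, 0 ≤ u n μ := fun n μ =>
    mul_nonneg (by positivity) (sub_nonneg.2 (expNeg_le_one _))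
  have hlim : ∀ μ : Measure X, Tendsto (fun n => ENNReal.ofReal (u n μ)) atTop (𝓝 (μ B)) := by
    intro μ
    by_cases hμ : μ B = ∞
    · have : ∀ n, u n μ = (n : ℝ) + 1 := by
        intro n
        simp only [u, hμ]
        rw [ENNReal.mul_top (by simp), expNeg_top]
        ring
      simp_rw [this, hμ]
      exact ENNReal.tendsto_ofReal_atTop.comp
        (tendsto_atTop_add_const_right _ _ tendsto_natCast_atTop_atTop)
    · rw [← ENNReal.ofReal_toReal hμ]
      exact (ENNReal.continuous_ofReal.tendsto _).comp (tendsto_nat_mul_one_sub_expNeg hμ)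
  have hT := hQ.tendsto_expFun hB hlB (v := 0) (by simp [FinSupp])
  have hint : ∀ n, Integrable (u n) Q := by
    intro n
    refine Integrable.of_bound (C := (n : ℝ) + 1) (hum n).aestronglyMeasurable
      (ae_of_all _ fun μ => ?_)
    rw [Real.norm_of_nonneg (hu0 n μ)]
    have : 1 - expNeg ((1 / ((n : ℝ≥0) + 1) : ℝ≥0) * μ B) ≤ 1 := by
      linarith [expNeg_nonneg ((1 / ((n : ℝ≥0) + 1) : ℝ≥0) * μ B)]
    have h0 : (0 : ℝ) ≤ (n : ℝ) + 1 := by positivity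
    nlinarith
  calc ∫⁻ μ, μ B ∂Q = ∫⁻ μ, liminf (fun n => ENNReal.ofReal (u n μ)) atTop ∂Q :=
        lintegral_congr fun μ => (hlim μ).liminf_eq.symm
    _ ≤ liminf (fun n => ∫⁻ μ, ENNReal.ofReal (u n μ) ∂Q) atTop :=
        lintegral_liminf_le fun n => (hum n).ennreal_ofReal
    _ = ENNReal.ofReal _ := by
        refine Tendsto.liminf_eq ?_
        refine ((ENNReal.continuous_ofReal.tendsto _).comp hT).congr fun n => ?_
        simp only [Function.comp]
        rw [← ofReal_integral_eq_lintegral_ofReal (hint n) (ae_of_all _ (hu0 n))]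
        simp only [u, expFun, SimpleFunc.coe_zero, Pi.zero_apply, ENNReal.coe_zero,
          lintegral_zero, expNeg_zero, mul_one]
    _ < ∞ := ENNReal.ofReal_lt_top

/-- The Mecke equation, with the mark restricted to a set `B` of finite intensity: both sides are
finite measures with the same Laplace functional. -/
theorem IsPoissonLaw.mecke [SigmaFinite lam] (hQ : IsPoissonLaw lam Q) {B : Set X}
    (hB : MeasurableSet B) (hlB : lam B ≠ ∞) :
    Q.withDensity (fun μ => μ B)
      = ((lam.restrict B).prod Q).map fun z => z.2 + Measure.dirac z.1 := by
  have := hQ.isProbabilityMeasure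
  have hfin := hQ.lintegral_apply_lt_top hB hlB
  have : IsFiniteMeasure (Q.withDensity fun μ => μ B) := isFiniteMeasure_withDensity hfin.ne
  have : IsFiniteMeasure (lam.restrict B) := ⟨by simpa using hlB.lt_top⟩
  have hmB := Measure.measurable_coe (α := X) hB
  have hlt : ∀ᵐ μ ∂Q, μ B < ∞ := ae_lt_top hmB hfin.ne
  have hma : Measurable fun z : X × Measure X => z.2 + Measure.dirac z.1 :=
    measurable_snd.add (Measure.measurable_dirac.comp measurable_fst)
  refine ext_of_expFun lam fun v hv => ?_
  rw [integral_withDensity_eq_integral_toReal_smul hmB hlt,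
    integral_map hma.aemeasurable (measurable_expFun v).aestronglyMeasurable]
  simp_rw [expFun_add_measure, expFun_dirac, mul_comm (expFun v _) (Real.exp _)]
  rw [integral_prod_mul (f := fun x => Real.exp (-(v x : ℝ))), hQ.integral_expFun v hv]
  -- The difference quotients `(n + 1) (1 - e^{-μ(B)/(n + 1)})` increase to `μ(B)`, which
  -- dominates.
  refine tendsto_nhds_unique ?_ (hQ.tendsto_expFun hB hlB hv)
  refine tendsto_integral_of_dominated_convergence (fun μ => (μ B).toReal) (fun n => ?_)
    (integrable_toReal_of_lintegral_ne_top hmB.aemeasurable hfin.ne) (fun n => ?_) ?_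
  · exact (((measurable_const.sub (measurable_expNeg.comp
      ((Measure.measurable_coe hB).const_mul _))).const_mul _).mul
      (measurable_expFun v)).aestronglyMeasurable
  · filter_upwards [hlt] with μ hμ
    rw [norm_mul, norm_mul, Real.norm_of_nonneg (expFun_nonneg _ _),
      Real.norm_of_nonneg (sub_nonneg.2 (expNeg_le_one _)),
      Real.norm_of_nonneg (by positivity : (0 : ℝ) ≤ (n : ℝ) + 1)]
    refine (mul_le_of_le_one_right (mul_nonneg (by positivity)
      (sub_nonneg.2 (expNeg_le_one _))) (expFun_le_one _ _)).trans ?_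
    rw [expNeg_of_ne_top (ENNReal.mul_ne_top ENNReal.coe_ne_top hμ.ne), ENNReal.toReal_mul]
    set a := (μ B).toReal
    have h1 := Real.add_one_le_exp (-((((1 / ((n : ℝ≥0) + 1) : ℝ≥0) : ℝ≥0∞).toReal) * a))
    have h2 : ((n : ℝ) + 1) * ((((1 / ((n : ℝ≥0) + 1) : ℝ≥0) : ℝ≥0∞).toReal) * a) = a := by
      rw [ENNReal.coe_toReal]
      push_cast
      field_simp
    calc ((n : ℝ) + 1) * (1 - Real.exp (-((((1 / ((n : ℝ≥0) + 1) : ℝ≥0) : ℝ≥0∞).toReal) * a)))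
        ≤ ((n : ℝ) + 1) * ((((1 / ((n : ℝ≥0) + 1) : ℝ≥0) : ℝ≥0∞).toReal) * a) :=
          mul_le_mul_of_nonneg_left (by linarith) (by positivity)
      _ = a := h2
  · filter_upwards [hlt] with μ hμ
    exact (tendsto_nat_mul_one_sub_expNeg hμ.ne).mul_const _

lemma IsPoissonLaw.lintegral_mul_apply [SigmaFinite lam] (hQ : IsPoissonLaw lam Q) {B : Set X}
    (hB : MeasurableSet B) (hlB : lam B ≠ ∞) {h : Measure X → ℝ≥0∞} (hh : Measurable h) :
    ∫⁻ μ, h μ * μ B ∂Q = ∫⁻ x in B, ∫⁻ μ, h (μ + Measure.dirac x) ∂Q ∂lam := by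
  have := hQ.isProbabilityMeasure
  have hma : Measurable fun z : X × Measure X => z.2 + Measure.dirac z.1 :=
    measurable_snd.add (Measure.measurable_dirac.comp measurable_fst)
  have h1 : ∫⁻ μ, h μ ∂(Q.withDensity fun μ => μ B) = ∫⁻ μ, h μ * μ B ∂Q := by
    rw [lintegral_withDensity_eq_lintegral_mul _ (Measure.measurable_coe hB) hh]
    simp_rw [Pi.mul_apply, mul_comm]
  rw [← h1, hQ.mecke hB hlB, lintegral_map hh hma,
    lintegral_prod (fun z : X × Measure X => h (z.2 + Measure.dirac z.1))
      (hh.comp hma).aemeasurable]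

/-- All moments of the number of points in a set of finite intensity are finite. -/
lemma IsPoissonLaw.lintegral_pow_lt_top [SigmaFinite lam] (hQ : IsPoissonLaw lam Q) {B : Set X}
    (hB : MeasurableSet B) (hlB : lam B ≠ ∞) (m : ℕ) : ∫⁻ μ, (μ B) ^ m ∂Q < ∞ := by
  have := hQ.isProbabilityMeasure
  have hmB := Measure.measurable_coe (α := X) hB
  induction m with
  | zero => simp
  | succ m ih =>
    simp_rw [pow_succ]
    rw [hQ.lintegral_mul_apply hB hlB (hmB.pow_const m)]
    have : ∀ x ∈ B, ∫⁻ μ, ((μ + Measure.dirac x) B) ^ m ∂Q ≤ 2 ^ m * (∫⁻ μ, (μ B) ^ m ∂Q + 1) := by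
      intro x hx
      calc ∫⁻ μ, ((μ + Measure.dirac x) B) ^ m ∂Q ≤ ∫⁻ μ, 2 ^ m * ((μ B) ^ m + 1) ∂Q := by
            refine lintegral_mono fun μ => ?_
            rw [Measure.add_apply, Measure.dirac_apply' _ hB, Set.indicator_of_mem hx, Pi.one_apply]
            rcases le_total (μ B) 1 with h | h
            · calc (μ B + 1) ^ m ≤ (1 + 1) ^ m := by gcongr
                _ = 2 ^ m * 1 := by norm_num
                _ ≤ _ := by gcongr; exact le_add_self
            · calc (μ B + 1) ^ m ≤ (μ B + μ B) ^ m := by gcongr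
                _ = 2 ^ m * (μ B) ^ m := by rw [← two_mul, mul_pow]
                _ ≤ _ := by gcongr; exact le_self_add
        _ = 2 ^ m * (∫⁻ μ, (μ B) ^ m ∂Q + 1) := by
            rw [lintegral_const_mul _ ((hmB.pow_const m).add_const 1), lintegral_add_right _ measurable_const]
            simp
    calc ∫⁻ x in B, ∫⁻ μ, ((μ + Measure.dirac x) B) ^ m ∂Q ∂lam
        ≤ ∫⁻ _ in B, 2 ^ m * (∫⁻ μ, (μ B) ^ m ∂Q + 1) ∂lam := setLIntegral_mono measurable_const this
      _ = 2 ^ m * (∫⁻ μ, (μ B) ^ m ∂Q + 1) * lam B := by simp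
      _ < ∞ := ENNReal.mul_lt_top (ENNReal.mul_lt_top (by simp)
          (ENNReal.add_lt_top.2 ⟨ih, by simp⟩)) hlB.lt_top

/-- Adding a point distributed according to the intensity measure preserves null sets. -/
lemma IsPoissonLaw.quasiMeasurePreserving_add_dirac [SigmaFinite lam] (hQ : IsPoissonLaw lam Q) :
    Measure.QuasiMeasurePreserving (fun z : Measure X × X => z.1 + Measure.dirac z.2)
      (Q.prod lam) Q := by
  have := hQ.isProbabilityMeasure
  have hma : Measurable fun z : Measure X × X => z.1 + Measure.dirac z.2 :=
    measurable_fst.add (Measure.measurable_dirac.comp measurable_snd)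
  refine ⟨hma, Measure.AbsolutelyContinuous.mk fun N hN h0 => ?_⟩
  have hN1 : Measurable (N.indicator (1 : Measure X → ℝ≥0∞)) := measurable_one.indicator hN
  rw [Measure.map_apply hma hN, ← lintegral_indicator_one (hma hN),
    lintegral_prod_symm _ (measurable_one.indicator (hma hN)).aemeasurable]
  have : ∀ k, ∫⁻ x in spanningSets lam k, ∫⁻ μ, N.indicator 1 (μ + Measure.dirac x) ∂Q ∂lam = 0 := by
    intro k
    rw [← hQ.lintegral_mul_apply (measurableSet_spanningSets lam k)
      (measure_spanningSets_lt_top lam k).ne hN1]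
    refine (lintegral_eq_zero_iff
      (hN1.mul (Measure.measurable_coe (measurableSet_spanningSets lam k)))).2 ?_
    filter_upwards [measure_eq_zero_iff_ae_notMem.1 h0] with μ hμ
    simp [hμ]
  have h2 := setLIntegral_iUnion_of_directed (μ := lam)
    (fun x => ∫⁻ μ, N.indicator (1 : Measure X → ℝ≥0∞) (μ + Measure.dirac x) ∂Q)
    (monotone_spanningSets lam).directed_le
  rw [iUnion_spanningSets, setLIntegral_univ] at h2
  refine Eq.trans ?_ (h2.trans (by simp [this]))
  rfl

end

section

variable {X : Type*} [MeasurableSpace X] {Ω : Type*} [MeasurableSpace Ω]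

/-! ### Factorial measures on boxes -/

lemma IsPoint.measure_inter {ν : Measure X} (h : IsPoint ν) {A B : Set X} (hA : MeasurableSet A)
    (hB : MeasurableSet B) : ν (A ∩ B) = ν A * ν B := by
  have : IsZeroOneMeasure ν := ⟨fun s hs => h s hs⟩
  exact IsZeroOneMeasure.measure_inter_eq_prod hA hB

/-- The value of the factorial measure `μ^{(|J|)}` on the box with sides `A j`, `j ∈ J`. -/
def facSum {ι : Type*} (μ : Measure X) (J : Finset ι) (A : ι → Set X) : ℝ≥0∞ :=
  ∑' i : J ↪ ℕ, ∏ j : J, points μ (i j) (A j)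

section facSum

variable {ι : Type*} [DecidableEq ι]

lemma facSum_empty {ι : Type*} (μ : Measure X) (A : ι → Set X) : facSum μ ∅ A = 1 := by
  simp [facSum]

/-- The recursion for factorial measures: adjoin a further point, and subtract the contributions
of the points that have been used already. -/
lemma facSum_insert {μ : Measure X} (hμ : IsConfiguration μ) {J : Finset ι} {a : ι} (ha : a ∉ J)
    {A : ι → Set X} (hA : ∀ j, MeasurableSet (A j)) :
    facSum μ (insert a J) A + ∑ j : J, facSum μ J (Function.update A j (A j ∩ A a))
      = facSum μ J A * μ (A a) := by
  let p := points μ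
  let e : ((insert a J : Finset ι) ↪ ℕ) ≃ Σ f : J ↪ ℕ, ↥(Set.range f)ᶜ :=
    (Equiv.embeddingCongr (Finset.subtypeInsertEquivOption ha) (Equiv.refl ℕ)).trans
      (Function.Embedding.optionEmbeddingEquiv J ℕ)
  have h1 : facSum μ (insert a J) A
      = ∑' f : J ↪ ℕ, ∑' k : ↥(Set.range f)ᶜ, (∏ j : J, p (f j) (A j)) * p k (A a) := by
    rw [facSum, ← e.symm.tsum_eq, ENNReal.tsum_sigma']
    refine tsum_congr fun f => tsum_congr fun k => ?_
    have he : ∀ o, e.symm ⟨f, k⟩ ((Finset.subtypeInsertEquivOption ha).symm o)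
        = o.elim (k : ℕ) (fun j => f j) := by
      intro o
      have h4 : e.symm ⟨f, k⟩ ((Finset.subtypeInsertEquivOption ha).symm o)
          = ((Function.Embedding.optionEmbeddingEquiv J ℕ).symm ⟨f, k⟩)
            ((Finset.subtypeInsertEquivOption ha) ((Finset.subtypeInsertEquivOption ha).symm o)) :=
        rfl
      rw [h4, Equiv.apply_symm_apply]
      cases o <;> rfl
    rw [← (Finset.subtypeInsertEquivOption ha).symm.prod_comp, Fintype.prod_option, mul_comm]
    simp_rw [he]
    rfl
  have h2 : ∑ j : J, facSum μ J (Function.update A j (A j ∩ A a))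
      = ∑' f : J ↪ ℕ, ∑' k : Set.range f, (∏ j : J, p (f j) (A j)) * p k (A a) := by
    have h3 : ∀ f : J ↪ ℕ, ∑' k : Set.range f, (∏ j : J, p (f j) (A j)) * p k (A a)
        = ∑ j : J, ∏ l : J, p (f l) (Function.update A j (A j ∩ A a) l) := by
      intro f
      rw [← (Equiv.ofInjective f f.injective).tsum_eq, tsum_fintype]
      refine Finset.sum_congr rfl fun j _ => ?_
      rw [Equiv.ofInjective_apply, ← Finset.mul_prod_erase _ _ (Finset.mem_univ j),
        ← Finset.mul_prod_erase _ (fun l : J => p (f l) (Function.update A j (A j ∩ A a) l))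
          (Finset.mem_univ j), Function.update_self, (hμ.isPoint_points _).measure_inter (hA _) (hA _)]
      rw [mul_right_comm]
      congr 1
      refine Finset.prod_congr rfl fun l hl => ?_
      rw [Function.update_of_ne (fun h => Finset.ne_of_mem_erase hl (Subtype.ext h))]
    simp_rw [h3]
    rw [Summable.tsum_finsetSum (fun j _ => ENNReal.summable)]
    rfl
  rw [h1, h2, ← ENNReal.tsum_add, facSum, ← ENNReal.tsum_mul_right]
  refine tsum_congr fun f => ?_
  have h5 := Summable.tsum_add_tsum_compl (s := Set.range f)
    (f := fun k => (∏ j : J, p (f j) (A j)) * p k (A a)) ENNReal.summable ENNReal.summable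
  rw [add_comm, h5, ENNReal.tsum_mul_left]
  congr 1
  conv_rhs => rw [← hμ.sum_points]
  rw [Measure.sum_apply _ (hA a)]

lemma facSum_le {μ : Measure X} (hμ : IsConfiguration μ) (J : Finset ι)
    {A : ι → Set X} (hA : ∀ j, MeasurableSet (A j)) : facSum μ J A ≤ ∏ j ∈ J, μ (A j) := by
  induction J using Finset.induction_on with
  | empty => simp [facSum_empty]
  | insert a J ha ih =>
    rw [Finset.prod_insert ha, mul_comm]
    calc facSum μ (insert a J) A ≤ facSum μ J A * μ (A a) := by
          rw [← facSum_insert hμ ha hA]; exact le_self_add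
      _ ≤ _ := by gcongr

end facSum

open Classical in
/-- The configuration `μ`, replaced by the empty configuration if it has infinitely many points
in `B`. -/
def cut (B : Set X) (μ : Measure X) : Measure X := if μ B = ∞ then 0 else μ

lemma IsConfiguration.zero : IsConfiguration (0 : Measure X) :=
  ⟨inferInstance, fun _ _ => ⟨0, by simp⟩⟩

lemma IsConfiguration.cut {μ : Measure X} (h : IsConfiguration μ) (B : Set X) :
    IsConfiguration (cut B μ) := by
  rw [PoissonMehler.cut]
  split_ifs
  exacts [IsConfiguration.zero, h]

lemma cut_apply_ne_top (B : Set X) (μ : Measure X) : cut B μ B ≠ ∞ := by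
  rw [cut]
  split_ifs with h
  exacts [by simp, h]

lemma cut_of_ne_top {B : Set X} {μ : Measure X} (h : μ B ≠ ∞) : cut B μ = μ := if_neg h

lemma cut_apply_le (B : Set X) (μ : Measure X) (A : Set X) : cut B μ A ≤ μ A := by
  rw [cut]
  split_ifs <;> simp

lemma measurable_cut_apply {B : Set X} (hB : MeasurableSet B) {A : Set X} (hA : MeasurableSet A) :
    Measurable fun μ : Measure X => cut B μ A := by
  have : (fun μ : Measure X => cut B μ A) = fun μ => if μ B = ∞ then 0 else μ A := by
    ext μ; rw [cut]; split_ifs <;> simp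
  rw [this]
  exact Measurable.ite (Measure.measurable_coe hB (measurableSet_singleton ∞)) measurable_const
    (Measure.measurable_coe hA)

lemma update_inter_box {ι : Type*} [DecidableEq ι] {B : Set X} {A : ι → Set X}
    (hA : ∀ j, MeasurableSet (A j)) (hAB : ∀ j, A j ⊆ B) (j a : ι) :
    (∀ l, MeasurableSet (Function.update A j (A j ∩ A a) l)) ∧
      ∀ l, Function.update A j (A j ∩ A a) l ⊆ B := by
  refine ⟨fun l => ?_, fun l => ?_⟩ <;> by_cases hl : l = j
  · subst hl; simpa using (hA _).inter (hA _)
  · simpa [Function.update_of_ne hl] using hA l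
  · subst hl; simpa using Set.inter_subset_left.trans (hAB _)
  · simpa [Function.update_of_ne hl] using hAB l

lemma measurable_facSum {ι : Type*} [DecidableEq ι] {B : Set X} (hB : MeasurableSet B)
    (J : Finset ι) : ∀ {A : ι → Set X}, (∀ j, MeasurableSet (A j)) → (∀ j, A j ⊆ B) →
    Measurable fun μ : Conf X => facSum (cut B (μ : Measure X)) J A := by
  induction J using Finset.induction_on with
  | empty => intro A _ _; simp [facSum_empty]
  | insert a J ha ih =>
    intro A hA hAB
    have hu := fun j : J => update_inter_box hA hAB (j : ι) a
    have h1 : (fun μ : Conf X => facSum (cut B (μ : Measure X)) (insert a J) A) = fun μ : Conf X =>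
        facSum (cut B (μ : Measure X)) J A * cut B (μ : Measure X) (A a)
          - ∑ j : J, facSum (cut B (μ : Measure X)) J (Function.update A j (A j ∩ A a)) := by
      ext μ
      rw [← facSum_insert (μ.2.cut B) ha hA, ENNReal.add_sub_cancel_right]
      rw [ENNReal.sum_ne_top]
      intro j _
      refine ne_top_of_le_ne_top (ENNReal.prod_ne_top fun l _ => ?_)
        (facSum_le (μ.2.cut B) J (hu j).1)
      exact ne_top_of_le_ne_top (cut_apply_ne_top B μ) (measure_mono ((hu j).2 l))
    rw [h1]
    refine Measurable.sub (Measurable.mul (ih hA hAB) ?_)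
      (Finset.measurable_fun_sum _ fun j _ => ih (hu j).1 (hu j).2)
    exact (measurable_cut_apply hB (hA a)).comp measurable_subtype_coe

lemma add_one_pow_le (a : ℝ≥0∞) (m : ℕ) : (a + 1) ^ m ≤ 2 ^ m * (a ^ m + 1) := by
  rcases le_total a 1 with h | h
  · calc (a + 1) ^ m ≤ (1 + 1) ^ m := by gcongr
      _ = 2 ^ m * 1 := by norm_num
      _ ≤ _ := by gcongr; exact le_add_self
  · calc (a + 1) ^ m ≤ (a + a) ^ m := by gcongr
      _ = 2 ^ m * a ^ m := by rw [← two_mul, mul_pow]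
      _ ≤ _ := by gcongr; exact le_self_add

variable {lam : Measure X} [SigmaFinite lam] {P : Measure Ω} [IsProbabilityMeasure P]
  {η : Ω → Measure X}

namespace IsPoissonProcess

lemma lintegral_map_eq {lam : Measure X} {P : Measure Ω} {η : Ω → Measure X}
    (hη : IsPoissonProcess P η lam)
    {h : Measure X → ℝ≥0∞} (hh : Measurable h) :
    ∫⁻ μ, h μ ∂(P.map η) = ∫⁻ ω, h (η ω) ∂P := lintegral_map hh hη.measurable

lemma lintegral_add_one_pow_lt_top (hη : IsPoissonProcess P η lam)
    {B : Set X} (hB : MeasurableSet B) (hlB : lam B ≠ ∞) (m : ℕ) :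
    ∫⁻ ω, (η ω B + 1) ^ m ∂P < ∞ := by
  have hmB : Measurable fun ω => η ω B := (Measure.measurable_coe hB).comp hη.measurable
  refine (lintegral_mono fun ω => add_one_pow_le _ m).trans_lt ?_
  rw [lintegral_const_mul _ ((hmB.pow_const m).add_const 1), lintegral_add_right _ measurable_const]
  refine ENNReal.mul_lt_top (by simp) (ENNReal.add_lt_top.2 ⟨?_, by simp⟩)
  have := hη.isPoissonLaw.lintegral_pow_lt_top hB hlB m
  rwa [hη.lintegral_map_eq ((Measure.measurable_coe hB).pow_const m)] at this

lemma ae_apply_ne_top (hη : IsPoissonProcess P η lam)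
    {B : Set X} (hB : MeasurableSet B) (hlB : lam B ≠ ∞) :
    ∀ᵐ ω ∂P, η ω B ≠ ∞ := by
  have hmB : Measurable fun ω => η ω B := (Measure.measurable_coe hB).comp hη.measurable
  have := hη.lintegral_add_one_pow_lt_top hB hlB 1
  simp only [pow_one] at this
  filter_upwards [ae_lt_top (hmB.add_const 1) this.ne] with ω hω
  exact (ENNReal.add_lt_top.1 hω).1.ne

lemma lintegral_mul_apply (hη : IsPoissonProcess P η lam)
    {B : Set X} (hB : MeasurableSet B) (hlB : lam B ≠ ∞)
    {h : Measure X → ℝ≥0∞} (hh : Measurable h) :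
    ∫⁻ ω, h (η ω) * η ω B ∂P = ∫⁻ x in B, ∫⁻ ω, h (η ω + Measure.dirac x) ∂P ∂lam := by
  rw [← hη.lintegral_map_eq (h := fun μ => h μ * μ B) (hh.mul (Measure.measurable_coe hB)),
    hη.isPoissonLaw.lintegral_mul_apply hB hlB hh]
  refine lintegral_congr fun x => ?_
  exact hη.lintegral_map_eq (hh.comp (measurable_id.add_const _))

lemma measurable_conf {lam : Measure X} {P : Measure Ω} {η : Ω → Measure X}
    (hη : IsPoissonProcess P η lam) : Measurable fun ω => (⟨η ω, hη.isConfiguration ω⟩ : Conf X) :=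
  hη.measurable.subtype_mk

lemma measurable_facSum_cut {lam : Measure X} {P : Measure Ω} {η : Ω → Measure X}
    (hη : IsPoissonProcess P η lam) {ι : Type*} [DecidableEq ι] {B : Set X} (hB : MeasurableSet B)
    (J : Finset ι) {A : ι → Set X} (hA : ∀ j, MeasurableSet (A j)) (hAB : ∀ j, A j ⊆ B) :
    Measurable fun ω => facSum (cut B (η ω)) J A := by
  have h := Measurable.comp (measurable_facSum hB J hA hAB) hη.measurable_conf
  rw [Function.comp_def] at h
  exact h

end IsPoissonProcess

lemma measurable_add_sum_dirac {ι : Type*} (J : Finset ι) :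
    Measurable fun z : (ι → X) × Measure X => z.2 + ∑ j ∈ J, Measure.dirac (z.1 j) := by
  refine measurable_snd.add (Finset.measurable_fun_sum _ fun j _ => ?_)
  exact Measure.measurable_dirac.comp ((measurable_pi_apply j).comp measurable_fst)

/-- The expectation of `h(η + ∑_{j ∈ J} δ_{x_j})`, for `x` in a box. -/
def boxShift {ι : Type*} (P : Measure Ω) (η : Ω → Measure X) (h : Measure X → ℝ≥0∞)
    (J : Finset ι) (A : ι → Set X) (x : ι → X) : ℝ≥0∞ :=
  (∏ j ∈ J, (A j).indicator 1 (x j)) * ∫⁻ ω, h (η ω + ∑ j ∈ J, Measure.dirac (x j)) ∂P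

lemma measurable_boxShift {ι : Type*} (hη : Measurable η) {h : Measure X → ℝ≥0∞}
    (hh : Measurable h) (J : Finset ι) {A : ι → Set X} (hA : ∀ j, MeasurableSet (A j)) :
    Measurable (boxShift P η h J A) := by
  refine Measurable.mul ?_ ?_
  · exact Finset.measurable_fun_prod _ fun j _ =>
      (measurable_one.indicator (hA j)).comp (measurable_pi_apply j)
  · have : Measurable fun z : (ι → X) × Ω => h (η z.2 + ∑ j ∈ J, Measure.dirac (z.1 j)) :=
      hh.comp ((measurable_add_sum_dirac J).comp
        (measurable_fst.prodMk (hη.comp measurable_snd)))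
    exact this.lintegral_prod_right'

/-- One step of the multivariate Mecke equation: the factor `μ (A a)` contributes a new point in
`A a` and the points in `A a` that are there already. -/
lemma IsPoissonProcess.boxShift_mul_apply (hη : IsPoissonProcess P η lam) {B : Set X}
    (hlB : lam B ≠ ∞) {ι : Type*} [DecidableEq ι] {J : Finset ι} {a : ι}
    (ha : a ∉ J) {A : ι → Set X} (hA : ∀ j, MeasurableSet (A j)) (hAB : ∀ j, A j ⊆ B)
    {h : Measure X → ℝ≥0∞} (hh : Measurable h) :
    boxShift P η (fun μ => h μ * μ (A a)) J A = fun y : ι → X =>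
      (∫⁻ z, boxShift P η h (insert a J) A (Function.update y a z) ∂lam)
        + ∑ j : J, boxShift P η h J (Function.update A j (A j ∩ A a)) y := by
  have hla : lam (A a) ≠ ∞ := ne_top_of_le_ne_top hlB (measure_mono (hAB a))
  ext y
  have hmy : Measurable fun ω => h (η ω + ∑ j ∈ J, Measure.dirac (y j)) :=
    hh.comp (hη.measurable.add_const _)
  have e1 : ∀ z, boxShift P η h (insert a J) A (Function.update y a z)
      = (A a).indicator (fun z => (∏ j ∈ J, (A j).indicator 1 (y j)) *
        ∫⁻ ω, h (η ω + Measure.dirac z + ∑ j ∈ J, Measure.dirac (y j)) ∂P) z := by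
    intro z
    have e2 : ∀ j ∈ J, Function.update y a z j = y j := fun j hj =>
      Function.update_of_ne (ne_of_mem_of_not_mem hj ha) _ _
    rw [boxShift, Finset.prod_insert ha, Finset.sum_insert ha, Function.update_self,
      Finset.prod_congr rfl (fun j hj => by rw [e2 j hj]),
      Finset.sum_congr rfl (fun j hj => by rw [e2 j hj])]
    simp_rw [← add_assoc]
    by_cases hz : z ∈ A a <;> simp [hz]
  simp_rw [e1]
  have hmz : Measurable fun z => ∫⁻ ω,
      h (η ω + Measure.dirac z + ∑ j ∈ J, Measure.dirac (y j)) ∂P := by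
    have : Measurable fun p : X × Ω =>
        h (η p.2 + Measure.dirac p.1 + ∑ j ∈ J, Measure.dirac (y j)) :=
      hh.comp (((hη.measurable.comp measurable_snd).add
        (Measure.measurable_dirac.comp measurable_fst)).add_const _)
    exact this.lintegral_prod_right'
  rw [lintegral_indicator (hA a), lintegral_const_mul _ hmz,
    ← hη.lintegral_mul_apply (hA a) hla
      (h := fun μ => h (μ + ∑ j ∈ J, Measure.dirac (y j))) (hh.comp (measurable_id.add_const _))]
  have e3 : ∀ j : J, boxShift P η h J (Function.update A j (A j ∩ A a)) y
      = (∏ j ∈ J, (A j).indicator 1 (y j)) *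
        ((A a).indicator 1 (y j) * ∫⁻ ω, h (η ω + ∑ j ∈ J, Measure.dirac (y j)) ∂P) := by
    intro j
    rw [boxShift, ← mul_assoc]
    congr 1
    rw [← Finset.mul_prod_erase _ _ j.2, ← Finset.mul_prod_erase _ _ j.2, Function.update_self,
      Set.inter_indicator_one, Pi.mul_apply, mul_right_comm]
    congr 2
    refine Finset.prod_congr rfl fun l hl => ?_
    rw [Function.update_of_ne (Finset.ne_of_mem_erase hl)]
  simp_rw [e3]
  rw [boxShift, ← Finset.mul_sum, ← mul_add, ← Finset.sum_mul]
  congr 1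
  rw [← lintegral_const_mul _ hmy, ← lintegral_add_left]
  · refine lintegral_congr fun ω => ?_
    rw [Measure.add_apply, Measure.finsetSum_apply, mul_add,
      mul_comm (∑ j : J, _), Finset.sum_coe_sort J (fun j => (A a).indicator 1 (y j))]
    simp_rw [Measure.dirac_apply' _ (hA a)]
  · exact hmy.mul ((Measure.measurable_coe (hA a)).comp hη.measurable)

/-- The multivariate Mecke equation on boxes. -/
theorem IsPoissonProcess.mecke_box (hη : IsPoissonProcess P η lam) {B : Set X}
    (hB : MeasurableSet B) (hlB : lam B ≠ ∞) {ι : Type*} [DecidableEq ι] (J : Finset ι) :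
    ∀ {A : ι → Set X}, (∀ j, MeasurableSet (A j)) → (∀ j, A j ⊆ B) →
    ∀ {h : Measure X → ℝ≥0∞}, Measurable h →
    (∃ C ≠ ∞, ∃ m : ℕ, ∀ μ, h μ ≤ C * (μ B + 1) ^ m) → ∀ x : ι → X,
    ∫⁻ ω, h (η ω) * facSum (cut B (η ω)) J A ∂P = (∫⋯∫⁻_J, boxShift P η h J A ∂fun _ => lam) x := by
  induction J using Finset.induction_on with
  | empty => intro A _ _ h _ _ x; simp [facSum_empty, boxShift]
  | insert a J ha ih =>
    intro A hA hAB h hh ⟨C, hC, m, hm⟩ x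
    have hu := fun j : J => update_inter_box hA hAB (j : ι) a
    have hmf : ∀ (J' : Finset ι) {A' : ι → Set X}, (∀ j, MeasurableSet (A' j)) →
        (∀ j, A' j ⊆ B) → Measurable fun ω => h (η ω) * facSum (cut B (η ω)) J' A' :=
      fun J' A' hA' hAB' => Measurable.mul (hh.comp hη.measurable)
        (hη.measurable_facSum_cut hB J' hA' hAB')
    have hfin : ∑ j : J, ∫⁻ ω, h (η ω) *
        facSum (cut B (η ω)) J (Function.update A j (A j ∩ A a)) ∂P ≠ ∞ := by
      rw [ENNReal.sum_ne_top]
      intro j _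
      refine ne_top_of_le_ne_top (ENNReal.mul_ne_top hC
        (hη.lintegral_add_one_pow_lt_top hB hlB (m + J.card)).ne) ?_
      have hmB : Measurable fun ω => η ω B := (Measure.measurable_coe hB).comp hη.measurable
      rw [← lintegral_const_mul _ ((hmB.add_const 1).pow_const _)]
      refine lintegral_mono fun ω => ?_
      rw [pow_add, ← mul_assoc]
      refine mul_le_mul' (hm _) ((facSum_le ((hη.isConfiguration ω).cut B) J (hu j).1).trans ?_)
      rw [← Finset.prod_const]
      refine Finset.prod_le_prod' fun l _ => ?_
      calc cut B (η ω) _ ≤ η ω B := (cut_apply_le _ _ _).trans (measure_mono ((hu j).2 l))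
        _ ≤ _ := le_self_add
    have hih : ∀ j : J, ∫⁻ ω, h (η ω) *
        facSum (cut B (η ω)) J (Function.update A j (A j ∩ A a)) ∂P
        = (∫⋯∫⁻_J, boxShift P η h J (Function.update A j (A j ∩ A a)) ∂fun _ => lam) x :=
      fun j => ih (hu j).1 (hu j).2 hh ⟨C, hC, m, hm⟩ x
    have hha : Measurable fun μ : Measure X => h μ * μ (A a) := hh.mul (Measure.measurable_coe (hA a))
    -- The recursion for the factorial measure, integrated: the number of points in `A a`
    -- times the factorial measure of the other sides counts the tuples with a new point in `A
    -- a`, and those where the additional point is one of the others.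
    have hL : ∫⁻ ω, h (η ω) * facSum (cut B (η ω)) (insert a J) A ∂P
        + ∑ j : J, ∫⁻ ω, h (η ω) * facSum (cut B (η ω)) J (Function.update A j (A j ∩ A a)) ∂P
        = (∫⋯∫⁻_J, boxShift P η (fun μ => h μ * μ (A a)) J A ∂fun _ => lam) x := by
      rw [← ih hA hAB hha ⟨C, hC, m + 1, fun μ => ?_⟩ x, ← lintegral_finsetSum,
        ← lintegral_add_left (hmf _ hA hAB)]
      · refine lintegral_congr_ae ?_
        filter_upwards [hη.ae_apply_ne_top hB hlB] with ω hω
        rw [← Finset.mul_sum, ← mul_add, facSum_insert ((hη.isConfiguration ω).cut B) ha hA,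
          mul_right_comm, mul_assoc, cut_of_ne_top hω]
      · exact fun j _ => hmf _ (hu j).1 (hu j).2
      · rw [pow_succ, ← mul_assoc]
        exact mul_le_mul' (hm μ) ((measure_mono (hAB a)).trans le_self_add)
    have hR := hη.boxShift_mul_apply hlB ha hA hAB hh
    have hmI := measurable_boxShift (P := P) hη.measurable hh (insert a J) hA
    have hmu : Measurable fun y : ι → X =>
        ∫⁻ z, boxShift P η h (insert a J) A (Function.update y a z) ∂lam := by
      have : Measurable fun p : (ι → X) × X => Function.update p.1 a p.2 := by
        refine measurable_pi_iff.2 fun l => ?_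
        by_cases hl : l = a
        · subst hl; simpa using measurable_snd
        · have h6 : (fun p : (ι → X) × X => Function.update p.1 a p.2 l) = fun p => p.1 l := by
            ext p; exact Function.update_of_ne hl _ _
          rw [h6]
          exact (measurable_pi_apply l).comp measurable_fst
      exact (hmI.comp this).lintegral_prod_right'
    -- The right-hand side satisfies the same recursion, by the univariate Mecke equation; the
    -- finite correction terms agree by induction and are cancelled.
    have hRR : (∫⋯∫⁻_J, boxShift P η (fun μ => h μ * μ (A a)) J A ∂fun _ => lam) x
        = (∫⋯∫⁻_insert a J, boxShift P η h (insert a J) A ∂fun _ => lam) x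
        + ∑ j : J, (∫⋯∫⁻_J, boxShift P η h J (Function.update A j (A j ∩ A a)) ∂fun _ => lam) x := by
      rw [lmarginal_insert' _ hmI ha, hR]
      simp only [lmarginal]
      have hmu' : Measurable fun y : J → X => ∫⁻ z, boxShift P η h (insert a J) A
          (Function.update (Function.updateFinset x J y) a z) ∂lam :=
        hmu.comp measurable_updateFinset
      rw [lintegral_add_left hmu', lintegral_finsetSum]
      exact fun j _ => (measurable_boxShift hη.measurable hh J (hu j).1).comp measurable_updateFinset
    rw [hRR] at hL
    simp_rw [← hih] at hL
    exact (ENNReal.add_left_inj hfin).1 hL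

end

section

variable {X : Type*} [MeasurableSpace X] {Ω : Type*} [MeasurableSpace Ω]

/-! ### The multivariate Mecke equation -/

/-- The cube `B^n`. -/
def cube (B : Set X) (n : ℕ) : Set (Fin n → X) := Set.univ.pi fun _ => B

lemma measurableSet_cube {B : Set X} (hB : MeasurableSet B) (n : ℕ) :
    MeasurableSet (cube B n) := MeasurableSet.univ_pi fun _ => hB

/-- The measure `μ^{(|J|)} ⊗ lam^{n-|J|}` on the cube `B^n`; configurations with infinitely many
points in `B` are replaced by the empty configuration. -/
def facKernel (lam : Measure X) (B : Set X) {n : ℕ} (J : Finset (Fin n)) (μ : Measure X) :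
    Measure (Fin n → X) :=
  (factorialProd lam (cut B μ) J).restrict (cube B n)

section facKernel

variable {lam : Measure X} {B : Set X} {n : ℕ}

lemma IsPoint.isFiniteMeasure {ν : Measure X} (h : IsPoint ν) : IsFiniteMeasure ν :=
  ⟨by rcases h _ MeasurableSet.univ with h | h <;> simp [h]⟩

lemma factorialProd_pi [SigmaFinite lam] {μ : Measure X} (hμ : IsConfiguration μ) (J : Finset (Fin n))
    {A : Fin n → Set X} (hA : ∀ j, MeasurableSet (A j)) :
    factorialProd lam μ J (Set.univ.pi A) = facSum μ J A * ∏ j ∈ Jᶜ, lam (A j) := by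
  rw [factorialProd, Measure.sum_apply _ (MeasurableSet.univ_pi hA), facSum,
    ← ENNReal.tsum_mul_right]
  refine tsum_congr fun i => ?_
  have hs : ∀ j : Fin n,
      SigmaFinite (if h : j ∈ J then points μ (i ⟨j, h⟩) else lam) := by
    intro j
    split_ifs with h
    · have := (hμ.isPoint_points (i ⟨j, h⟩)).isFiniteMeasure
      infer_instance
    · infer_instance
  rw [Measure.pi_pi]
  have h1 : ∀ j : Fin n, (if h : j ∈ J then points μ (i ⟨j, h⟩) else lam) (A j)
      = if h : j ∈ J then points μ (i ⟨j, h⟩) (A j) else lam (A j) := by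
    intro j; split_ifs <;> rfl
  simp_rw [h1]
  rw [Fintype.prod_dite]
  refine congrArg₂ (· * ·) (Finset.prod_congr (Finset.ext fun x => by simp) fun x _ => rfl) ?_
  exact (Finset.prod_subtype Jᶜ (fun j => Finset.mem_compl) fun j => lam (A j)).symm

lemma facKernel_pi [SigmaFinite lam] {μ : Measure X} (hμ : IsConfiguration μ) (hB : MeasurableSet B)
    (J : Finset (Fin n)) {A : Fin n → Set X} (hA : ∀ j, MeasurableSet (A j)) :
    facKernel lam B J μ (Set.univ.pi A)
      = facSum (cut B μ) J (fun j => A j ∩ B) * ∏ j ∈ Jᶜ, lam (A j ∩ B) := by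
  rw [facKernel, Measure.restrict_apply (MeasurableSet.univ_pi hA), cube, ← Set.pi_inter_distrib,
    factorialProd_pi (hμ.cut B) J fun j => (hA j).inter hB]

lemma facKernel_univ_le [SigmaFinite lam] {μ : Measure X} (hμ : IsConfiguration μ)
    (hB : MeasurableSet B)
    (J : Finset (Fin n)) :
    facKernel lam B J μ Set.univ ≤ (cut B μ B) ^ J.card * lam B ^ Jᶜ.card := by
  have h := facKernel_pi (lam := lam) hμ hB J (A := fun _ => Set.univ) fun _ => MeasurableSet.univ
  rw [Set.pi_univ] at h
  rw [h]
  simp only [Set.univ_inter, Finset.prod_const]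
  gcongr
  refine (facSum_le (hμ.cut B) J fun _ => hB).trans ?_
  rw [Finset.prod_const]

lemma isFiniteMeasure_facKernel [SigmaFinite lam] {μ : Measure X} (hμ : IsConfiguration μ)
    (hB : MeasurableSet B)
    (hlB : lam B ≠ ∞) (J : Finset (Fin n)) : IsFiniteMeasure (facKernel lam B J μ) :=
  ⟨(facKernel_univ_le hμ hB J).trans_lt (ENNReal.mul_lt_top
    (ENNReal.pow_lt_top (cut_apply_ne_top B μ).lt_top) (ENNReal.pow_lt_top hlB.lt_top))⟩

lemma measurable_facKernel [SigmaFinite lam] (hB : MeasurableSet B) (hlB : lam B ≠ ∞)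
    (J : Finset (Fin n)) :
    Measurable fun μ : Conf X => facKernel lam B J (μ : Measure X) := by
  have := fun μ : Conf X => isFiniteMeasure_facKernel μ.2 hB hlB J
  have hbox : ∀ A : Fin n → Set X, (∀ j, MeasurableSet (A j)) →
      Measurable fun μ : Conf X => facKernel lam B J (μ : Measure X) (Set.univ.pi A) := by
    intro A hA
    simp_rw [fun μ : Conf X => facKernel_pi (lam := lam) μ.2 hB J hA]
    exact (measurable_facSum hB J (fun j => (hA j).inter hB)
      fun j => Set.inter_subset_right).mul_const _
  refine Measurable.measure_of_isPiSystem generateFrom_pi.symm isPiSystem_pi ?_ ?_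
  · rintro _ ⟨A, hA, rfl⟩
    exact hbox A fun j => hA j (Set.mem_univ j)
  · have := hbox (fun _ => Set.univ) fun _ => MeasurableSet.univ
    rwa [Set.pi_univ] at this

/-- For functions supported in `B^n`, the kernel `facKernel` agrees with the product of the
factorial measure and powers of `lam`, unless `B` has infinitely many points. -/
lemma integral_factorialProd {μ : Measure X} (hμB : μ B ≠ ∞) (J : Finset (Fin n))
    {g : (Fin n → X) → ℝ} (hg : ∀ x, x ∉ cube B n → g x = 0) :
    ∫ x, g x ∂(factorialProd lam μ J) = ∫ x, g x ∂(facKernel lam B J μ) := by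
  rw [facKernel, cut_of_ne_top hμB, setIntegral_eq_integral_of_forall_compl_eq_zero hg]

end facKernel

/-- Integrating a box indicator over the coordinates on which the other factor does not depend. -/
lemma lmarginal_prod_indicator_mul {ι : Type*} [DecidableEq ι] {lam : Measure X} [SigmaFinite lam]
    (t : Finset ι) {A : ι → Set X} (hA : ∀ j, MeasurableSet (A j)) {Φ : (ι → X) → ℝ≥0∞}
    (hΦ : ∀ x y, Φ (Function.updateFinset x t y) = Φ x) (x : ι → X) :
    (∫⋯∫⁻_t, (fun z => (∏ j ∈ t, (A j).indicator 1 (z j)) * Φ z) ∂fun _ => lam) x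
      = (∏ j ∈ t, lam (A j)) * Φ x := by
  rw [lmarginal]
  simp_rw [hΦ]
  have h1 : ∀ y : t → X, ∏ j ∈ t, (A j).indicator (1 : X → ℝ≥0∞) (Function.updateFinset x t y j)
      = (Set.univ.pi fun j : t => A j).indicator 1 y := by
    intro y
    rw [← Finset.prod_coe_sort]
    have h2 : ∀ j : t, Function.updateFinset x t y j = y j := fun j => by
      simp [Function.updateFinset]
    simp_rw [h2]
    by_cases hy : y ∈ Set.univ.pi fun j : t => A j
    · rw [Set.indicator_of_mem hy]
      exact Finset.prod_eq_one fun j _ => Set.indicator_of_mem (hy j (Set.mem_univ j)) _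
    · rw [Set.indicator_of_notMem hy]
      simp only [Set.mem_pi, Set.mem_univ, true_imp_iff, not_forall] at hy
      obtain ⟨j, hj⟩ := hy
      exact Finset.prod_eq_zero (Finset.mem_univ j) (Set.indicator_of_notMem hj _)
  simp_rw [h1]
  have hm : MeasurableSet (Set.univ.pi fun j : t => A j) := MeasurableSet.univ_pi fun j => hA j
  rw [lintegral_mul_const _ (measurable_one.indicator hm), lintegral_indicator_one hm,
    Measure.pi_pi, Finset.prod_coe_sort t fun j => lam (A j)]

variable {lam : Measure X} [SigmaFinite lam] {P : Measure Ω} [IsProbabilityMeasure P]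
  {η : Ω → Measure X}

/-- The expectation of `h(η + ∑_{j ∈ J} δ_{x_j})`. -/
def shiftMean {ι : Type*} (P : Measure Ω) (η : Ω → Measure X) (h : Measure X → ℝ≥0∞)
    (J : Finset ι) (x : ι → X) : ℝ≥0∞ :=
  ∫⁻ ω, h (η ω + ∑ j ∈ J, Measure.dirac (x j)) ∂P

lemma measurable_shiftMean {ι : Type*} (hη : Measurable η) {h : Measure X → ℝ≥0∞}
    (hh : Measurable h) (J : Finset ι) : Measurable (shiftMean P η h J) := by
  have : Measurable fun z : (ι → X) × Ω => h (η z.2 + ∑ j ∈ J, Measure.dirac (z.1 j)) :=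
    hh.comp ((measurable_add_sum_dirac J).comp
      (measurable_fst.prodMk (hη.comp measurable_snd)))
  exact this.lintegral_prod_right'

lemma IsPoissonProcess.measurable_facKernel {lam : Measure X} [SigmaFinite lam]
    {P : Measure Ω} {η : Ω → Measure X} (hη : IsPoissonProcess P η lam) {B : Set X}
    (hB : MeasurableSet B) (hlB : lam B ≠ ∞) {n : ℕ} (J : Finset (Fin n)) :
    Measurable fun ω => facKernel lam B J (η ω) := by
  have h : Measurable ((fun μ : Conf X => facKernel lam B J (μ : Measure X)) ∘
      fun ω => (⟨η ω, hη.isConfiguration ω⟩ : Conf X)) :=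
    (PoissonMehler.measurable_facKernel hB hlB J).comp hη.measurable_conf
  exact h

/-- The multivariate Mecke equation for bounded functionals of `η` and boxes in `B^n`: the
coordinates in `J` carry points of `η` and are covered by `mecke_box`, those in `Jᶜ` are integrated
with respect to `lam`. -/
lemma IsPoissonProcess.mecke_facKernel_pi (hη : IsPoissonProcess P η lam) {B : Set X}
    (hB : MeasurableSet B) (hlB : lam B ≠ ∞) {n : ℕ} (J : Finset (Fin n)) {h : Measure X → ℝ≥0∞}
    (hh : Measurable h) {C : ℝ≥0∞} (hC : C ≠ ∞) (hhC : ∀ μ, h μ ≤ C) {A : Fin n → Set X}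
    (hA : ∀ j, MeasurableSet (A j)) :
    ∫⁻ ω, h (η ω) * facKernel lam B J (η ω) (Set.univ.pi A) ∂P
      = ∫⁻ x in Set.univ.pi A, (cube B n).indicator 1 x * shiftMean P η h J x
        ∂(Measure.pi fun _ => lam) := by
  rcases isEmpty_or_nonempty (Fin n → X) with hX | ⟨⟨x₀⟩⟩
  · simp [Set.eq_empty_of_isEmpty]
  have hAB : ∀ j, MeasurableSet (A j ∩ B) := fun j => (hA j).inter hB
  have hm : Measurable fun ω => h (η ω) * facSum (cut B (η ω)) J (fun j => A j ∩ B) :=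
    Measurable.mul (hh.comp hη.measurable)
      (hη.measurable_facSum_cut hB J hAB fun j => Set.inter_subset_right)
  simp_rw [fun ω => facKernel_pi (lam := lam) (hη.isConfiguration ω) hB J hA, ← mul_assoc]
  rw [lintegral_mul_const _ hm, hη.mecke_box hB hlB J hAB (fun j => Set.inter_subset_right) hh
    ⟨C, hC, 0, fun μ => by simpa using hhC μ⟩ x₀, mul_comm]
  let F : (Fin n → X) → ℝ≥0∞ := fun z =>
    (∏ j ∈ Jᶜ, (A j ∩ B).indicator 1 (z j)) * boxShift P η h J (fun j => A j ∩ B) z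
  have hmb := measurable_boxShift (P := P) hη.measurable hh J hAB
  have hF : Measurable F := Measurable.mul
    (Finset.measurable_fun_prod _ fun j _ =>
      (measurable_one.indicator (hAB j)).comp (measurable_pi_apply j)) hmb
  have h1 : ∫⁻ x in Set.univ.pi A, (cube B n).indicator 1 x * shiftMean P η h J x
      ∂(Measure.pi fun _ => lam) = ∫⁻ x, F x ∂(Measure.pi fun _ => lam) := by
    rw [← lintegral_indicator (MeasurableSet.univ_pi hA)]
    refine lintegral_congr fun x => ?_
    simp only [F, boxShift]
    rw [← mul_assoc, mul_comm (∏ j ∈ Jᶜ, _), Finset.prod_mul_prod_compl]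
    by_cases hx : x ∈ Set.univ.pi A ∩ cube B n
    · rw [Set.indicator_of_mem hx.1, Set.indicator_of_mem hx.2, Finset.prod_eq_one, shiftMean]
      · rfl
      · intro j _
        have hj : x j ∈ A j ∩ B := ⟨hx.1 j (Set.mem_univ j), hx.2 j (Set.mem_univ j)⟩
        exact Set.indicator_of_mem hj _
    · have hx' := hx
      rw [cube, ← Set.pi_inter_distrib] at hx'
      simp only [Set.mem_pi, Set.mem_univ, true_imp_iff, not_forall] at hx'
      obtain ⟨j, hj⟩ := hx'
      rw [Finset.prod_eq_zero (Finset.mem_univ j) (Set.indicator_of_notMem hj _), zero_mul]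
      by_cases hx1 : x ∈ Set.univ.pi A
      · rw [Set.indicator_of_mem hx1, Set.indicator_of_notMem fun hx2 => hx ⟨hx1, hx2⟩, zero_mul]
      · rw [Set.indicator_of_notMem hx1]
  rw [h1, lintegral_eq_lmarginal_univ x₀, ← Finset.union_compl J,
    lmarginal_union _ F hF disjoint_compl_right]
  have h2 : (∫⋯∫⁻_Jᶜ, F ∂fun _ => lam)
      = fun x => (∏ j ∈ Jᶜ, lam (A j ∩ B)) * boxShift P η h J (fun j => A j ∩ B) x := by
    ext x
    refine lmarginal_prod_indicator_mul Jᶜ hAB (fun x y => ?_) x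
    have h3 : ∀ j ∈ J, Function.updateFinset x Jᶜ y j = x j := fun j hj => by
      simp [Function.updateFinset, hj]
    simp only [boxShift]
    rw [Finset.prod_congr rfl fun j hj => by rw [h3 j hj],
      Finset.sum_congr rfl fun j hj => by rw [h3 j hj]]
  rw [h2]
  simp only [lmarginal]
  rw [lintegral_const_mul]
  exact hmb.comp measurable_updateFinset

/-- The multivariate Mecke equation for bounded functionals of `η`: both sides define finite
measures in `φ`, which agree on boxes. -/
lemma IsPoissonProcess.mecke_of_le (hη : IsPoissonProcess P η lam) {B : Set X}
    (hB : MeasurableSet B) (hlB : lam B ≠ ∞) {n : ℕ} (J : Finset (Fin n)) {h : Measure X → ℝ≥0∞}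
    (hh : Measurable h) {C : ℝ≥0∞} (hC : C ≠ ∞) (hhC : ∀ μ, h μ ≤ C) {φ : (Fin n → X) → ℝ≥0∞}
    (hφ : Measurable φ) :
    ∫⁻ ω, h (η ω) * ∫⁻ x, φ x ∂(facKernel lam B J (η ω)) ∂P
      = ∫⁻ x in cube B n, φ x * shiftMean P η h J x ∂(Measure.pi fun _ => lam) := by
  have hκ : Measurable fun ω => facKernel lam B J (η ω) :=
    hη.measurable_facKernel hB hlB J
  have hhη : Measurable fun ω => h (η ω) := hh.comp hη.measurable
  have hms := measurable_shiftMean (P := P) hη.measurable hh J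
  let M₁ : Measure (Fin n → X) := (P.withDensity fun ω => h (η ω)).bind fun ω =>
    facKernel lam B J (η ω)
  let M₂ : Measure (Fin n → X) := ((Measure.pi fun _ => lam).restrict (cube B n)).withDensity
    (shiftMean P η h J)
  have h1 : ∀ {φ : (Fin n → X) → ℝ≥0∞}, Measurable φ →
      ∫⁻ x, φ x ∂M₁ = ∫⁻ ω, h (η ω) * ∫⁻ x, φ x ∂(facKernel lam B J (η ω)) ∂P := by
    intro φ hφ
    have hi : Measurable fun ω => ∫⁻ x, φ x ∂(facKernel lam B J (η ω)) :=
      (Measure.measurable_lintegral hφ).comp hκ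
    rw [Measure.lintegral_bind hκ.aemeasurable hφ.aemeasurable,
      lintegral_withDensity_eq_lintegral_mul _ hhη hi]
    rfl
  have h2 : ∀ {φ : (Fin n → X) → ℝ≥0∞}, Measurable φ →
      ∫⁻ x, φ x ∂M₂ = ∫⁻ x in cube B n, φ x * shiftMean P η h J x ∂(Measure.pi fun _ => lam) := by
    intro φ hφ
    rw [lintegral_withDensity_eq_lintegral_mul _ hms hφ]
    exact lintegral_congr fun x => mul_comm _ _
  have hbox : ∀ A : Fin n → Set X, (∀ j, MeasurableSet (A j)) →
      M₁ (Set.univ.pi A) = M₂ (Set.univ.pi A) := by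
    intro A hA
    have hmA := MeasurableSet.univ_pi hA
    have h3 := hη.mecke_facKernel_pi hB hlB J hh hC hhC hA
    rw [← lintegral_indicator_one hmA, ← lintegral_indicator_one hmA,
      h1 (measurable_one.indicator hmA), h2 (measurable_one.indicator hmA)]
    simp_rw [lintegral_indicator_one hmA]
    rw [h3, ← lintegral_indicator hmA, ← lintegral_indicator (measurableSet_cube hB n)]
    refine lintegral_congr fun x => ?_
    by_cases hx1 : x ∈ Set.univ.pi A <;> by_cases hx2 : x ∈ cube B n <;> simp [hx1, hx2]
  have huniv : M₁ Set.univ = M₂ Set.univ := by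
    have := hbox (fun _ => Set.univ) fun _ => MeasurableSet.univ
    rwa [Set.pi_univ] at this
  have hM2 : M₂ Set.univ < ∞ := by
    rw [← lintegral_one, h2 measurable_const]
    calc ∫⁻ x in cube B n, 1 * shiftMean P η h J x ∂(Measure.pi fun _ => lam)
        ≤ ∫⁻ x in cube B n, C ∂(Measure.pi fun _ => lam) := by
          refine lintegral_mono fun x => ?_
          rw [one_mul]
          exact (lintegral_mono fun ω => hhC _).trans (by simp)
      _ < ∞ := by
          rw [setLIntegral_const, cube, Measure.pi_pi]
          exact ENNReal.mul_lt_top hC.lt_top (ENNReal.prod_lt_top fun _ _ => hlB.lt_top)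
  have hfin : IsFiniteMeasure M₁ := ⟨huniv ▸ hM2⟩
  have : M₁ = M₂ := by
    refine ext_of_generate_finite _ generateFrom_pi.symm isPiSystem_pi ?_ huniv
    rintro _ ⟨A, hA, rfl⟩
    exact hbox A fun j => hA j (Set.mem_univ j)
  rw [← h1 hφ, this, h2 hφ]

/-- The multivariate Mecke equation, by monotone approximation of `h`. -/
theorem IsPoissonProcess.multivariate_mecke (hη : IsPoissonProcess P η lam) {B : Set X}
    (hB : MeasurableSet B) (hlB : lam B ≠ ∞) {n : ℕ} (J : Finset (Fin n)) {h : Measure X → ℝ≥0∞}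
    (hh : Measurable h) {φ : (Fin n → X) → ℝ≥0∞} (hφ : Measurable φ) :
    ∫⁻ ω, h (η ω) * ∫⁻ x, φ x ∂(facKernel lam B J (η ω)) ∂P
      = ∫⁻ x in cube B n, φ x * shiftMean P η h J x ∂(Measure.pi fun _ => lam) := by
  have hκ : Measurable fun ω => ∫⁻ x, φ x ∂(facKernel lam B J (η ω)) :=
    (Measure.measurable_lintegral hφ).comp
      (hη.measurable_facKernel hB hlB J)
  let u : ℕ → Measure X → ℝ≥0∞ := fun k μ => min (h μ) k
  have hu : ∀ k, Measurable (u k) := fun k => hh.min measurable_const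
  have humono : Monotone u := fun k l hkl μ => min_le_min_left _ (by exact_mod_cast hkl)
  have hsup : ∀ μ, ⨆ k, u k μ = h μ := by
    intro μ
    simp only [u]
    rw [← inf_iSup_eq, ENNReal.iSup_natCast, inf_top_eq]
  have h1 := fun k => hη.mecke_of_le hB hlB J (hu k) (ENNReal.natCast_ne_top k)
    (fun μ => min_le_right _ _) hφ
  have hs : ∀ x, shiftMean P η h J x = ⨆ k, shiftMean P η (u k) J x := by
    intro x
    simp only [shiftMean]
    have hux : ∀ k, Measurable fun ω => u k (η ω + ∑ j ∈ J, Measure.dirac (x j)) :=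
      fun k => (hu k).comp (hη.measurable.add_const _)
    rw [← lintegral_iSup hux fun k l hkl ω => humono hkl _]
    simp_rw [hsup]
  simp_rw [hs, ENNReal.mul_iSup]
  have hm1 : ∀ k, Measurable fun x => φ x * shiftMean P η (u k) J x :=
    fun k => hφ.mul (measurable_shiftMean hη.measurable (hu k) J)
  have hm2 : ∀ k, Measurable fun ω => u k (η ω) * ∫⁻ x, φ x ∂(facKernel lam B J (η ω)) :=
    fun k => Measurable.mul ((hu k).comp hη.measurable) hκ
  rw [lintegral_iSup hm1
    fun k l hkl x => mul_le_mul_right (lintegral_mono fun ω => humono hkl _) _]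
  simp_rw [← h1]
  rw [← lintegral_iSup hm2
    fun k l hkl ω => mul_le_mul_left (humono hkl _) _]
  simp_rw [← ENNReal.iSup_mul, hsup]

/-! ### Pathwise integrals with respect to `η - lam` -/

/-- Second moments of the factorial measures of a cube of finite intensity; they are bounded by
moments of the number of points in `B`. -/
lemma IsPoissonProcess.lintegral_facKernel_univ_sq_lt_top (hη : IsPoissonProcess P η lam)
    {B : Set X} (hB : MeasurableSet B) (hlB : lam B ≠ ∞) {n : ℕ} (J : Finset (Fin n)) :
    ∫⁻ ω, (facKernel lam B J (η ω) Set.univ) ^ (2 : ℝ) ∂P < ∞ := by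
  have hmB : Measurable fun ω => η ω B := (Measure.measurable_coe hB).comp hη.measurable
  calc ∫⁻ ω, (facKernel lam B J (η ω) Set.univ) ^ (2 : ℝ) ∂P
      ≤ ∫⁻ ω, (η ω B + 1) ^ (J.card * 2) * (lam B ^ Jᶜ.card) ^ 2 ∂P := by
        refine lintegral_mono fun ω => ?_
        rw [show (2 : ℝ) = (2 : ℕ) by norm_num, ENNReal.rpow_natCast, pow_mul, ← mul_pow]
        gcongr
        refine (facKernel_univ_le (hη.isConfiguration ω) hB J).trans ?_
        gcongr
        exact (cut_apply_le _ _ _).trans le_self_add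
    _ < ∞ := by
        rw [lintegral_mul_const _ ((hmB.add_const 1).pow_const _)]
        exact ENNReal.mul_lt_top (hη.lintegral_add_one_pow_lt_top hB hlB _)
          (ENNReal.pow_lt_top (ENNReal.pow_lt_top hlB.lt_top))

/-- `L²` bounds for `f(η)` give `L¹` bounds on cubes for the functionals `f(η + ∑ δ_{x_j})`: by the
Mecke equation these are expectations of `|f(η)|` times the mass of a factorial measure, to which
the Cauchy–Schwarz inequality applies. -/
lemma IsPoissonProcess.exists_lintegral_shift_le (hη : IsPoissonProcess P η lam)
    {B : Set X} (hB : MeasurableSet B) (hlB : lam B ≠ ∞) {n : ℕ} (J : Finset (Fin n)) :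
    ∃ C ≠ ∞, ∀ f : Measure X → ℝ, Measurable f →
      ∫⁻ x in cube B n, ∫⁻ ω, ‖f (η ω + ∑ j ∈ J, Measure.dirac (x j))‖ₑ ∂P
        ∂(Measure.pi fun _ => lam) ≤ C * eLpNorm (fun ω => f (η ω)) 2 P := by
  refine ⟨(∫⁻ ω, (facKernel lam B J (η ω) Set.univ) ^ (2 : ℝ) ∂P) ^ (1 / (2 : ℝ)),
    ENNReal.rpow_ne_top_of_nonneg (by norm_num)
      (hη.lintegral_facKernel_univ_sq_lt_top hB hlB J).ne, fun f hf => ?_⟩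
  have h1 := hη.multivariate_mecke hB hlB J hf.enorm (φ := fun _ => 1) measurable_const
  simp only [lintegral_const, one_mul] at h1
  have hκ : Measurable fun ω => facKernel lam B J (η ω) Set.univ :=
    (Measure.measurable_coe MeasurableSet.univ).comp (hη.measurable_facKernel hB hlB J)
  have hfη : Measurable fun ω => ‖f (η ω)‖ₑ := hf.enorm.comp hη.measurable
  have h2 := ENNReal.lintegral_mul_le_Lp_mul_Lq P (p := 2) (q := 2)
    (by constructor <;> norm_num) hκ.aemeasurable hfη.aemeasurable
  rw [eLpNorm_eq_lintegral_rpow_enorm_toReal (by norm_num) (by norm_num)]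
  simp only [ENNReal.toReal_ofNat]
  refine le_trans (le_of_eq ?_) h2
  exact h1.symm.trans (lintegral_congr fun ω => mul_comm _ _)

section Pathwise

variable {B : Set X} {n : ℕ} {g : (Fin n → X) → ℝ}

lemma IsPoissonProcess.ae_compensatedIntegral_eq (hη : IsPoissonProcess P η lam)
    (hB : MeasurableSet B) (hlB : lam B ≠ ∞) (hg0 : ∀ x, x ∉ cube B n → g x = 0) :
    ∀ᵐ ω ∂P, compensatedIntegral lam (η ω) g
      = ∑ J : Finset (Fin n), (-1 : ℝ) ^ (n - J.card) * ∫ x, g x ∂(facKernel lam B J (η ω)) := by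
  filter_upwards [hη.ae_apply_ne_top hB hlB] with ω hω
  simp_rw [compensatedIntegral, integral_factorialProd hω _ hg0]

lemma measurable_integral_facKernel (hB : MeasurableSet B) (hlB : lam B ≠ ∞) (J : Finset (Fin n))
    (hg : Measurable g) {M : ℝ} (hM : ∀ x, |g x| ≤ M) :
    Measurable fun μ : Conf X => ∫ x, g x ∂(facKernel lam B J (μ : Measure X)) := by
  have h := measurable_facKernel hB hlB J (lam := lam)
  have h1 : ∀ μ : Conf X, ∫ x, g x ∂(facKernel lam B J (μ : Measure X))
      = (∫⁻ x, ENNReal.ofReal (g x) ∂(facKernel lam B J (μ : Measure X))).toReal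
        - (∫⁻ x, ENNReal.ofReal (-g x) ∂(facKernel lam B J (μ : Measure X))).toReal := by
    intro μ
    have := isFiniteMeasure_facKernel (lam := lam) μ.2 hB hlB J
    exact integral_eq_lintegral_pos_part_sub_lintegral_neg_part
      (Integrable.of_bound hg.aestronglyMeasurable M (ae_of_all _ hM))
  simp_rw [h1]
  exact ((Measure.measurable_lintegral hg.ennreal_ofReal).comp h).ennreal_toReal.sub
    ((Measure.measurable_lintegral hg.neg.ennreal_ofReal).comp h).ennreal_toReal

/-- The pathwise integral of a bounded function on a cube depends measurably on `η`. -/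
lemma IsPoissonProcess.exists_representative_compensatedIntegral (hη : IsPoissonProcess P η lam)
    (hB : MeasurableSet B) (hlB : lam B ≠ ∞) (hg : Measurable g) {M : ℝ} (hM : ∀ x, |g x| ≤ M)
    (hg0 : ∀ x, x ∉ cube B n → g x = 0) :
    ∃ Φ : Measure X → ℝ, IsRepresentative P η Φ fun ω => compensatedIntegral lam (η ω) g := by
  obtain ⟨Φ, hΦ, he⟩ := exists_measurable_extension (Φ := fun μ : Conf X =>
    ∑ J : Finset (Fin n), (-1 : ℝ) ^ (n - J.card) * ∫ x, g x ∂(facKernel lam B J (μ : Measure X)))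
    (Finset.measurable_fun_sum _ fun J _ =>
      (measurable_integral_facKernel hB hlB J hg hM).const_mul _)
  refine ⟨Φ, hΦ, ?_⟩
  filter_upwards [hη.ae_compensatedIntegral_eq hB hlB hg0] with ω hω
  rw [hω, he ⟨η ω, hη.isConfiguration ω⟩]

lemma IsPoissonProcess.memLp_integral_facKernel (hη : IsPoissonProcess P η lam)
    (hB : MeasurableSet B) (hlB : lam B ≠ ∞) (J : Finset (Fin n)) (hg : Measurable g) {M : ℝ}
    (hM : ∀ x, |g x| ≤ M) : MemLp (fun ω => ∫ x, g x ∂(facKernel lam B J (η ω))) 2 P := by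
  have hm : Measurable fun ω => ∫ x, g x ∂(facKernel lam B J (η ω)) := by
    have h : Measurable ((fun μ : Conf X => ∫ x, g x ∂(facKernel lam B J (μ : Measure X))) ∘
        fun ω => (⟨η ω, hη.isConfiguration ω⟩ : Conf X)) :=
      (measurable_integral_facKernel hB hlB J hg hM).comp hη.measurable_conf
    exact h
  have hκ : Measurable fun ω => (facKernel lam B J (η ω)).real Set.univ :=
    ((Measure.measurable_coe MeasurableSet.univ).comp
      (hη.measurable_facKernel hB hlB J)).ennreal_toReal
  have h1 : MemLp (fun ω => (facKernel lam B J (η ω)).real Set.univ) 2 P := by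
    refine ⟨hκ.aestronglyMeasurable, ?_⟩
    rw [eLpNorm_lt_top_iff_lintegral_rpow_enorm_lt_top (by norm_num) (by norm_num)]
    refine lt_of_le_of_lt (lintegral_mono fun ω => ?_)
      (hη.lintegral_facKernel_univ_sq_lt_top hB hlB J)
    rw [ENNReal.toReal_ofNat, measureReal_def, Real.enorm_of_nonneg ENNReal.toReal_nonneg]
    gcongr
    exact ENNReal.ofReal_toReal_le
  refine (h1.const_mul M).of_le hm.aestronglyMeasurable (ae_of_all _ fun ω => ?_)
  have hf := isFiniteMeasure_facKernel (lam := lam) (hη.isConfiguration ω) hB hlB J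
  refine (norm_integral_le_of_norm_le_const (ae_of_all _ hM)).trans (le_abs_self _)

lemma IsPoissonProcess.memLp_compensatedIntegral (hη : IsPoissonProcess P η lam)
    (hB : MeasurableSet B) (hlB : lam B ≠ ∞) (hg : Measurable g) {M : ℝ} (hM : ∀ x, |g x| ≤ M)
    (hg0 : ∀ x, x ∉ cube B n → g x = 0) :
    MemLp (fun ω => compensatedIntegral lam (η ω) g) 2 P := by
  refine (memLp_congr_ae (hη.ae_compensatedIntegral_eq hB hlB hg0)).2 ?_
  exact memLp_finsetSum _ fun J _ => (hη.memLp_integral_facKernel hB hlB J hg hM).const_mul _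

lemma IsPoissonProcess.integral_expFun {lam : Measure X} {P : Measure Ω}
    [IsProbabilityMeasure P] {η : Ω → Measure X} (hη : IsPoissonProcess P η lam) {v : SimpleFunc X ℝ≥0}
    (hv : FinSupp lam v) : ∫ ω, expFun v (η ω) ∂P = Real.exp (-∫ x, decay v x ∂lam) := by
  rw [← hη.isPoissonLaw.integral_expFun v hv,
    integral_map hη.measurable.aemeasurable (measurable_expFun v).aestronglyMeasurable]

lemma IsPoissonProcess.integral_expFun_shift (hη : IsPoissonProcess P η lam)
    {v : SimpleFunc X ℝ≥0} (hv : FinSupp lam v) (J : Finset (Fin n)) (x : Fin n → X) :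
    ∫ ω, expFun v (η ω + ∑ j ∈ J, Measure.dirac (x j)) ∂P
      = Real.exp (-∫ x, decay v x ∂lam) * ∏ j ∈ J, Real.exp (-(v (x j) : ℝ)) := by
  simp_rw [expFun_add_measure, expFun_sum_dirac]
  rw [integral_mul_const, hη.integral_expFun hv]

/-- The `n`-th difference of an exponential functional. -/
lemma diffOp_expFun (v : SimpleFunc X ℝ≥0) (x : Fin n → X) (μ : Measure X) :
    diffOp x (expFun v) μ = expFun v μ * ∏ j, -decay v (x j) := by
  have h1 : ∏ j, -decay v (x j) = ∏ j : Fin n, (Real.exp (-(v (x j) : ℝ)) + -1) :=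
    Finset.prod_congr rfl fun j _ => by simp only [decay]; ring
  rw [h1, Finset.prod_add, diffOp, Finset.mul_sum, Finset.powerset_univ]
  refine Finset.sum_congr rfl fun J _ => ?_
  rw [expFun_add_measure, expFun_sum_dirac, Finset.prod_const, Finset.card_sdiff_of_subset
    (Finset.subset_univ J), Finset.card_univ, Fintype.card_fin]
  ring

lemma IsPoissonProcess.integral_diffOp_expFun (hη : IsPoissonProcess P η lam)
    {v : SimpleFunc X ℝ≥0} (hv : FinSupp lam v) (x : Fin n → X) :
    ∫ ω, diffOp x (expFun v) (η ω) ∂P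
      = Real.exp (-∫ x, decay v x ∂lam) * ∏ j, -decay v (x j) := by
  simp_rw [diffOp_expFun]
  rw [integral_mul_const, hη.integral_expFun hv]

/-- The Mecke equation for exponential functionals and bounded nonnegative kernels, with Bochner
integrals. -/
lemma IsPoissonProcess.integral_expFun_mul_integral_facKernel_of_nonneg
    (hη : IsPoissonProcess P η lam) (hB : MeasurableSet B) (hlB : lam B ≠ ∞) (J : Finset (Fin n))
    (hg : Measurable g) (hg0 : ∀ x, 0 ≤ g x) {M : ℝ} (hM : ∀ x, |g x| ≤ M) {v : SimpleFunc X ℝ≥0}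
    (hv : FinSupp lam v) :
    ∫ ω, expFun v (η ω) * ∫ x, g x ∂(facKernel lam B J (η ω)) ∂P
      = ∫ x in cube B n, g x * ∫ ω, expFun v (η ω + ∑ j ∈ J, Measure.dirac (x j)) ∂P
        ∂(Measure.pi fun _ => lam) := by
  have hκ := (hη.memLp_integral_facKernel hB hlB J hg hM).1
  have hvη : Measurable fun ω => expFun v (η ω) := (measurable_expFun v).comp hη.measurable
  have hS : Measurable fun x : Fin n → X =>
      ∫ ω, expFun v (η ω + ∑ j ∈ J, Measure.dirac (x j)) ∂P := by
    simp_rw [hη.integral_expFun_shift hv]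
    have hvr : Measurable fun x => (v x : ℝ) := v.measurable.coe_nnreal_real
    exact measurable_const.mul (Finset.measurable_fun_prod _ fun j _ =>
      Real.measurable_exp.comp (hvr.comp (measurable_pi_apply j)).neg)
  rw [integral_eq_lintegral_of_nonneg_ae (ae_of_all _ fun ω => mul_nonneg (expFun_nonneg _ _)
      (integral_nonneg hg0)) (hvη.aestronglyMeasurable.mul hκ),
    integral_eq_lintegral_of_nonneg_ae (ae_of_all _ fun x => mul_nonneg (hg0 x)
      (integral_nonneg fun ω => expFun_nonneg _ _)) (hg.mul hS).aestronglyMeasurable]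
  have h1 := hη.multivariate_mecke hB hlB J (measurable_expFun v).ennreal_ofReal
    hg.ennreal_ofReal
  congr 1
  refine Eq.trans (lintegral_congr fun ω => ?_) (h1.trans (lintegral_congr fun x => ?_))
  · have := isFiniteMeasure_facKernel (lam := lam) (hη.isConfiguration ω) hB hlB J
    rw [ENNReal.ofReal_mul (expFun_nonneg _ _), ofReal_integral_eq_lintegral_ofReal
      (Integrable.of_bound hg.aestronglyMeasurable M (ae_of_all _ hM)) (ae_of_all _ hg0)]
  · rw [ENNReal.ofReal_mul (hg0 x), ofReal_integral_eq_lintegral_ofReal _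
      (ae_of_all _ fun ω => expFun_nonneg _ _)]
    · rfl
    · exact Integrable.of_bound ((measurable_expFun v).comp
        (hη.measurable.add_const _)).aestronglyMeasurable 1
        (ae_of_all _ fun ω => abs_expFun_le_one v _)

lemma IsPoissonProcess.integrable_expFun_mul_integral_facKernel (hη : IsPoissonProcess P η lam)
    (hB : MeasurableSet B) (hlB : lam B ≠ ∞) (J : Finset (Fin n)) (hg : Measurable g) {M : ℝ}
    (hM : ∀ x, |g x| ≤ M) (v : SimpleFunc X ℝ≥0) :
    Integrable (fun ω => expFun v (η ω) * ∫ x, g x ∂(facKernel lam B J (η ω))) P :=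
  ((hη.memLp_integral_facKernel hB hlB J hg hM).integrable (by norm_num)).bdd_mul
    ((measurable_expFun v).comp hη.measurable).aestronglyMeasurable
    (ae_of_all _ fun ω => abs_expFun_le_one v (η ω))

lemma integrableOn_cube_mul_prod_exp (hlB : lam B ≠ ∞) (J : Finset (Fin n)) (hg : Measurable g)
    {M : ℝ} (hM : ∀ x, |g x| ≤ M) (v : SimpleFunc X ℝ≥0) (c : ℝ) :
    IntegrableOn (fun x => g x * (c * ∏ j ∈ J, Real.exp (-(v (x j) : ℝ)))) (cube B n)
      (Measure.pi fun _ => lam) := by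
  have hvr : Measurable fun x => (v x : ℝ) := v.measurable.coe_nnreal_real
  refine Measure.integrableOn_of_bounded (M := M * |c|) ?_ ?_ (ae_of_all _ fun x => ?_)
  · rw [cube, Measure.pi_pi]
    exact ENNReal.prod_ne_top fun _ _ => hlB
  · exact (hg.mul (measurable_const.mul (Finset.measurable_fun_prod _ fun j _ =>
      Real.measurable_exp.comp (hvr.comp (measurable_pi_apply j)).neg))).aestronglyMeasurable
  · rw [norm_mul, norm_mul]
    refine mul_le_mul (hM x) ?_ (by positivity) ((abs_nonneg _).trans (hM x))
    refine mul_le_of_le_one_right (abs_nonneg _) ?_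
    rw [Real.norm_of_nonneg (Finset.prod_nonneg fun j _ => (Real.exp_pos _).le)]
    exact Finset.prod_le_one (fun j _ => (Real.exp_pos _).le) fun j _ => by simp

lemma IsPoissonProcess.integral_expFun_mul_integral_facKernel (hη : IsPoissonProcess P η lam)
    (hB : MeasurableSet B) (hlB : lam B ≠ ∞) (J : Finset (Fin n)) (hg : Measurable g) {M : ℝ}
    (hM : ∀ x, |g x| ≤ M) {v : SimpleFunc X ℝ≥0} (hv : FinSupp lam v) :
    ∫ ω, expFun v (η ω) * ∫ x, g x ∂(facKernel lam B J (η ω)) ∂P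
      = ∫ x in cube B n, g x * (Real.exp (-∫ x, decay v x ∂lam) *
        ∏ j ∈ J, Real.exp (-(v (x j) : ℝ))) ∂(Measure.pi fun _ => lam) := by
  set c := Real.exp (-∫ x, decay v x ∂lam)
  have hp : ∀ x, |max (g x) 0| ≤ M := fun x => by
    refine le_trans ?_ (hM x)
    rw [abs_of_nonneg (le_max_right _ _)]
    exact max_le (le_abs_self _) (abs_nonneg _)
  have hn : ∀ x, |max (-g x) 0| ≤ M := fun x => by
    refine le_trans ?_ (hM x)
    rw [abs_of_nonneg (le_max_right _ _)]
    exact max_le (neg_le_abs _) (abs_nonneg _)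
  have hgp : Measurable fun x => max (g x) 0 := hg.max measurable_const
  have hgn : Measurable fun x => max (-g x) 0 := hg.neg.max measurable_const
  have hsub : ∀ x, g x = max (g x) 0 - max (-g x) 0 := fun x => by
    rcases le_total (g x) 0 with h | h
    · rw [max_eq_right h, max_eq_left (by linarith)]; ring
    · rw [max_eq_left h, max_eq_right (by linarith)]; ring
  have h1 := hη.integral_expFun_mul_integral_facKernel_of_nonneg hB hlB J hgp
    (fun x => le_max_right _ _) hp hv
  have h2 := hη.integral_expFun_mul_integral_facKernel_of_nonneg hB hlB J hgn
    (fun x => le_max_right _ _) hn hv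
  simp_rw [hη.integral_expFun_shift hv] at h1 h2
  have hL : ∀ ω, expFun v (η ω) * ∫ x, g x ∂(facKernel lam B J (η ω))
      = expFun v (η ω) * ∫ x, max (g x) 0 ∂(facKernel lam B J (η ω))
        - expFun v (η ω) * ∫ x, max (-g x) 0 ∂(facKernel lam B J (η ω)) := by
    intro ω
    have := isFiniteMeasure_facKernel (lam := lam) (hη.isConfiguration ω) hB hlB J
    rw [← mul_sub, ← integral_sub (Integrable.of_bound hgp.aestronglyMeasurable M (ae_of_all _ hp))
      (Integrable.of_bound hgn.aestronglyMeasurable M (ae_of_all _ hn))]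
    simp_rw [← hsub]
  have hR : ∀ x : Fin n → X, g x * (c * ∏ j ∈ J, Real.exp (-(v (x j) : ℝ)))
      = max (g x) 0 * (c * ∏ j ∈ J, Real.exp (-(v (x j) : ℝ)))
        - max (-g x) 0 * (c * ∏ j ∈ J, Real.exp (-(v (x j) : ℝ))) := by
    intro x
    rw [← sub_mul, ← hsub]
  rw [integral_congr_ae (ae_of_all _ hL),
    integral_sub (hη.integrable_expFun_mul_integral_facKernel hB hlB J hgp hp v)
      (hη.integrable_expFun_mul_integral_facKernel hB hlB J hgn hn v), h1, h2,
    integral_congr_ae (ae_of_all _ hR),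
    integral_sub (integrableOn_cube_mul_prod_exp hlB J hgp hp v c)
      (integrableOn_cube_mul_prod_exp hlB J hgn hn v c)]

/-- The pathwise integral of `g` is the adjoint of the expected difference operator: the alternating
sums over `J` in the definitions of the integral and of `D^n` correspond term by term under the
Mecke equation. -/
theorem IsPoissonProcess.integral_expFun_mul_compensatedIntegral (hη : IsPoissonProcess P η lam)
    (hB : MeasurableSet B) (hlB : lam B ≠ ∞) (hg : Measurable g) {M : ℝ} (hM : ∀ x, |g x| ≤ M)
    (hg0 : ∀ x, x ∉ cube B n → g x = 0) {v : SimpleFunc X ℝ≥0} (hv : FinSupp lam v) :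
    ∫ ω, expFun v (η ω) * compensatedIntegral lam (η ω) g ∂P
      = ∫ x, g x * ∫ ω, diffOp x (expFun v) (η ω) ∂P ∂(Measure.pi fun _ => lam) := by
  set c := Real.exp (-∫ x, decay v x ∂lam) with hc
  have h1 : ∀ x : Fin n → X, g x * ∫ ω, diffOp x (expFun v) (η ω) ∂P
      = ∑ J : Finset (Fin n), (-1 : ℝ) ^ (n - J.card) *
        (g x * (c * ∏ j ∈ J, Real.exp (-(v (x j) : ℝ)))) := by
    intro x
    have hi : ∀ J ∈ (Finset.univ : Finset (Finset (Fin n))), Integrable (fun ω =>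
        (-1 : ℝ) ^ (n - J.card) * expFun v (η ω + ∑ j ∈ J, Measure.dirac (x j))) P :=
      fun J _ => (Integrable.of_bound ((measurable_expFun v).comp
        (hη.measurable.add_const _)).aestronglyMeasurable 1
        (ae_of_all _ fun ω => abs_expFun_le_one v _)).const_mul _
    simp only [diffOp]
    rw [integral_finsetSum _ hi, Finset.mul_sum]
    refine Finset.sum_congr rfl fun J _ => ?_
    rw [integral_const_mul, hη.integral_expFun_shift hv]
    ring
  have h2 : ∫ x, g x * ∫ ω, diffOp x (expFun v) (η ω) ∂P ∂(Measure.pi fun _ => lam)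
      = ∫ x in cube B n, g x * ∫ ω, diffOp x (expFun v) (η ω) ∂P ∂(Measure.pi fun _ => lam) :=
    (setIntegral_eq_integral_of_forall_compl_eq_zero fun x hx => by simp [hg0 x hx]).symm
  have h3 : ∀ᵐ ω ∂P, expFun v (η ω) * compensatedIntegral lam (η ω) g
      = ∑ J : Finset (Fin n), (-1 : ℝ) ^ (n - J.card) *
        (expFun v (η ω) * ∫ x, g x ∂(facKernel lam B J (η ω))) := by
    filter_upwards [hη.ae_compensatedIntegral_eq hB hlB hg0] with ω hω
    rw [hω, Finset.mul_sum]
    exact Finset.sum_congr rfl fun J _ => by ring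
  rw [h2, integral_congr_ae h3, integral_finsetSum _ fun J _ =>
    (hη.integrable_expFun_mul_integral_facKernel hB hlB J hg hM v).const_mul _,
    integral_congr_ae (ae_of_all _ h1), integral_finsetSum _ fun J _ =>
    (integrableOn_cube_mul_prod_exp hlB J hg hM v c).const_mul _]
  refine Finset.sum_congr rfl fun J _ => ?_
  rw [integral_const_mul, integral_const_mul,
    hη.integral_expFun_mul_integral_facKernel hB hlB J hg hM hv]

end Pathwise

end

section

variable {X : Type*} [MeasurableSpace X] {Ω : Type*} [MeasurableSpace Ω]

/-! ### The Fock space -/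

variable (X) in
/-- The disjoint union of the powers `X^n`, on which all the kernels of a chaos expansion live. -/
abbrev Fock : Type _ := Σ n : ℕ, Fin n → X

/-- An `n`-tuple as a point of the disjoint union. -/
abbrev Fock.mk (n : ℕ) (x : Fin n → X) : Fock X := ⟨n, x⟩

lemma fock_mk_injective (n : ℕ) : Function.Injective (Fock.mk n : (Fin n → X) → Fock X) := by
  intro x y h
  simpa [Fock.mk] using h

lemma measurable_fock {β : Type*} [MeasurableSpace β] {f : Fock X → β}
    (h : ∀ n, Measurable fun x : Fin n → X => f ⟨n, x⟩) : Measurable f := by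
  intro A hA
  rw [MeasurableSpace.measurableSet_iInf]
  exact fun n => h n hA

lemma measurableEmbedding_fock_mk (n : ℕ) :
    MeasurableEmbedding (Fock.mk n : (Fin n → X) → Fock X) where
  injective := fock_mk_injective n
  measurable := by
    intro A hA
    rw [MeasurableSpace.measurableSet_iInf] at hA
    exact hA n
  measurableSet_image' := by
    intro A hA
    rw [MeasurableSpace.measurableSet_iInf]
    intro m
    change MeasurableSet (Fock.mk m ⁻¹' (Fock.mk n '' A))
    by_cases h : m = n
    · subst h
      rwa [Set.preimage_image_eq _ (fock_mk_injective m)]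
    · convert MeasurableSet.empty (α := Fin m → X)
      ext x
      simp only [Fock.mk, Set.mem_preimage, Set.mem_image, Sigma.mk.injEq, Set.mem_empty_iff_false, iff_false]
      rintro ⟨y, -, hy, -⟩
      exact h hy.symm

/-- The measure `∑_n lam^n / n!` on the disjoint union of the powers of `X`: its `L²` space is the
symmetric Fock space, up to the symmetry of the kernels. -/
def fockMeasure (lam : Measure X) [SigmaFinite lam] : Measure (Fock X) :=
  Measure.sum fun n : ℕ =>
    ((n.factorial : ℝ≥0∞)⁻¹ • Measure.pi fun _ : Fin n => lam).map (Fock.mk n)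

instance (lam : Measure X) [SigmaFinite lam] : SFinite (fockMeasure lam) := by
  unfold fockMeasure
  infer_instance

variable {lam : Measure X} [SigmaFinite lam] {P : Measure Ω} [IsProbabilityMeasure P]
  {η : Ω → Measure X}

lemma ae_fockMeasure_iff {p : Fock X → Prop} :
    (∀ᵐ z ∂(fockMeasure lam), p z) ↔ ∀ n, ∀ᵐ x ∂(Measure.pi fun _ : Fin n => lam), p ⟨n, x⟩ := by
  rw [fockMeasure, Measure.ae_sum_iff]
  refine forall_congr' fun n => ?_
  rw [(measurableEmbedding_fock_mk n).ae_map_iff]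
  simp only [ae_iff, Measure.smul_apply, smul_eq_mul, mul_eq_zero, ENNReal.inv_eq_zero,
    ENNReal.natCast_ne_top, false_or]

lemma integral_fock_level {lam : Measure X} (n : ℕ) (φ : Fock X → ℝ) :
    ∫ z, φ z ∂((n.factorial : ℝ≥0∞)⁻¹ • Measure.pi fun _ : Fin n => lam).map (Fock.mk n)
      = (n.factorial : ℝ)⁻¹ * ∫ x, φ ⟨n, x⟩ ∂(Measure.pi fun _ : Fin n => lam) := by
  rw [(measurableEmbedding_fock_mk n).integral_map, integral_smul_measure]
  simp

lemma integrable_fock_level {lam : Measure X} (n : ℕ) (φ : Fock X → ℝ) :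
    Integrable φ (((n.factorial : ℝ≥0∞)⁻¹ • Measure.pi fun _ : Fin n => lam).map (Fock.mk n)) ↔
      Integrable (fun x => φ ⟨n, x⟩) (Measure.pi fun _ : Fin n => lam) := by
  rw [(measurableEmbedding_fock_mk n).integrable_map_iff,
    integrable_smul_measure (by simp) (by simp [Nat.factorial_ne_zero])]
  rfl

lemma iUnion_cube_spanningSets (lam : Measure X) [SigmaFinite lam] (n : ℕ) :
    ⋃ k, cube (spanningSets lam k) n = Set.univ := by
  refine Set.eq_univ_of_forall fun x => ?_
  have h : ∀ j, ∃ k, x j ∈ spanningSets lam k := fun j =>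
    Set.mem_iUnion.1 (iUnion_spanningSets lam ▸ Set.mem_univ (x j))
  choose k hk using h
  exact Set.mem_iUnion.2 ⟨Finset.univ.sup k, fun j _ =>
    monotone_spanningSets lam (Finset.le_sup (Finset.mem_univ j)) (hk j)⟩

/-- A property that holds almost everywhere on each of an exhausting sequence of cubes holds almost
everywhere. -/
lemma ae_of_forall_cube {n : ℕ} {p : (Fin n → X) → Prop}
    (h : ∀ k, ∀ᵐ x ∂((Measure.pi fun _ : Fin n => lam).restrict (cube (spanningSets lam k) n)), p x) :
    ∀ᵐ x ∂(Measure.pi fun _ : Fin n => lam), p x := by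
  have := ae_restrict_iUnion_iff (μ := Measure.pi fun _ : Fin n => lam)
    (fun k => cube (spanningSets lam k) n) p
  rw [iUnion_cube_spanningSets, Measure.restrict_univ] at this
  exact this.2 h

/-! ### Expected differences -/

lemma measurable_diffOp {n : ℕ} {f : Measure X → ℝ} (hf : Measurable f) :
    Measurable fun z : (Fin n → X) × Measure X => diffOp z.1 f z.2 :=
  Finset.measurable_fun_sum _ fun J _ => (hf.comp (measurable_add_sum_dirac J)).const_mul _

lemma diffOp_add {n : ℕ} (x : Fin n → X) (f h : Measure X → ℝ) (μ : Measure X) :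
    diffOp x (f + h) μ = diffOp x f μ + diffOp x h μ := by
  simp only [diffOp, Pi.add_apply, mul_add, Finset.sum_add_distrib]

lemma diffOp_sub {n : ℕ} (x : Fin n → X) (f h : Measure X → ℝ) (μ : Measure X) :
    diffOp x (f - h) μ = diffOp x f μ - diffOp x h μ := by
  simp only [diffOp, Pi.sub_apply, mul_sub, Finset.sum_sub_distrib]

lemma diffOp_smul {n : ℕ} (x : Fin n → X) (c : ℝ) (f : Measure X → ℝ) (μ : Measure X) :
    diffOp x (c • f) μ = c * diffOp x f μ := by
  simp only [diffOp, Pi.smul_apply, smul_eq_mul, Finset.mul_sum]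
  exact Finset.sum_congr rfl fun J _ => by ring

/-- The function `(x_1, …, x_n) ↦ 𝔼 D^n_{x_1, …, x_n} f(η)` on the Fock space. -/
def meanDiff (P : Measure Ω) (η : Ω → Measure X) (f : Measure X → ℝ) (z : Fock X) : ℝ :=
  ∫ ω, diffOp z.2 f (η ω) ∂P

lemma measurable_meanDiff (hη : Measurable η) {f : Measure X → ℝ} (hf : Measurable f) :
    Measurable (meanDiff P η f) := by
  refine measurable_fock fun n => ?_
  have : StronglyMeasurable fun z : (Fin n → X) × Ω => diffOp z.1 f (η z.2) :=
    ((measurable_diffOp hf).comp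
      (measurable_fst.prodMk (hη.comp measurable_snd))).stronglyMeasurable
  exact this.integral_prod_right'.measurable

lemma IsPoissonProcess.eLpNorm_map_eq {lam : Measure X} {P : Measure Ω} {η : Ω → Measure X}
    (hη : IsPoissonProcess P η lam) {f : Measure X → ℝ}
    (hf : Measurable f) : eLpNorm f 2 (P.map η) = eLpNorm (fun ω => f (η ω)) 2 P :=
  eLpNorm_map_measure hf.aestronglyMeasurable hη.measurable.aemeasurable

lemma IsPoissonProcess.exists_lintegral_diffOp_le (hη : IsPoissonProcess P η lam)
    {B : Set X} (hB : MeasurableSet B) (hlB : lam B ≠ ∞) (n : ℕ) :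
    ∃ C ≠ ∞, ∀ f : Measure X → ℝ, Measurable f →
      ∫⁻ x in cube B n, ∫⁻ ω, ‖diffOp x f (η ω)‖ₑ ∂P ∂(Measure.pi fun _ => lam)
        ≤ C * eLpNorm f 2 (P.map η) := by
  choose C hC h using fun J : Finset (Fin n) => hη.exists_lintegral_shift_le hB hlB J
  refine ⟨∑ J, C J, ENNReal.sum_ne_top.2 fun J _ => hC J, fun f hf => ?_⟩
  have hm : ∀ J : Finset (Fin n), Measurable fun z : (Fin n → X) × Ω =>
      ‖f (η z.2 + ∑ j ∈ J, Measure.dirac (z.1 j))‖ₑ := fun J =>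
    (hf.comp ((measurable_add_sum_dirac J).comp
      (measurable_fst.prodMk (hη.measurable.comp measurable_snd)))).enorm
  rw [hη.eLpNorm_map_eq hf, Finset.sum_mul]
  refine le_trans ?_ (Finset.sum_le_sum fun J _ => h J f hf)
  rw [← lintegral_finsetSum _ fun J _ => (hm J).lintegral_prod_right']
  refine lintegral_mono fun x => ?_
  have hmx : ∀ J : Finset (Fin n), Measurable fun ω =>
      ‖f (η ω + ∑ j ∈ J, Measure.dirac (x j))‖ₑ := fun J =>
    (hf.comp (hη.measurable.add_const _)).enorm
  refine le_trans ?_ (lintegral_finsetSum _ fun J _ => hmx J).le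
  refine lintegral_mono fun ω => ?_
  refine (enorm_sum_le _ _).trans (Finset.sum_le_sum fun J _ => ?_)
  rw [enorm_mul]
  simp

/-- Expected differences of square integrable functionals exist almost everywhere. -/
lemma IsPoissonProcess.ae_integrable_diffOp (hη : IsPoissonProcess P η lam) {f : Measure X → ℝ}
    (hf : Measurable f) (hf2 : MemLp f 2 (P.map η)) (n : ℕ) :
    ∀ᵐ x ∂(Measure.pi fun _ : Fin n => lam), Integrable (fun ω => diffOp x f (η ω)) P := by
  refine ae_of_forall_cube fun k => ?_
  obtain ⟨C, hC, h⟩ := hη.exists_lintegral_diffOp_le (measurableSet_spanningSets lam k)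
    (measure_spanningSets_lt_top lam k).ne n
  have hm : Measurable fun z : (Fin n → X) × Ω => ‖diffOp z.1 f (η z.2)‖ₑ :=
    ((measurable_diffOp hf).comp
      (measurable_fst.prodMk (hη.measurable.comp measurable_snd))).enorm
  have hlt : ∫⁻ x in cube (spanningSets lam k) n, ∫⁻ ω, ‖diffOp x f (η ω)‖ₑ ∂P
      ∂(Measure.pi fun _ => lam) ≠ ∞ :=
    ne_top_of_le_ne_top (ENNReal.mul_ne_top hC hf2.2.ne) (h f hf)
  filter_upwards [ae_lt_top hm.lintegral_prod_right' hlt] with x hx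
  have hmx : Measurable fun ω => diffOp x f (η ω) :=
    (measurable_diffOp hf).comp (measurable_const.prodMk hη.measurable)
  exact ⟨hmx.aestronglyMeasurable, hx⟩

lemma IsPoissonProcess.meanDiff_add (hη : IsPoissonProcess P η lam) {f h : Measure X → ℝ}
    (hf : Measurable f) (hf2 : MemLp f 2 (P.map η)) (hh : Measurable h)
    (hh2 : MemLp h 2 (P.map η)) :
    meanDiff P η (f + h) =ᵐ[fockMeasure lam] meanDiff P η f + meanDiff P η h := by
  refine ae_fockMeasure_iff.2 fun n => ?_
  filter_upwards [hη.ae_integrable_diffOp hf hf2 n, hη.ae_integrable_diffOp hh hh2 n] with x h1 h2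
  simp only [meanDiff, diffOp_add, Pi.add_apply]
  exact integral_add h1 h2

lemma meanDiff_smul {P : Measure Ω} {η : Ω → Measure X} (c : ℝ) (f : Measure X → ℝ) :
    meanDiff P η (c • f) = c • meanDiff P η f := by
  ext z
  simp only [meanDiff, diffOp_smul, integral_const_mul, Pi.smul_apply, smul_eq_mul]

lemma IsPoissonProcess.meanDiff_sub (hη : IsPoissonProcess P η lam) {f h : Measure X → ℝ}
    (hf : Measurable f) (hf2 : MemLp f 2 (P.map η)) (hh : Measurable h)
    (hh2 : MemLp h 2 (P.map η)) :
    meanDiff P η (f - h) =ᵐ[fockMeasure lam] meanDiff P η f - meanDiff P η h := by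
  refine ae_fockMeasure_iff.2 fun n => ?_
  filter_upwards [hη.ae_integrable_diffOp hf hf2 n, hη.ae_integrable_diffOp hh hh2 n] with x h1 h2
  simp only [meanDiff, diffOp_sub, Pi.sub_apply]
  exact integral_sub h1 h2

/-- Expected differences are continuous from `L²` into `L¹` of each cube. -/
lemma IsPoissonProcess.exists_lintegral_meanDiff_le (hη : IsPoissonProcess P η lam)
    {B : Set X} (hB : MeasurableSet B) (hlB : lam B ≠ ∞) (n : ℕ) :
    ∃ C ≠ ∞, ∀ f : Measure X → ℝ, Measurable f →
      ∫⁻ x in cube B n, ‖meanDiff P η f ⟨n, x⟩‖ₑ ∂(Measure.pi fun _ => lam)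
        ≤ C * eLpNorm f 2 (P.map η) := by
  obtain ⟨C, hC, h⟩ := hη.exists_lintegral_diffOp_le hB hlB n
  exact ⟨C, hC, fun f hf =>
    (lintegral_mono fun x => enorm_integral_le_lintegral_enorm _).trans (h f hf)⟩

lemma IsPoissonProcess.meanDiff_ae_eq_zero (hη : IsPoissonProcess P η lam) {f : Measure X → ℝ}
    (hf : Measurable f) (h0 : eLpNorm f 2 (P.map η) = 0) :
    meanDiff P η f =ᵐ[fockMeasure lam] 0 := by
  refine ae_fockMeasure_iff.2 fun n => ae_of_forall_cube fun k => ?_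
  obtain ⟨C, hC, h⟩ := hη.exists_lintegral_meanDiff_le (measurableSet_spanningSets lam k)
    (measure_spanningSets_lt_top lam k).ne n
  have h1 := h f hf
  rw [h0, mul_zero, nonpos_iff_eq_zero, lintegral_eq_zero_iff] at h1
  · filter_upwards [h1] with x hx
    simpa using hx
  · exact ((measurable_meanDiff hη.measurable hf).comp
      (measurableEmbedding_fock_mk n).measurable).enorm

/-- Expected differences do not depend on the representative. -/
lemma IsPoissonProcess.meanDiff_congr (hη : IsPoissonProcess P η lam) {f h : Measure X → ℝ}
    (hf : Measurable f) (hf2 : MemLp f 2 (P.map η)) (hh : Measurable h)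
    (he : f =ᵐ[P.map η] h) : meanDiff P η f =ᵐ[fockMeasure lam] meanDiff P η h := by
  have hh2 : MemLp h 2 (P.map η) := (memLp_congr_ae he).1 hf2
  have h1 := hη.meanDiff_ae_eq_zero (hf.sub hh) (by
    rw [eLpNorm_congr_ae (g := 0) (he.mono fun μ hμ => by simp [hμ]), eLpNorm_zero])
  filter_upwards [h1, hη.meanDiff_sub hf hf2 hh hh2] with z h2 h3
  rw [h3, Pi.sub_apply, Pi.zero_apply] at h2
  linarith

/-- Almost everywhere convergence of expected differences along rapidly convergent sequences, from
the continuity into `L¹` of cubes and the Borel–Cantelli lemma. -/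
lemma IsPoissonProcess.tendsto_meanDiff (hη : IsPoissonProcess P η lam) {f : Measure X → ℝ}
    (hf : Measurable f) (hf2 : MemLp f 2 (P.map η)) {u : ℕ → Measure X → ℝ}
    (hu : ∀ k, Measurable (u k)) (hu2 : ∀ k, MemLp (u k) 2 (P.map η))
    (hs : ∑' k, eLpNorm (f - u k) 2 (P.map η) ≠ ∞) :
    ∀ᵐ z ∂(fockMeasure lam), Tendsto (fun k => meanDiff P η (u k) z) atTop
      (𝓝 (meanDiff P η f z)) := by
  have h1 : ∀ᵐ z ∂(fockMeasure lam), Tendsto (fun k => ‖meanDiff P η (f - u k) z‖ₑ) atTop (𝓝 0) := by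
    refine ae_fockMeasure_iff.2 fun n => ae_of_forall_cube fun k => ?_
    obtain ⟨C, hC, h⟩ := hη.exists_lintegral_meanDiff_le (measurableSet_spanningSets lam k)
      (measure_spanningSets_lt_top lam k).ne n
    have hm : ∀ i, Measurable fun x : Fin n → X => ‖meanDiff P η (f - u i) ⟨n, x⟩‖ₑ := fun i =>
      ((measurable_meanDiff hη.measurable (hf.sub (hu i))).comp
        (measurableEmbedding_fock_mk n).measurable).enorm
    have hlt : ∫⁻ x in cube (spanningSets lam k) n, ∑' i, ‖meanDiff P η (f - u i) ⟨n, x⟩‖ₑ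
        ∂(Measure.pi fun _ => lam) ≠ ∞ := by
      rw [lintegral_tsum fun i => (hm i).aemeasurable]
      refine ne_top_of_le_ne_top (ENNReal.mul_ne_top hC hs) ?_
      rw [← ENNReal.tsum_mul_left]
      exact ENNReal.tsum_le_tsum fun i => h _ (hf.sub (hu i))
    filter_upwards [ae_lt_top (Measurable.tsum hm) hlt] with x hx
    exact ENNReal.tendsto_atTop_zero_of_tsum_ne_top hx.ne
  have h2 : ∀ᵐ z ∂(fockMeasure lam), ∀ k, meanDiff P η (f - u k) z
      = meanDiff P η f z - meanDiff P η (u k) z :=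
    ae_all_iff.2 fun k => hη.meanDiff_sub hf hf2 (hu k) (hu2 k)
  filter_upwards [h1, h2] with z hz1 hz2
  simp_rw [hz2] at hz1
  have h3 := tendsto_iff_edist_tendsto_0 (f := fun k => meanDiff P η (u k) z)
    (y := meanDiff P η f z) (l := atTop)
  rw [h3]
  refine hz1.congr fun k => ?_
  rw [edist_comm, edist_eq_enorm_sub]

/-! ### The isometry on exponential functionals -/

/-- The linear span of the exponential functionals. -/
def expSpan (lam : Measure X) : Submodule ℝ (Measure X → ℝ) :=
  Submodule.span ℝ {f | ∃ v, FinSupp lam v ∧ f = expFun v}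

lemma bounded_of_mem_expSpan {lam : Measure X} {f : Measure X → ℝ} (hf : f ∈ expSpan lam) :
    Measurable f ∧ ∃ M : ℝ, ∀ μ, |f μ| ≤ M := by
  induction hf using Submodule.span_induction with
  | mem f hf =>
    obtain ⟨v, -, rfl⟩ := hf
    exact ⟨measurable_expFun v, 1, abs_expFun_le_one v⟩
  | zero => exact ⟨measurable_const, 0, by simp⟩
  | add f h _ _ ihf ihh =>
    obtain ⟨h1, M, hM⟩ := ihf
    obtain ⟨h2, N, hN⟩ := ihh
    exact ⟨h1.add h2, M + N, fun μ => (abs_add_le _ _).trans (add_le_add (hM μ) (hN μ))⟩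
  | smul c f _ ih =>
    obtain ⟨h1, M, hM⟩ := ih
    refine ⟨h1.const_smul c, |c| * M, fun μ => ?_⟩
    rw [Pi.smul_apply, smul_eq_mul, abs_mul]
    exact mul_le_mul_of_nonneg_left (hM μ) (abs_nonneg c)

lemma memLp_of_mem_expSpan {lam : Measure X} {f : Measure X → ℝ} (hf : f ∈ expSpan lam)
    (Q : Measure (Measure X))
    [IsFiniteMeasure Q] : MemLp f 2 Q := by
  obtain ⟨h1, M, hM⟩ := bounded_of_mem_expSpan hf
  exact MemLp.of_bound h1.aestronglyMeasurable M (ae_of_all _ hM)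

lemma IsPoissonProcess.meanDiff_expFun (hη : IsPoissonProcess P η lam) {v : SimpleFunc X ℝ≥0}
    (hv : FinSupp lam v) (z : Fock X) :
    meanDiff P η (expFun v) z = Real.exp (-∫ x, decay v x ∂lam) * ∏ j, -decay v (z.2 j) :=
  hη.integral_diffOp_expFun hv z.2

lemma FinSupp.integrable_decay_mul {lam : Measure X} {v w : SimpleFunc X ℝ≥0} (hv : FinSupp lam v) :
    Integrable (fun x => decay v x * decay w x) lam := by
  refine hv.integrable_of_bounded ((measurable_decay v).mul (measurable_decay w)) 1 (fun x => ?_)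
    fun x hx => support_decay_subset v (left_ne_zero_of_mul hx)
  rw [abs_mul]
  exact mul_le_one₀ (abs_decay_le_one v x) (abs_nonneg _) (abs_decay_le_one w x)

/-- The isometry on exponential functionals: the kernels are products, so the integral over the Fock
space is an exponential series, and `1 - e^{-(v + w)} = (1 - e^{-v}) + (1 - e^{-w}) - (1 - e^{-v})(1
- e^{-w})`. -/
lemma IsPoissonProcess.fock_isometry_expFun (hη : IsPoissonProcess P η lam)
    {v w : SimpleFunc X ℝ≥0} (hv : FinSupp lam v) (hw : FinSupp lam w) :
    Integrable (fun z => meanDiff P η (expFun v) z * meanDiff P η (expFun w) z) (fockMeasure lam) ∧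
    ∫ z, meanDiff P η (expFun v) z * meanDiff P η (expFun w) z ∂(fockMeasure lam)
      = ∫ ω, expFun v (η ω) * expFun w (η ω) ∂P := by
  set a := Real.exp (-∫ x, decay v x ∂lam) with ha
  set b := Real.exp (-∫ x, decay w x ∂lam) with hb
  set I₂ := ∫ x, decay v x * decay w x ∂lam with hI₂
  have h1 : ∀ z : Fock X, meanDiff P η (expFun v) z * meanDiff P η (expFun w) z
      = a * b * ∏ j, (decay v (z.2 j) * decay w (z.2 j)) := by
    intro z
    rw [hη.meanDiff_expFun hv, hη.meanDiff_expFun hw, Finset.prod_mul_distrib, Finset.prod_neg,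
      Finset.prod_neg, ← ha, ← hb]
    have : ((-1 : ℝ) ^ (Finset.univ : Finset (Fin z.1)).card) *
        (-1) ^ (Finset.univ : Finset (Fin z.1)).card = 1 := by
      rw [← mul_pow]; simp
    linear_combination (a * b * (∏ j, decay v (z.2 j)) * ∏ j, decay w (z.2 j)) * this
  have hpos : ∀ z : Fock X, 0 ≤ a * b * ∏ j, (decay v (z.2 j) * decay w (z.2 j)) := fun z =>
    mul_nonneg (by positivity) (Finset.prod_nonneg fun j _ =>
      mul_nonneg (decay_nonneg _ _) (decay_nonneg _ _))
  have hlev : ∀ n : ℕ, ∫ z : Fock X, a * b * ∏ j, (decay v (z.2 j) * decay w (z.2 j))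
      ∂((n.factorial : ℝ≥0∞)⁻¹ • Measure.pi fun _ : Fin n => lam).map (Fock.mk n)
      = a * b * (I₂ ^ n / n.factorial) := by
    intro n
    rw [integral_fock_level n, integral_const_mul,
      integral_fintype_prod_eq_pow (fun x => decay v x * decay w x), Fintype.card_fin]
    ring
  have hexp : HasSum (fun n : ℕ => a * b * (I₂ ^ n / n.factorial)) (a * b * Real.exp I₂) := by
    have hs := NormedSpace.expSeries_div_hasSum_exp I₂
    rw [← Real.exp_eq_exp_ℝ] at hs
    exact hs.mul_left _
  have hint : Integrable (fun z : Fock X => a * b * ∏ j, (decay v (z.2 j) * decay w (z.2 j)))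
      (fockMeasure lam) := by
    refine integrable_sum_measure (fun n => ?_) ?_
    · rw [integrable_fock_level]
      exact (Integrable.fintype_prod fun _ : Fin n => hv.integrable_decay_mul).const_mul _
    · simp_rw [fun z : Fock X => Real.norm_of_nonneg (hpos z), hlev]
      exact hexp.summable
  simp_rw [h1]
  refine ⟨hint, ?_⟩
  rw [fockMeasure, integral_sum_measure hint, tsum_congr hlev, hexp.tsum_eq]
  have h2 : ∀ ω, expFun v (η ω) * expFun w (η ω) = expFun (v + w) (η ω) := fun ω => by
    rw [← expFun_mul]; rfl
  simp_rw [h2]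
  rw [hη.integral_expFun (hv.add hw), ha, hb, ← Real.exp_add, ← Real.exp_add]
  congr 1
  have h3 : ∀ x, decay (v + w) x = decay v x + decay w x - decay v x * decay w x := by
    intro x
    simp only [decay, SimpleFunc.coe_add, Pi.add_apply, NNReal.coe_add, neg_add, Real.exp_add]
    ring
  simp_rw [h3]
  have h4 : Integrable (fun x => decay v x + decay w x) lam :=
    hv.integrable_decay.add hw.integrable_decay
  rw [integral_sub h4 hv.integrable_decay_mul, integral_add hv.integrable_decay hw.integrable_decay]
  ring

lemma IsPoissonProcess.meanDiff_add_of_mem (hη : IsPoissonProcess P η lam)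
    {f h : Measure X → ℝ} (hf : f ∈ expSpan lam) (hh : h ∈ expSpan lam) :
    meanDiff P η (f + h) =ᵐ[fockMeasure lam] meanDiff P η f + meanDiff P η h := by
  have := hη.isPoissonLaw.isProbabilityMeasure
  exact hη.meanDiff_add (bounded_of_mem_expSpan hf).1 (memLp_of_mem_expSpan hf _)
    (bounded_of_mem_expSpan hh).1 (memLp_of_mem_expSpan hh _)

lemma IsPoissonProcess.fock_isometry_expSpan (hη : IsPoissonProcess P η lam)
    {f h : Measure X → ℝ} (hf : f ∈ expSpan lam) (hh : h ∈ expSpan lam) :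
    Integrable (fun z => meanDiff P η f z * meanDiff P η h z) (fockMeasure lam) ∧
    ∫ z, meanDiff P η f z * meanDiff P η h z ∂(fockMeasure lam) = ∫ ω, f (η ω) * h (η ω) ∂P := by
  have hP := hη.isPoissonLaw.isProbabilityMeasure
  have hi : ∀ {f h : Measure X → ℝ}, f ∈ expSpan lam → h ∈ expSpan lam →
      Integrable (fun ω => f (η ω) * h (η ω)) P := fun hf hh =>
    ((memLp_of_mem_expSpan hf _).integrable_mul (memLp_of_mem_expSpan hh (P.map η))).comp_measurable
      hη.measurable
  induction hf using Submodule.span_induction with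
  | mem f hf =>
    obtain ⟨v, hv, rfl⟩ := hf
    have hvm : expFun v ∈ expSpan lam := Submodule.subset_span ⟨v, hv, rfl⟩
    induction hh using Submodule.span_induction with
    | mem h hh =>
      obtain ⟨w, hw, rfl⟩ := hh
      exact hη.fock_isometry_expFun hv hw
    | zero => simp [meanDiff, diffOp]
    | add h₁ h₂ hm₁ hm₂ ih₁ ih₂ =>
      have he : (fun z => meanDiff P η (expFun v) z * meanDiff P η (h₁ + h₂) z)
          =ᵐ[fockMeasure lam] fun z => meanDiff P η (expFun v) z * meanDiff P η h₁ z
            + meanDiff P η (expFun v) z * meanDiff P η h₂ z := by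
        filter_upwards [hη.meanDiff_add_of_mem hm₁ hm₂] with z hz
        rw [hz, Pi.add_apply, mul_add]
      refine ⟨(ih₁.1.add ih₂.1).congr he.symm, ?_⟩
      rw [integral_congr_ae he, integral_add ih₁.1 ih₂.1, ih₁.2, ih₂.2,
        ← integral_add (hi hvm hm₁) (hi hvm hm₂)]
      simp_rw [Pi.add_apply, mul_add]
    | smul c h _ ih =>
      simp_rw [meanDiff_smul, Pi.smul_apply, smul_eq_mul, mul_left_comm _ c]
      exact ⟨ih.1.const_mul c, by rw [integral_const_mul, integral_const_mul, ih.2]⟩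
  | zero => simp [meanDiff, diffOp]
  | add f₁ f₂ hm₁ hm₂ ih₁ ih₂ =>
    have he : (fun z => meanDiff P η (f₁ + f₂) z * meanDiff P η h z)
        =ᵐ[fockMeasure lam] fun z => meanDiff P η f₁ z * meanDiff P η h z
          + meanDiff P η f₂ z * meanDiff P η h z := by
      filter_upwards [hη.meanDiff_add_of_mem hm₁ hm₂] with z hz
      rw [hz, Pi.add_apply, add_mul]
    refine ⟨(ih₁.1.add ih₂.1).congr he.symm, ?_⟩
    rw [integral_congr_ae he, integral_add ih₁.1 ih₂.1, ih₁.2, ih₂.2,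
      ← integral_add (hi hm₁ hh) (hi hm₂ hh)]
    simp_rw [Pi.add_apply, add_mul]
  | smul c f _ ih =>
    simp_rw [meanDiff_smul, Pi.smul_apply, smul_eq_mul, mul_assoc]
    exact ⟨ih.1.const_mul c, by rw [integral_const_mul, integral_const_mul, ih.2]⟩

end

section

variable {X : Type*} [MeasurableSpace X] {Ω : Type*} [MeasurableSpace Ω]

/-! ### Density of the exponential functionals -/

lemma memLp_expFun (Q : Measure (Measure X)) [IsFiniteMeasure Q] (v : SimpleFunc X ℝ≥0) :
    MemLp (expFun v) 2 Q :=
  MemLp.of_bound (measurable_expFun v).aestronglyMeasurable 1 (ae_of_all _ (abs_expFun_le_one v))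

/-- The classes of the exponential functionals in `L²(Q)`. -/
def expLp (lam : Measure X) (Q : Measure (Measure X)) [IsFiniteMeasure Q] : Set (Lp ℝ 2 Q) :=
  {F | ∃ v, FinSupp lam v ∧ F = (memLp_expFun Q v).toLp}

lemma inner_eq_integral {E : Type*} [MeasurableSpace E] {ρ : Measure E} (F G : Lp ℝ 2 ρ) :
    inner ℝ F G = ∫ z, F z * G z ∂ρ := by
  rw [L2.inner_def]
  exact integral_congr_ae (ae_of_all _ fun z => by simp [mul_comm])

/-- Exponential functionals span a dense subspace of `L²(Q)`, as no nonzero element is orthogonal to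
all of them. -/
lemma dense_span_expLp (lam : Measure X) [SigmaFinite lam] (Q : Measure (Measure X))
    [IsFiniteMeasure Q] : Dense (Submodule.span ℝ (expLp lam Q) : Set (Lp ℝ 2 Q)) := by
  rw [Submodule.dense_iff_topologicalClosure_eq_top, Submodule.topologicalClosure_eq_top_iff,
    Submodule.eq_bot_iff]
  intro F hF
  have h0 : F =ᵐ[Q] 0 := by
    refine ae_eq_zero_of_expFun lam ((Lp.memLp F).integrable (by norm_num)) fun v hv => ?_
    have h1 := (Submodule.mem_orthogonal _ _).1 hF _
      (Submodule.subset_span ⟨v, hv, rfl⟩ : (memLp_expFun Q v).toLp ∈ Submodule.span ℝ (expLp lam Q))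
    rw [inner_eq_integral] at h1
    rw [← h1]
    refine integral_congr_ae ?_
    filter_upwards [(memLp_expFun Q v).coeFn_toLp] with μ hμ
    rw [hμ, mul_comm]
  exact (Lp.eq_zero_iff_ae_eq_zero).2 h0

lemma exists_expSpan_ae_eq {lam : Measure X} {Q : Measure (Measure X)} [IsFiniteMeasure Q]
    {F : Lp ℝ 2 Q} (hF : F ∈ Submodule.span ℝ (expLp lam Q)) : ∃ h ∈ expSpan lam, F =ᵐ[Q] h := by
  induction hF using Submodule.span_induction with
  | mem F hF =>
    obtain ⟨v, hv, rfl⟩ := hF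
    exact ⟨expFun v, Submodule.subset_span ⟨v, hv, rfl⟩, MemLp.coeFn_toLp _⟩
  | zero => exact ⟨0, zero_mem _, Lp.coeFn_zero _ _ _⟩
  | add F G _ _ ihF ihG =>
    obtain ⟨f, hf, hFf⟩ := ihF
    obtain ⟨g, hg, hGg⟩ := ihG
    exact ⟨f + g, add_mem hf hg, (Lp.coeFn_add F G).trans (hFf.add hGg)⟩
  | smul c F _ ih =>
    obtain ⟨f, hf, hFf⟩ := ih
    exact ⟨c • f, Submodule.smul_mem _ _ hf, (Lp.coeFn_smul c F).trans (hFf.const_smul c)⟩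

lemma exists_expSpan_eLpNorm_le (lam : Measure X) [SigmaFinite lam] (Q : Measure (Measure X))
    [IsFiniteMeasure Q] {f : Measure X → ℝ} (hf : MemLp f 2 Q) {ε : ℝ≥0∞} (hε : ε ≠ 0) :
    ∃ h ∈ expSpan lam, eLpNorm (f - h) 2 Q ≤ ε := by
  obtain ⟨G, hG, hd⟩ := EMetric.mem_closure_iff.1
    ((dense_span_expLp lam Q) hf.toLp) ε (pos_iff_ne_zero.2 hε)
  obtain ⟨h, hh, he⟩ := exists_expSpan_ae_eq hG
  refine ⟨h, hh, le_of_eq_of_le ?_ hd.le⟩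
  rw [Lp.edist_def]
  refine eLpNorm_congr_ae ?_
  filter_upwards [hf.coeFn_toLp, he] with μ h1 h2
  simp [h1, h2]

variable {lam : Measure X} [SigmaFinite lam] {P : Measure Ω} [IsProbabilityMeasure P]
  {η : Ω → Measure X}

/-! ### The isometry between `L²` and the Fock space -/

lemma eLpNorm_two_sq_eq {E : Type*} [MeasurableSpace E] {ρ : Measure E} {f : E → ℝ}
    (hf : MemLp f 2 ρ) : eLpNorm f 2 ρ = ENNReal.ofReal ((∫ z, f z * f z ∂ρ) ^ (2⁻¹ : ℝ)) := by
  rw [hf.eLpNorm_eq_integral_rpow_norm (by norm_num) (by norm_num)]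
  simp [← sq]

lemma IsPoissonProcess.eLpNorm_meanDiff_of_mem (hη : IsPoissonProcess P η lam)
    {h : Measure X → ℝ} (hh : h ∈ expSpan lam) :
    eLpNorm (meanDiff P η h) 2 (fockMeasure lam) = eLpNorm h 2 (P.map η) := by
  have hP := hη.isPoissonLaw.isProbabilityMeasure
  obtain ⟨h1, h2⟩ := hη.fock_isometry_expSpan hh hh
  have hm := (bounded_of_mem_expSpan hh).1
  have h3 : MemLp (meanDiff P η h) 2 (fockMeasure lam) := by
    refine (memLp_two_iff_integrable_sq
      (measurable_meanDiff hη.measurable hm).aestronglyMeasurable).2 ?_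
    simpa only [sq] using h1
  rw [eLpNorm_two_sq_eq h3, eLpNorm_two_sq_eq (memLp_of_mem_expSpan hh _), h2,
    integral_map (f := fun μ => h μ * h μ) hη.measurable.aemeasurable
      (hm.mul hm).aestronglyMeasurable]

/-- The norm bound extends from the span of the exponential functionals by Fatou's lemma, along a
rapidly convergent sequence. -/
lemma IsPoissonProcess.eLpNorm_meanDiff_le (hη : IsPoissonProcess P η lam) {f : Measure X → ℝ}
    (hf : Measurable f) (hf2 : MemLp f 2 (P.map η)) :
    eLpNorm (meanDiff P η f) 2 (fockMeasure lam) ≤ eLpNorm f 2 (P.map η) := by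
  have hP := hη.isPoissonLaw.isProbabilityMeasure
  choose u hu hle using fun k : ℕ => exists_expSpan_eLpNorm_le lam (P.map η) hf2
    (ε := (2⁻¹ : ℝ≥0∞) ^ k) (pow_ne_zero _ (by simp))
  have hum : ∀ k, Measurable (u k) := fun k => (bounded_of_mem_expSpan (hu k)).1
  have hu2 : ∀ k, MemLp (u k) 2 (P.map η) := fun k => memLp_of_mem_expSpan (hu k) _
  have hs : ∑' k, eLpNorm (f - u k) 2 (P.map η) ≠ ∞ := by
    refine ne_top_of_le_ne_top ?_ (ENNReal.tsum_le_tsum hle)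
    rw [ENNReal.tsum_geometric_two]
    simp
  refine (Lp.eLpNorm_lim_le_liminf_eLpNorm
    (fun k => (measurable_meanDiff hη.measurable (hum k)).aestronglyMeasurable) _
    (hη.tendsto_meanDiff hf hf2 hum hu2 hs)).trans ?_
  have h1 : Tendsto (fun k : ℕ => eLpNorm f 2 (P.map η) + (2⁻¹ : ℝ≥0∞) ^ k) atTop
      (𝓝 (eLpNorm f 2 (P.map η))) := by
    have := (ENNReal.tendsto_pow_atTop_nhds_zero_of_lt_one
      (show (2⁻¹ : ℝ≥0∞) < 1 by simp)).const_add (eLpNorm f 2 (P.map η))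
    rwa [add_zero] at this
  rw [← h1.liminf_eq]
  refine liminf_le_liminf (Eventually.of_forall fun k => ?_)
  rw [hη.eLpNorm_meanDiff_of_mem (hu k)]
  calc eLpNorm (u k) 2 (P.map η) = eLpNorm (f - (f - u k)) 2 (P.map η) := by simp
    _ ≤ eLpNorm f 2 (P.map η) + eLpNorm (f - u k) 2 (P.map η) :=
        eLpNorm_sub_le hf2.1 (hf2.sub (hu2 k)).1 (by norm_num)
    _ ≤ _ := by gcongr; exact hle k

lemma IsPoissonProcess.memLp_meanDiff (hη : IsPoissonProcess P η lam) {f : Measure X → ℝ}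
    (hf : Measurable f) (hf2 : MemLp f 2 (P.map η)) :
    MemLp (meanDiff P η f) 2 (fockMeasure lam) :=
  ⟨(measurable_meanDiff hη.measurable hf).aestronglyMeasurable,
    (hη.eLpNorm_meanDiff_le hf hf2).trans_lt hf2.2⟩

/-- Expected differences preserve the `L²` norm. The lower bound follows from the upper bound
applied to `f - h`, with `h` a close linear combination of exponential functionals. -/
theorem IsPoissonProcess.eLpNorm_meanDiff (hη : IsPoissonProcess P η lam) {f : Measure X → ℝ}
    (hf : Measurable f) (hf2 : MemLp f 2 (P.map η)) :
    eLpNorm (meanDiff P η f) 2 (fockMeasure lam) = eLpNorm f 2 (P.map η) := by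
  have hP := hη.isPoissonLaw.isProbabilityMeasure
  refine le_antisymm (hη.eLpNorm_meanDiff_le hf hf2) ?_
  refine ENNReal.le_of_forall_pos_le_add fun ε hε _ => ?_
  have hε2 : (ε : ℝ≥0∞) / 2 ≠ 0 := by simp [hε.ne']
  obtain ⟨h, hh, hle⟩ := exists_expSpan_eLpNorm_le lam (P.map η) hf2 hε2
  have hm := (bounded_of_mem_expSpan hh).1
  have hh2 := memLp_of_mem_expSpan hh (P.map η)
  have hTf := hη.memLp_meanDiff hf hf2
  have hTd := hη.memLp_meanDiff (hf.sub hm) (hf2.sub hh2)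
  calc eLpNorm f 2 (P.map η) = eLpNorm (h + (f - h)) 2 (P.map η) := by simp
    _ ≤ eLpNorm h 2 (P.map η) + eLpNorm (f - h) 2 (P.map η) :=
        eLpNorm_add_le hh2.1 (hf2.sub hh2).1 (by norm_num)
    _ ≤ eLpNorm h 2 (P.map η) + ε / 2 := by gcongr
    _ = eLpNorm (meanDiff P η h) 2 (fockMeasure lam) + ε / 2 := by
        rw [hη.eLpNorm_meanDiff_of_mem hh]
    _ = eLpNorm (meanDiff P η f - meanDiff P η (f - h)) 2 (fockMeasure lam) + ε / 2 := by
        congr 1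
        refine eLpNorm_congr_ae ?_
        filter_upwards [hη.meanDiff_sub hf hf2 hm hh2] with z hz
        rw [Pi.sub_apply, hz, Pi.sub_apply]
        ring
    _ ≤ (eLpNorm (meanDiff P η f) 2 (fockMeasure lam) + ε / 2) + ε / 2 := by
        gcongr
        refine (eLpNorm_sub_le hTf.1 hTd.1 (by norm_num)).trans ?_
        gcongr
        exact (hη.eLpNorm_meanDiff_le (hf.sub hm) (hf2.sub hh2)).trans hle
    _ = _ := by rw [add_assoc, ENNReal.add_halves]

/-- The isometry `f ↦ (𝔼 D^n f(η))_n` from `L²` of the distribution of `η` into `L²` of the Fock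
space measure. -/
def fockIso (hη : IsPoissonProcess P η lam) :
    Lp ℝ 2 (P.map η) →ₗᵢ[ℝ] Lp ℝ 2 (fockMeasure lam) where
  toFun F := (hη.memLp_meanDiff (Lp.stronglyMeasurable F).measurable (Lp.memLp F)).toLp
  map_add' F G := by
    have hm := fun F : Lp ℝ 2 (P.map η) => (Lp.stronglyMeasurable F).measurable
    rw [← MemLp.toLp_add]
    refine MemLp.toLp_congr _ _ ?_
    exact (hη.meanDiff_congr (hm _) (Lp.memLp _) ((hm F).add (hm G)) (Lp.coeFn_add F G)).trans
      (hη.meanDiff_add (hm F) (Lp.memLp F) (hm G) (Lp.memLp G))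
  map_smul' c F := by
    have hm := fun F : Lp ℝ 2 (P.map η) => (Lp.stronglyMeasurable F).measurable
    rw [RingHom.id_apply, ← MemLp.toLp_const_smul]
    refine MemLp.toLp_congr _ _ ?_
    rw [← meanDiff_smul]
    exact hη.meanDiff_congr (hm _) (Lp.memLp _) ((hm F).const_smul c) (Lp.coeFn_smul c F)
  norm_map' F := by
    simp only [LinearMap.coe_mk, AddHom.coe_mk]
    rw [Lp.norm_toLp, hη.eLpNorm_meanDiff (Lp.stronglyMeasurable F).measurable (Lp.memLp F),
      Lp.norm_def]

lemma fockIso_toLp (hη : IsPoissonProcess P η lam) {f : Measure X → ℝ}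
    (hf : Measurable f) (hf2 : MemLp f 2 (P.map η)) :
    fockIso hη hf2.toLp =ᵐ[fockMeasure lam] meanDiff P η f :=
  (MemLp.coeFn_toLp (hη.memLp_meanDiff (Lp.stronglyMeasurable hf2.toLp).measurable
    (Lp.memLp hf2.toLp))).trans (hη.meanDiff_congr (Lp.stronglyMeasurable _).measurable (Lp.memLp _) hf
    hf2.coeFn_toLp)

/-- The adjoint of the isometry `fockIso`: it maps a kernel of degree `n` to `1 / n!` times its
multiple Wiener–Itô integral. -/
def fockAdj (hη : IsPoissonProcess P η lam) : Lp ℝ 2 (fockMeasure lam) →L[ℝ] Lp ℝ 2 (P.map η) :=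
  ContinuousLinearMap.adjoint (fockIso hη).toContinuousLinearMap

lemma inner_fockAdj (hη : IsPoissonProcess P η lam) (φ : Lp ℝ 2 (fockMeasure lam))
    (F : Lp ℝ 2 (P.map η)) : inner ℝ (fockAdj hη φ) F = inner ℝ φ (fockIso hη F) :=
  ContinuousLinearMap.adjoint_inner_left _ _ _

/-- An integrable functional is the image of `φ` under the adjoint as soon as it has the right
integrals against the exponential functionals; square integrability need not be known in advance. -/
lemma ae_eq_fockAdj (hη : IsPoissonProcess P η lam) (φ : Lp ℝ 2 (fockMeasure lam))
    {Φ : Measure X → ℝ} (hΦ : Integrable Φ (P.map η))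
    (h : ∀ v, FinSupp lam v → ∫ μ, Φ μ * expFun v μ ∂(P.map η)
      = ∫ z, φ z * meanDiff P η (expFun v) z ∂(fockMeasure lam)) :
    Φ =ᵐ[P.map η] fockAdj hη φ := by
  have hP := hη.isPoissonLaw.isProbabilityMeasure
  have hi : Integrable (fockAdj hη φ) (P.map η) := (Lp.memLp _).integrable (by norm_num)
  have h0 := ae_eq_zero_of_expFun lam (hΦ.sub hi) fun v hv => by
    have h1 := inner_fockAdj hη φ (memLp_expFun (P.map η) v).toLp
    rw [inner_eq_integral, inner_eq_integral] at h1
    have hb : ∀ {h : Measure X → ℝ}, Integrable h (P.map η) →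
        Integrable (fun μ => h μ * expFun v μ) (P.map η) := fun hh =>
      hh.mul_bdd (measurable_expFun v).aestronglyMeasurable (ae_of_all _ (abs_expFun_le_one v))
    simp only [Pi.sub_apply, sub_mul]
    rw [integral_sub (hb hΦ) (hb hi), h v hv, sub_eq_zero]
    have h2 : ∫ μ, fockAdj hη φ μ * ((memLp_expFun (P.map η) v).toLp : Lp ℝ 2 (P.map η)) μ
        ∂(P.map η)
        = ∫ μ, fockAdj hη φ μ * expFun v μ ∂(P.map η) := by
      refine integral_congr_ae ?_
      filter_upwards [(memLp_expFun (P.map η) v).coeFn_toLp] with μ hμ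
      rw [hμ]
    rw [← h2, h1]
    refine integral_congr_ae ?_
    filter_upwards [fockIso_toLp hη (measurable_expFun v) (memLp_expFun (P.map η) v)] with z hz
    rw [hz]
  filter_upwards [h0] with μ hμ
  exact sub_eq_zero.1 hμ

/-! ### Functions of the number operator -/

lemma measurable_degree (a : ℕ → ℝ) : Measurable fun z : Fock X => a z.1 :=
  measurable_fock fun n => (measurable_const : Measurable fun _ : Fin n → X => a n)

lemma memLp_numMul {a : ℕ → ℝ} (ha : ∀ n, |a n| ≤ 1) (F : Lp ℝ 2 (fockMeasure lam)) :
    MemLp (fun z => a z.1 * F z) 2 (fockMeasure lam) :=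
  (Lp.memLp F).of_le ((measurable_degree a).aestronglyMeasurable.mul (Lp.memLp F).1)
    (ae_of_all _ fun z => by
      rw [norm_mul]
      exact mul_le_of_le_one_left (norm_nonneg _) (ha _))

/-- Multiplication by a bounded function `a` of the degree. -/
def numMul (lam : Measure X) [SigmaFinite lam] (a : ℕ → ℝ) (ha : ∀ n, |a n| ≤ 1) :
    Lp ℝ 2 (fockMeasure lam) →L[ℝ] Lp ℝ 2 (fockMeasure lam) :=
  LinearMap.mkContinuous
    { toFun := fun F => (memLp_numMul ha F).toLp
      map_add' := fun F G => by
        rw [← MemLp.toLp_add]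
        refine MemLp.toLp_congr _ _ ?_
        filter_upwards [Lp.coeFn_add F G] with z hz
        rw [hz, Pi.add_apply, Pi.add_apply, mul_add]
      map_smul' := fun c F => by
        rw [RingHom.id_apply, ← MemLp.toLp_const_smul]
        refine MemLp.toLp_congr _ _ ?_
        filter_upwards [Lp.coeFn_smul c F] with z hz
        rw [hz, Pi.smul_apply, Pi.smul_apply, smul_eq_mul, smul_eq_mul, mul_left_comm] } 1
    fun F => by
      rw [one_mul]
      refine Lp.norm_le_norm_of_ae_le ?_
      filter_upwards [(memLp_numMul ha F).coeFn_toLp] with z hz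
      simp only [LinearMap.coe_mk, AddHom.coe_mk]
      rw [hz, norm_mul]
      exact mul_le_of_le_one_left (norm_nonneg _) (ha _)

lemma coeFn_numMul (a : ℕ → ℝ) (ha : ∀ n, |a n| ≤ 1) (F : Lp ℝ 2 (fockMeasure lam)) :
    numMul lam a ha F =ᵐ[fockMeasure lam] fun z => a z.1 * F z :=
  MemLp.coeFn_toLp (memLp_numMul ha F)

/-- Dominated convergence in `L²`. -/
lemma tendsto_eLpNorm_sub_of_dominated {E : Type*} [MeasurableSpace E] {ρ : Measure E}
    {u : ℕ → E → ℝ} {f b : E → ℝ} (hu : ∀ k, AEStronglyMeasurable (u k) ρ)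
    (hf : AEStronglyMeasurable f ρ) (hb : MemLp b 2 ρ) (hle : ∀ k, ∀ᵐ z ∂ρ, |u k z - f z| ≤ |b z|)
    (hlim : ∀ᵐ z ∂ρ, Tendsto (fun k => u k z) atTop (𝓝 (f z))) :
    Tendsto (fun k => eLpNorm (u k - f) 2 ρ) atTop (𝓝 0) := by
  have h1 : Tendsto (fun k => ∫⁻ z, ‖(u k - f) z‖ₑ ^ (2 : ℝ) ∂ρ) atTop (𝓝 0) := by
    rw [show (0 : ℝ≥0∞) = ∫⁻ z, 0 ∂ρ by simp]
    refine tendsto_lintegral_of_dominated_convergence' (fun z => ‖b z‖ₑ ^ (2 : ℝ))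
      (fun k => ((hu k).sub hf).enorm.pow_const _) (fun k => ?_) ?_ ?_
    · filter_upwards [hle k] with z hz
      gcongr
      rw [enorm_le_iff_norm_le]
      exact hz
    · exact ((eLpNorm_lt_top_iff_lintegral_rpow_enorm_lt_top (by norm_num) (by norm_num)).1
        hb.2).ne
    · filter_upwards [hlim] with z hz
      have h2 : Tendsto (fun k => ‖u k z - f z‖ₑ) atTop (𝓝 0) := by
        have := (hz.sub_const (f z)).enorm
        simpa using this
      have := h2.ennrpow_const 2
      simpa using this
  have h3 := h1.ennrpow_const (1 / 2)
  simp only [one_div, ENNReal.zero_rpow_of_pos (show (0 : ℝ) < 2⁻¹ by norm_num)] at h3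
  refine h3.congr fun k => ?_
  rw [eLpNorm_eq_lintegral_rpow_enorm_toReal (by norm_num) (by norm_num)]
  simp

end

section

variable {X : Type*} [MeasurableSpace X] {Ω : Type*} [MeasurableSpace Ω]

/-! ### Limits in `L²(P)` -/

/-- `L²` limits are unique almost surely, so the choice made in `l2Limit` is immaterial. -/
lemma IsL2Limit.ae_eq {P : Measure Ω} {Z : ℕ → Ω → ℝ} {Y Y' : Ω → ℝ} (h : IsL2Limit P Z Y)
    (h' : IsL2Limit P Z Y') (hZ : ∀ k, AEStronglyMeasurable (Z k) P) : Y =ᵐ[P] Y' := by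
  have h1 : ∀ k, eLpNorm (Y - Y') 2 P ≤ eLpNorm (Z k - Y') 2 P + eLpNorm (Z k - Y) 2 P := by
    intro k
    calc eLpNorm (Y - Y') 2 P = eLpNorm ((Z k - Y') - (Z k - Y)) 2 P := by congr 1; ring
      _ ≤ _ := eLpNorm_sub_le ((hZ k).sub h'.1.1) ((hZ k).sub h.1.1) (by norm_num)
  have h2 := h'.2.add h.2
  rw [add_zero] at h2
  have h3 : eLpNorm (Y - Y') 2 P = 0 := le_antisymm (ge_of_tendsto' h2 h1) bot_le
  rw [eLpNorm_eq_zero_iff (h.1.1.sub h'.1.1) (by norm_num)] at h3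
  exact h3.mono fun ω hω => sub_eq_zero.1 hω

lemma IsL2Limit.l2Limit {P : Measure Ω} {Z : ℕ → Ω → ℝ} {Y : Ω → ℝ} (h : IsL2Limit P Z Y) :
    IsL2Limit P Z (l2Limit P Z) := by
  have hex : ∃ Y, IsL2Limit P Z Y := ⟨Y, h⟩
  rw [PoissonMehler.l2Limit, dif_pos hex]
  exact hex.choose_spec

variable {lam : Measure X} [SigmaFinite lam] {P : Measure Ω} [IsProbabilityMeasure P]
  {η : Ω → Measure X}

/-- Convergence of kernels in the Fock space implies convergence of the corresponding functionals.
-/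
lemma isL2Limit_fockAdj (hη : IsPoissonProcess P η lam) {W : ℕ → Lp ℝ 2 (fockMeasure lam)}
    {V : Lp ℝ 2 (fockMeasure lam)} (hW : Tendsto W atTop (𝓝 V)) {Z : ℕ → Ω → ℝ}
    (hZ : ∀ k, Z k =ᵐ[P] fun ω => fockAdj hη (W k) (η ω)) :
    IsL2Limit P Z fun ω => fockAdj hη V (η ω) := by
  have hm := fun F : Lp ℝ 2 (P.map η) => (Lp.stronglyMeasurable F).measurable
  refine ⟨(memLp_map_measure_iff (Lp.memLp _).1 hη.measurable.aemeasurable).1 (Lp.memLp _), ?_⟩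
  have h1 : ∀ k, eLpNorm (Z k - fun ω => fockAdj hη V (η ω)) 2 P
      = ‖fockAdj hη (W k) - fockAdj hη V‖ₑ := by
    intro k
    rw [Lp.enorm_def, hη.eLpNorm_map_eq (hm _)]
    refine eLpNorm_congr_ae ?_
    filter_upwards [hZ k, ae_of_ae_map hη.measurable.aemeasurable
      (Lp.coeFn_sub (fockAdj hη (W k)) (fockAdj hη V))] with ω h2 h3
    rw [h3, Pi.sub_apply, Pi.sub_apply, h2]
  simp_rw [h1]
  have h2 : Tendsto (fun k => fockAdj hη (W k) - fockAdj hη V) atTop (𝓝 0) := by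
    have := (((fockAdj hη).continuous.tendsto V).comp hW).sub_const (fockAdj hη V)
    simpa using this
  simpa using h2.enorm

/-! ### Truncation of kernels -/

section truncate

variable {n : ℕ} {g : (Fin n → X) → ℝ}

lemma measurable_truncate (lam : Measure X) [SigmaFinite lam] (k : ℕ) (hg : Measurable g) :
    Measurable (truncate lam k g) := by
  refine Measurable.ite ?_ hg measurable_const
  have h1 : MeasurableSet (cube (spanningSets lam k) n) :=
    measurableSet_cube (measurableSet_spanningSets lam k) n
  have h2 : MeasurableSet {x | |g x| ≤ k} := measurableSet_le hg.abs measurable_const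
  convert h1.inter h2 using 1
  ext x
  simp [cube]

lemma abs_truncate_le (lam : Measure X) [SigmaFinite lam] (k : ℕ) (g : (Fin n → X) → ℝ)
    (x : Fin n → X) : |truncate lam k g x| ≤ k := by
  rw [truncate]
  split_ifs with h
  · exact h.2
  · simp

lemma abs_truncate_le_abs (lam : Measure X) [SigmaFinite lam] (k : ℕ) (g : (Fin n → X) → ℝ)
    (x : Fin n → X) : |truncate lam k g x| ≤ |g x| := by
  rw [truncate]
  split_ifs with h
  · exact le_rfl
  · simp

lemma abs_truncate_sub_le (lam : Measure X) [SigmaFinite lam] (k : ℕ) (g : (Fin n → X) → ℝ)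
    (x : Fin n → X) : |truncate lam k g x - g x| ≤ |g x| := by
  rw [truncate]
  split_ifs with h <;> simp

lemma truncate_eq_zero (lam : Measure X) [SigmaFinite lam] (k : ℕ) (g : (Fin n → X) → ℝ)
    (x : Fin n → X) (hx : x ∉ cube (spanningSets lam k) n) : truncate lam k g x = 0 := by
  rw [truncate, if_neg]
  exact fun h => hx fun j _ => h.1 j

/-- Each truncation level is eventually inactive at a given point. -/
lemma tendsto_truncate (lam : Measure X) [SigmaFinite lam] (g : (Fin n → X) → ℝ) (x : Fin n → X) :
    Tendsto (fun k => truncate lam k g x) atTop (𝓝 (g x)) := by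
  obtain ⟨k₀, hk₀⟩ := Set.mem_iUnion.1
    (iUnion_cube_spanningSets lam n ▸ Set.mem_univ x : x ∈ ⋃ k, cube (spanningSets lam k) n)
  obtain ⟨k₁, hk₁⟩ := exists_nat_ge |g x|
  refine tendsto_const_nhds.congr' ?_
  filter_upwards [eventually_ge_atTop k₀, eventually_ge_atTop k₁] with k h0 h1
  rw [truncate, if_pos]
  exact ⟨fun j => monotone_spanningSets lam h0 (hk₀ j (Set.mem_univ j)),
    hk₁.trans (by exact_mod_cast h1)⟩

end truncate

/-! ### Multiple integrals of the chaos kernels -/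

/-- The integral of a function that lives on degree `n` only. -/
lemma integral_fock_of_level {ψ : Fock X → ℝ} (hψ : Integrable ψ (fockMeasure lam)) (n : ℕ)
    (h0 : ∀ z, z.1 ≠ n → ψ z = 0) :
    ∫ z, ψ z ∂(fockMeasure lam)
      = (n.factorial : ℝ)⁻¹ * ∫ x, ψ ⟨n, x⟩ ∂(Measure.pi fun _ : Fin n => lam) := by
  rw [fockMeasure, integral_sum_measure hψ, tsum_eq_single n, integral_fock_level]
  intro m hm
  rw [integral_fock_level]
  simp [fun x => h0 ⟨m, x⟩ hm]

lemma memLp_fock_level {φ : Fock X → ℝ} (hφm : Measurable φ) (hφ : MemLp φ 2 (fockMeasure lam))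
    (n : ℕ) : MemLp (fun x => φ ⟨n, x⟩) 2 (Measure.pi fun _ : Fin n => lam) := by
  have hm : Measurable fun x => φ (Fock.mk n x) := hφm.comp (measurableEmbedding_fock_mk n).measurable
  have h1 := (memLp_two_iff_integrable_sq hφm.aestronglyMeasurable).1 hφ
  refine (memLp_two_iff_integrable_sq hm.aestronglyMeasurable).2 ?_
  exact (integrable_fock_level n _).1 (h1.mono_measure (Measure.le_sum _ n))

/-- The indicator function of the degree `n`, as a weight. -/
def levelWeight (n m : ℕ) : ℝ := if m = n then 1 else 0

lemma abs_levelWeight_le (n m : ℕ) : |levelWeight n m| ≤ 1 := by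
  rw [levelWeight]; split_ifs <;> simp

/-- The truncations of the chaos kernels, normalized as functions on the Fock space. -/
def truncKernel (P : Measure Ω) (lam : Measure X) [SigmaFinite lam] (η : Ω → Measure X)
    (f : Measure X → ℝ) (n k : ℕ) (z : Fock X) : ℝ :=
  levelWeight n z.1 * (z.1.factorial * truncate lam k (chaosKernel P η f z.1) z.2)

lemma factorial_mul_chaosKernel {P : Measure Ω} {η : Ω → Measure X} (f : Measure X → ℝ) (z : Fock X) :
    (z.1.factorial : ℝ) * chaosKernel P η f z.1 z.2 = meanDiff P η f z := by
  rw [chaosKernel, ← mul_assoc, mul_inv_cancel₀ (by positivity), one_mul, meanDiff]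

lemma measurable_chaosKernel (hη : Measurable η) {f : Measure X → ℝ} (hf : Measurable f) (n : ℕ) :
    Measurable (chaosKernel P η f n) :=
  ((measurable_meanDiff hη hf).comp (measurableEmbedding_fock_mk n).measurable).const_mul _

lemma measurable_truncKernel (hη : Measurable η) {f : Measure X → ℝ} (hf : Measurable f)
    (n k : ℕ) : Measurable (truncKernel P lam η f n k) :=
  measurable_fock fun m =>
    ((measurable_truncate lam k (measurable_chaosKernel (P := P) hη hf m)).const_mul
      (m.factorial : ℝ)).const_mul (levelWeight n m)

lemma abs_truncKernel_le (f : Measure X → ℝ) (n k : ℕ) (z : Fock X) :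
    |truncKernel P lam η f n k z| ≤ |meanDiff P η f z| := by
  rw [truncKernel, abs_mul, ← factorial_mul_chaosKernel, abs_mul, abs_mul]
  calc |levelWeight n z.1| * (|(z.1.factorial : ℝ)| * |truncate lam k (chaosKernel P η f z.1) z.2|)
      ≤ 1 * (|(z.1.factorial : ℝ)| * |chaosKernel P η f z.1 z.2|) := by
        exact mul_le_mul (abs_levelWeight_le _ _) (mul_le_mul_of_nonneg_left
          (abs_truncate_le_abs lam _ _ _) (abs_nonneg _)) (by positivity) zero_le_one
    _ = _ := one_mul _

lemma abs_truncKernel_sub_le (f : Measure X → ℝ) (n k : ℕ) (z : Fock X) :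
    |truncKernel P lam η f n k z - levelWeight n z.1 * meanDiff P η f z| ≤ |meanDiff P η f z| := by
  rw [truncKernel, ← factorial_mul_chaosKernel, ← mul_sub, ← mul_sub, abs_mul, abs_mul, abs_mul]
  calc |levelWeight n z.1| * (|(z.1.factorial : ℝ)| *
        |truncate lam k (chaosKernel P η f z.1) z.2 - chaosKernel P η f z.1 z.2|)
      ≤ 1 * (|(z.1.factorial : ℝ)| * |chaosKernel P η f z.1 z.2|) := by
        exact mul_le_mul (abs_levelWeight_le _ _) (mul_le_mul_of_nonneg_left
          (abs_truncate_sub_le lam _ _ _) (abs_nonneg _)) (by positivity) zero_le_one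
    _ = _ := one_mul _

lemma tendsto_truncKernel (f : Measure X → ℝ) (n : ℕ) (z : Fock X) :
    Tendsto (fun k => truncKernel P lam η f n k z) atTop
      (𝓝 (levelWeight n z.1 * meanDiff P η f z)) := by
  rw [← factorial_mul_chaosKernel]
  exact ((tendsto_truncate lam _ z.2).const_mul _).const_mul _

lemma memLp_truncKernel (hη : IsPoissonProcess P η lam) {f : Measure X → ℝ}
    (hf : Measurable f) (hf2 : MemLp f 2 (P.map η)) (n k : ℕ) :
    MemLp (truncKernel P lam η f n k) 2 (fockMeasure lam) :=
  (hη.memLp_meanDiff hf hf2).of_le (measurable_truncKernel hη.measurable hf n k).aestronglyMeasurable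
    (ae_of_all _ (abs_truncKernel_le f n k))

lemma tendsto_toLp_truncKernel (hη : IsPoissonProcess P η lam) {f : Measure X → ℝ}
    (hf : Measurable f) (hf2 : MemLp f 2 (P.map η)) (n : ℕ) :
    Tendsto (fun k => (memLp_truncKernel hη hf hf2 n k).toLp) atTop
      (𝓝 (numMul lam (levelWeight n) (abs_levelWeight_le n) (fockIso hη hf2.toLp))) := by
  rw [tendsto_iff_edist_tendsto_0]
  have h1 : ∀ᵐ z ∂(fockMeasure lam),
      numMul lam (levelWeight n) (abs_levelWeight_le n) (fockIso hη hf2.toLp) z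
        = levelWeight n z.1 * meanDiff P η f z := by
    filter_upwards [coeFn_numMul (levelWeight n) (abs_levelWeight_le n) (fockIso hη hf2.toLp),
      fockIso_toLp hη hf hf2] with z h1 h2
    rw [h1, h2]
  have h2 := tendsto_eLpNorm_sub_of_dominated (ρ := fockMeasure lam)
    (fun k => (measurable_truncKernel (lam := lam) (P := P) hη.measurable hf n k).aestronglyMeasurable)
    (f := fun z => levelWeight n z.1 * meanDiff P η f z)
    ((measurable_degree (levelWeight n)).mul
      (measurable_meanDiff hη.measurable hf)).aestronglyMeasurable
    (hη.memLp_meanDiff hf hf2) (fun k => ae_of_all _ (abs_truncKernel_sub_le f n k))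
    (ae_of_all _ (tendsto_truncKernel f n))
  refine h2.congr fun k => ?_
  rw [Lp.edist_def]
  refine eLpNorm_congr_ae ?_
  filter_upwards [h1, (memLp_truncKernel hη hf hf2 n k).coeFn_toLp] with z h3 h4
  simp only [Pi.sub_apply]
  rw [h3, h4]

/-- The pathwise integrals of the truncated kernels are given by the adjoint of `fockIso`. -/
lemma wienerItoApprox_ae_eq (hη : IsPoissonProcess P η lam) {f : Measure X → ℝ}
    (hf : Measurable f) (hf2 : MemLp f 2 (P.map η)) (n k : ℕ) :
    wienerItoApprox lam η (chaosKernel P η f n) k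
      =ᵐ[P] fun ω => fockAdj hη (memLp_truncKernel hη hf hf2 n k).toLp (η ω) := by
  have hP := hη.isPoissonLaw.isProbabilityMeasure
  set g := truncate lam k (chaosKernel P η f n) with hg
  have hgm : Measurable g := measurable_truncate lam k (measurable_chaosKernel hη.measurable hf n)
  have hB := measurableSet_spanningSets lam k
  have hlB := (measure_spanningSets_lt_top lam k).ne
  have hM : ∀ x, |g x| ≤ (k : ℝ) := abs_truncate_le lam k _
  have hg0 := truncate_eq_zero lam k (chaosKernel P η f n)
  obtain ⟨Φ, hΦ, hΦe⟩ := hη.exists_representative_compensatedIntegral hB hlB hgm hM hg0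
  have hΦ2 : MemLp Φ 2 (P.map η) := by
    rw [memLp_map_measure_iff hΦ.aestronglyMeasurable hη.measurable.aemeasurable]
    exact (memLp_congr_ae hΦe).1 (hη.memLp_compensatedIntegral hB hlB hgm hM hg0)
  have h1 : Φ =ᵐ[P.map η] fockAdj hη (memLp_truncKernel hη hf hf2 n k).toLp := by
    refine ae_eq_fockAdj hη _ (hΦ2.integrable (by norm_num)) fun v hv => ?_
    have h2 := hη.integral_expFun_mul_compensatedIntegral hB hlB hgm hM hg0 hv
    rw [integral_map (f := fun μ => Φ μ * expFun v μ) hη.measurable.aemeasurable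
      (hΦ.mul (measurable_expFun v)).aestronglyMeasurable]
    have h3 : ∫ ω, Φ (η ω) * expFun v (η ω) ∂P
        = ∫ ω, expFun v (η ω) * compensatedIntegral lam (η ω) g ∂P := by
      refine integral_congr_ae ?_
      filter_upwards [hΦe] with ω hω
      rw [hω, mul_comm]
    have h4 : ∫ z, ((memLp_truncKernel hη hf hf2 n k).toLp : Lp ℝ 2 (fockMeasure lam)) z
          * meanDiff P η (expFun v) z ∂(fockMeasure lam)
        = ∫ z, truncKernel P lam η f n k z * meanDiff P η (expFun v) z ∂(fockMeasure lam) := by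
      refine integral_congr_ae ?_
      filter_upwards [(memLp_truncKernel hη hf hf2 n k).coeFn_toLp] with z hz
      rw [hz]
    have hi : Integrable (fun z => truncKernel P lam η f n k z * meanDiff P η (expFun v) z)
        (fockMeasure lam) := (memLp_truncKernel hη hf hf2 n k).integrable_mul
      (hη.memLp_meanDiff (measurable_expFun v) (memLp_expFun _ v))
    rw [h3, h2, h4, integral_fock_of_level hi n fun z hz => by
      simp [truncKernel, levelWeight, hz], ← integral_const_mul]
    refine integral_congr_ae (ae_of_all _ fun x => ?_)
    -- The normalization of `truncKernel` by `n!` cancels the factor `1 / n!` in `fockMeasure`.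
    have hn : (n.factorial : ℝ) ≠ 0 := by positivity
    simp only [truncKernel, levelWeight, if_true, one_mul, meanDiff]
    rw [← hg]
    field_simp
  filter_upwards [hΦe, ae_of_ae_map hη.measurable.aemeasurable h1] with ω h2 h3
  rw [← h3, ← h2]
  rfl

lemma isL2Limit_wienerItoApprox (hη : IsPoissonProcess P η lam) {f : Measure X → ℝ}
    (hf : Measurable f) (hf2 : MemLp f 2 (P.map η)) (n : ℕ) :
    IsL2Limit P (wienerItoApprox lam η (chaosKernel P η f n)) fun ω =>
      fockAdj hη (numMul lam (levelWeight n) (abs_levelWeight_le n) (fockIso hη hf2.toLp)) (η ω) :=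
  isL2Limit_fockAdj hη (tendsto_toLp_truncKernel hη hf hf2 n)
    (wienerItoApprox_ae_eq hη hf hf2 n)

lemma aestronglyMeasurable_fockAdj (hη : IsPoissonProcess P η lam)
    (W : Lp ℝ 2 (fockMeasure lam)) : AEStronglyMeasurable (fun ω => fockAdj hη W (η ω)) P :=
  ((Lp.stronglyMeasurable _).comp_measurable hη.measurable).aestronglyMeasurable

/-- The multiple Wiener–Itô integral of a chaos kernel of `f(η)` is the projection of `f(η)` to the
corresponding chaos. -/
lemma wienerIto_ae_eq (hη : IsPoissonProcess P η lam) {f : Measure X → ℝ}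
    (hf : Measurable f) (hf2 : MemLp f 2 (P.map η)) (n : ℕ) :
    wienerIto P lam η (chaosKernel P η f n) =ᵐ[P] fun ω =>
      fockAdj hη (numMul lam (levelWeight n) (abs_levelWeight_le n) (fockIso hη hf2.toLp)) (η ω) := by
  have h := isL2Limit_wienerItoApprox hη hf hf2 n
  exact h.l2Limit.ae_eq h fun k => (aestronglyMeasurable_fockAdj hη _).congr
    (wienerItoApprox_ae_eq hη hf hf2 n k).symm

/-! ### The inverse of the Ornstein–Uhlenbeck generator -/

/-- The weights of the partial sums of the series defining `L⁻¹`. -/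
def invWeight (m n : ℕ) : ℝ := if n ≤ m then (n : ℝ)⁻¹ else 0

lemma abs_inv_natCast_le (n : ℕ) : |(n : ℝ)⁻¹| ≤ 1 := by
  rw [abs_of_nonneg (by positivity)]
  exact Nat.cast_inv_le_one n

lemma abs_invWeight_le (m n : ℕ) : |invWeight m n| ≤ 1 := by
  rw [invWeight]
  split_ifs
  · exact abs_inv_natCast_le n
  · simp

/-- The partial sum of order `m + 1` adds the projection to the degree `m + 1`, divided by `m + 1`.
-/
lemma numMul_invWeight_succ (m : ℕ) (F : Lp ℝ 2 (fockMeasure lam)) :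
    numMul lam (invWeight (m + 1)) (abs_invWeight_le _) F
      = numMul lam (invWeight m) (abs_invWeight_le _) F
        + ((m + 1 : ℕ) : ℝ)⁻¹ • numMul lam (levelWeight (m + 1)) (abs_levelWeight_le _) F := by
  refine Lp.ext ?_
  filter_upwards [coeFn_numMul _ (abs_invWeight_le (m + 1)) F, coeFn_numMul _ (abs_invWeight_le m) F,
    coeFn_numMul _ (abs_levelWeight_le (m + 1)) F, Lp.coeFn_add
      (numMul lam (invWeight m) (abs_invWeight_le _) F)
      (((m + 1 : ℕ) : ℝ)⁻¹ • numMul lam (levelWeight (m + 1)) (abs_levelWeight_le _) F),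
    Lp.coeFn_smul (((m + 1 : ℕ) : ℝ)⁻¹)
      (numMul lam (levelWeight (m + 1)) (abs_levelWeight_le _) F)] with z h1 h2 h3 h4 h5
  rw [h4, Pi.add_apply, h5, Pi.smul_apply, h1, h2, h3, smul_eq_mul]
  simp only [invWeight, levelWeight]
  rcases lt_trichotomy z.1 (m + 1) with h | h | h
  · rw [if_pos h.le, if_pos (Nat.lt_succ_iff.1 h), if_neg h.ne]; ring
  · rw [if_pos h.le, if_neg (by omega), if_pos h, h]; ring
  · rw [if_neg (by omega), if_neg (by omega), if_neg h.ne']; ring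

/-- The partial sums of the series defining `L⁻¹` multiply the kernel of degree `n`, `1 ≤ n ≤ m`, by
`-1/n` and annihilate the other degrees. -/
lemma invOUPartial_ae_eq (hη : IsPoissonProcess P η lam) {f : Measure X → ℝ}
    (hf : Measurable f) (hf2 : MemLp f 2 (P.map η)) (m : ℕ) :
    invOUPartial P lam η f m =ᵐ[P] fun ω => fockAdj hη
      (-numMul lam (invWeight m) (abs_invWeight_le m) (fockIso hη hf2.toLp)) (η ω) := by
  set F := fockIso hη hf2.toLp with hF
  have hη' := hη.measurable.aemeasurable (μ := P)
  suffices h : ∀ᵐ ω ∂P, ∑ n ∈ Finset.Icc 1 m, (n : ℝ)⁻¹ * wienerIto P lam η (chaosKernel P η f n) ω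
      = fockAdj hη (numMul lam (invWeight m) (abs_invWeight_le m) F) (η ω) by
    rw [map_neg]
    filter_upwards [h, ae_of_ae_map hη' (Lp.coeFn_neg
      (fockAdj hη (numMul lam (invWeight m) (abs_invWeight_le m) F)))] with ω h1 h2
    rw [h2, Pi.neg_apply, ← h1, invOUPartial]
  induction m with
  | zero =>
    have h0 : numMul lam (invWeight 0) (abs_invWeight_le 0) F = 0 := by
      refine Lp.ext ?_
      filter_upwards [coeFn_numMul _ (abs_invWeight_le 0) F,
        Lp.coeFn_zero ℝ 2 (fockMeasure lam)] with z h1 h2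
      rw [h1, h2, invWeight]
      split_ifs with h
      -- The weight is `0⁻¹ = 0` in degree `0`.
      · simp [Nat.le_zero.1 h]
      · simp
    rw [h0, map_zero]
    filter_upwards [ae_of_ae_map hη' (Lp.coeFn_zero ℝ 2 (P.map η))] with ω h1
    rw [h1]
    simp
  | succ m ih =>
    rw [numMul_invWeight_succ, map_add, map_smul]
    filter_upwards [ih, wienerIto_ae_eq hη hf hf2 (m + 1), ae_of_ae_map hη' (Lp.coeFn_add
      (fockAdj hη (numMul lam (invWeight m) (abs_invWeight_le m) F))
      ((((m + 1 : ℕ) : ℝ)⁻¹) • fockAdj hη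
        (numMul lam (levelWeight (m + 1)) (abs_levelWeight_le _) F))),
      ae_of_ae_map hη' (Lp.coeFn_smul (((m + 1 : ℕ) : ℝ)⁻¹) (fockAdj hη
        (numMul lam (levelWeight (m + 1)) (abs_levelWeight_le _) F)))] with ω h1 h2 h3 h4
    rw [h3, Pi.add_apply, h4, Pi.smul_apply, ← h1, Finset.sum_Icc_succ_top (by omega), h2,
      smul_eq_mul]

lemma tendsto_numMul_invWeight (F : Lp ℝ 2 (fockMeasure lam)) :
    Tendsto (fun m => -numMul lam (invWeight m) (abs_invWeight_le m) F) atTop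
      (𝓝 (-numMul lam (fun n => (n : ℝ)⁻¹) abs_inv_natCast_le F)) := by
  refine Tendsto.neg ?_
  rw [tendsto_iff_edist_tendsto_0]
  have hF := (Lp.memLp F)
  have h2 := tendsto_eLpNorm_sub_of_dominated (ρ := fockMeasure lam)
    (u := fun m z => invWeight m z.1 * F z) (f := fun z => (z.1 : ℝ)⁻¹ * F z) (b := F)
    (fun m => (measurable_degree (invWeight m)).aestronglyMeasurable.mul hF.1)
    ((measurable_degree fun n => (n : ℝ)⁻¹).aestronglyMeasurable.mul hF.1) hF
    (fun m => ae_of_all _ fun z => ?_) (ae_of_all _ fun z => ?_)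
  · refine h2.congr fun m => ?_
    rw [Lp.edist_def]
    refine eLpNorm_congr_ae ?_
    filter_upwards [coeFn_numMul _ (abs_invWeight_le m) F,
      coeFn_numMul (fun n => (n : ℝ)⁻¹) abs_inv_natCast_le F] with z h3 h4
    simp only [Pi.sub_apply]
    rw [h3, h4]
  · rw [← sub_mul, abs_mul]
    refine mul_le_of_le_one_left (abs_nonneg _) ?_
    rw [invWeight]
    split_ifs
    · simp
    · rw [zero_sub, abs_neg]; exact abs_inv_natCast_le _
  · refine Tendsto.mul_const _ (tendsto_const_nhds.congr' ?_)
    filter_upwards [eventually_ge_atTop z.1] with m hm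
    rw [invWeight, if_pos hm]

lemma isL2Limit_invOUPartial (hη : IsPoissonProcess P η lam) {f : Measure X → ℝ}
    (hf : Measurable f) (hf2 : MemLp f 2 (P.map η)) :
    IsL2Limit P (invOUPartial P lam η f) fun ω => fockAdj hη
      (-numMul lam (fun n => (n : ℝ)⁻¹) abs_inv_natCast_le (fockIso hη hf2.toLp)) (η ω) :=
  isL2Limit_fockAdj hη (tendsto_numMul_invWeight _) (invOUPartial_ae_eq hη hf hf2)

/-- The inverse Ornstein–Uhlenbeck generator multiplies the kernel of degree `n ≥ 1` by `-1/n`, and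
annihilates degree `0`, where the weight is `0⁻¹ = 0`. -/
theorem invOU_ae_eq (hη : IsPoissonProcess P η lam) {f : Measure X → ℝ}
    (hf : Measurable f) (hf2 : MemLp f 2 (P.map η)) :
    invOU P lam η f =ᵐ[P] fun ω => fockAdj hη
      (-numMul lam (fun n => (n : ℝ)⁻¹) abs_inv_natCast_le (fockIso hη hf2.toLp)) (η ω) := by
  have h := isL2Limit_invOUPartial hη hf hf2
  exact h.l2Limit.ae_eq h fun k => (aestronglyMeasurable_fockAdj hη _).congr
    (invOUPartial_ae_eq hη hf hf2 k).symm

end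

section

variable {X : Type*} [MeasurableSpace X] {Ω : Type*} [MeasurableSpace Ω]

/-! ### The operators `P_s` on the Fock space -/

variable {lam : Measure X} [SigmaFinite lam] {P : Measure Ω} [IsProbabilityMeasure P]
  {η : Ω → Measure X}

/-- The conditional distribution, given `η`, of the thinning of `η` with added noise. -/
def condMehler (hη : IsPoissonProcess P η lam) (s : I) : Kernel Ω (Measure X) :=
  (mehlerKernel lam).comap (fun ω => (s, (⟨η ω, hη.isConfiguration ω⟩ : Conf X)))
    (measurable_const.prodMk hη.measurable_conf)

instance (hη : IsPoissonProcess P η lam) (s : I) : IsMarkovKernel (condMehler hη s) := by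
  unfold condMehler
  infer_instance

lemma condMehler_apply (hη : IsPoissonProcess P η lam) (s : I) (ω : Ω) :
    condMehler hη s ω = mehlerMeasure lam s (η ω) := rfl

/-- The joint distribution of `ω` and of the thinning of `η` with added noise. -/
def jointMehler (hη : IsPoissonProcess P η lam) (s : I) : Measure (Ω × Measure X) :=
  P ⊗ₘ condMehler hη s

lemma measurePreserving_snd_jointMehler (hη : IsPoissonProcess P η lam) (s : I) :
    MeasurePreserving Prod.snd (jointMehler hη s) (P.map η) := by
  refine ⟨measurable_snd, Measure.ext fun A hA => ?_⟩
  rw [Measure.map_apply measurable_snd hA, jointMehler, Measure.compProd_apply (measurable_snd hA)]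
  have h := lintegral_mehlerMeasure hη s (h := A.indicator 1) (measurable_one.indicator hA)
  rw [lintegral_indicator_one hA] at h
  rw [← h]
  refine lintegral_congr fun ω => ?_
  rw [lintegral_indicator_one hA]
  rfl

lemma measurePreserving_fst_jointMehler (hη : IsPoissonProcess P η lam) (s : I) :
    MeasurePreserving (fun z => η z.1) (jointMehler hη s) (P.map η) := by
  have h : (jointMehler hη s).map Prod.fst = P := Measure.fst_compProd P (condMehler hη s)
  exact (MeasurePreserving.mk hη.measurable rfl : MeasurePreserving η P (P.map η)).comp
    ⟨measurable_fst, h⟩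

lemma abs_pow_le_one (s : I) (n : ℕ) : |(s : ℝ) ^ n| ≤ 1 := by
  rw [abs_of_nonneg (pow_nonneg s.2.1 n)]
  exact pow_le_one₀ s.2.1 s.2.2

/-- On an exponential functional, thinning with added noise multiplies the kernel of degree `n` by
`s ^ n`. -/
lemma meanDiff_expFun_thin (hη : IsPoissonProcess P η lam) (s : I) {v : SimpleFunc X ℝ≥0}
    (hv : FinSupp lam v) (z : Fock X) :
    Real.exp (-((1 - s) * ∫ x, decay v x ∂lam)) * meanDiff P η (expFun (thin s v)) z
      = (s : ℝ) ^ z.1 * meanDiff P η (expFun v) z := by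
  rw [hη.meanDiff_expFun hv, hη.meanDiff_expFun (hv.thin s)]
  have h1 : ∏ j, -decay (thin s v) (z.2 j) = (s : ℝ) ^ z.1 * ∏ j, -decay v (z.2 j) := by
    simp_rw [decay_thin, ← mul_neg]
    rw [Finset.prod_mul_distrib, Finset.prod_const, Finset.card_univ, Fintype.card_fin]
  have h2 : Real.exp (-((1 - s) * ∫ x, decay v x ∂lam)) * Real.exp (-∫ x, decay (thin s v) x ∂lam)
      = Real.exp (-∫ x, decay v x ∂lam) := by
    simp_rw [decay_thin]
    rw [integral_const_mul, ← Real.exp_add]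
    congr 1
    ring
  rw [h1, ← mul_assoc, h2]
  ring

lemma integrable_jointMehler_mul (hη : IsPoissonProcess P η lam) (s : I) {f h : Measure X → ℝ}
    (hf2 : MemLp f 2 (P.map η)) (hh2 : MemLp h 2 (P.map η)) :
    Integrable (fun z : Ω × Measure X => f z.2 * h (η z.1)) (jointMehler hη s) :=
  (hf2.comp_measurePreserving (measurePreserving_snd_jointMehler hη s)).integrable_mul
    (hh2.comp_measurePreserving (measurePreserving_fst_jointMehler hη s))

lemma integral_jointMehler_expFun (hη : IsPoissonProcess P η lam) (s : I) {v w : SimpleFunc X ℝ≥0}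
    (hv : FinSupp lam v) (hw : FinSupp lam w) :
    ∫ z, expFun v z.2 * expFun w (η z.1) ∂(jointMehler hη s)
      = ∫ z, ((s : ℝ) ^ z.1 * meanDiff P η (expFun v) z) * meanDiff P η (expFun w) z
        ∂(fockMeasure lam) := by
  have hP := hη.isPoissonLaw.isProbabilityMeasure
  rw [jointMehler, Measure.integral_compProd
    (integrable_jointMehler_mul hη s (memLp_expFun _ v) (memLp_expFun _ w))]
  simp_rw [integral_mul_const, condMehler_apply,
    fun ω => integral_expFun_mehlerMeasure lam s (hη.isConfiguration ω) hv,
    ← meanDiff_expFun_thin hη s hv, mul_assoc]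
  rw [integral_const_mul, integral_const_mul, (hη.fock_isometry_expFun (hv.thin s) hw).2]

/-- The operator `P_s` multiplies the kernel of degree `n` by `s ^ n`. -/
lemma inner_jointMehler (hη : IsPoissonProcess P η lam) (s : I) (F G : Lp ℝ 2 (P.map η)) :
    inner ℝ (Lp.compMeasurePreservingₗᵢ ℝ _ (measurePreserving_snd_jointMehler hη s) F)
      (Lp.compMeasurePreservingₗᵢ ℝ _ (measurePreserving_fst_jointMehler hη s) G)
      = inner ℝ (numMul lam (fun n => (s : ℝ) ^ n) (abs_pow_le_one s) (fockIso hη F))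
        (fockIso hη G) := by
  have hP := hη.isPoissonLaw.isProbabilityMeasure
  let A := (Lp.compMeasurePreservingₗᵢ (E := ℝ) (p := 2) ℝ _
    (measurePreserving_snd_jointMehler hη s)).toContinuousLinearMap
  let B := (Lp.compMeasurePreservingₗᵢ (E := ℝ) (p := 2) ℝ _
    (measurePreserving_fst_jointMehler hη s)).toContinuousLinearMap
  let U := (fockIso hη).toContinuousLinearMap
  let M := numMul lam (fun n => (s : ℝ) ^ n) (abs_pow_le_one s)
  change inner ℝ (A F) (B G) = inner ℝ (M (U F)) (U G)
  have hexp : ∀ v, FinSupp lam v → ∀ w, FinSupp lam w →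
      inner ℝ (A (memLp_expFun (P.map η) v).toLp) (B (memLp_expFun (P.map η) w).toLp)
        = inner ℝ (M (U (memLp_expFun (P.map η) v).toLp)) (U (memLp_expFun (P.map η) w).toLp) := by
    intro v hv w hw
    have h1 := integral_jointMehler_expFun hη s hv hw
    rw [inner_eq_integral, inner_eq_integral]
    refine Eq.trans (integral_congr_ae ?_) (h1.trans (integral_congr_ae ?_))
    · have hA := Lp.coeFn_compMeasurePreserving (memLp_expFun (P.map η) v).toLp
        (measurePreserving_snd_jointMehler hη s)
      have hB := Lp.coeFn_compMeasurePreserving (memLp_expFun (P.map η) w).toLp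
        (measurePreserving_fst_jointMehler hη s)
      filter_upwards [hA, hB, (measurePreserving_snd_jointMehler hη s).quasiMeasurePreserving.ae
        (memLp_expFun (P.map η) v).coeFn_toLp,
        (measurePreserving_fst_jointMehler hη s).quasiMeasurePreserving.ae
        (memLp_expFun (P.map η) w).coeFn_toLp] with z h2 h3 h4 h5
      exact congrArg₂ (· * ·) (h2.trans h4) (h3.trans h5)
    · filter_upwards [coeFn_numMul _ (abs_pow_le_one s) (fockIso hη (memLp_expFun (P.map η) v).toLp),
        fockIso_toLp hη (measurable_expFun v) (memLp_expFun (P.map η) v),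
        fockIso_toLp hη (measurable_expFun w) (memLp_expFun (P.map η) w)] with z h2 h3 h4
      refine (congrArg₂ (· * ·) (h2.trans ?_) h4).symm
      rw [h3]
  -- Both sides are bilinear and continuous, and the exponential functionals are total.
  have h1 : ∀ v, FinSupp lam v → ∀ G : Lp ℝ 2 (P.map η),
      inner ℝ (A (memLp_expFun (P.map η) v).toLp) (B G)
        = inner ℝ (M (U (memLp_expFun (P.map η) v).toLp)) (U G) := by
    intro v hv G
    have := ContinuousLinearMap.ext_on (dense_span_expLp lam (P.map η))
      (f := (innerSL ℝ (A (memLp_expFun (P.map η) v).toLp)).comp B)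
      (g := (innerSL ℝ (M (U (memLp_expFun (P.map η) v).toLp))).comp U) (by
        rintro _ ⟨w, hw, rfl⟩
        exact hexp v hv w hw)
    exact DFunLike.congr_fun this G
  have h2 := ContinuousLinearMap.ext_on (dense_span_expLp lam (P.map η))
    (f := (innerSL ℝ (B G)).comp A) (g := (innerSL ℝ (U G)).comp (M.comp U)) (by
      rintro _ ⟨v, hv, rfl⟩
      have := h1 v hv G
      rw [real_inner_comm, real_inner_comm (U G)] at this
      exact this)
  have h3 := DFunLike.congr_fun h2 F
  rw [real_inner_comm, real_inner_comm (U G)]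
  exact h3

lemma ae_integrable_mehlerMeasure (hη : IsPoissonProcess P η lam) (s : I) {f : Measure X → ℝ}
    (hf : Measurable f) (hi : Integrable f (P.map η)) :
    ∀ᵐ ω ∂P, Integrable f (mehlerMeasure lam s (η ω)) := by
  have h := lintegral_mehlerMeasure hη s hf.enorm
  have hm : Measurable fun ω => ∫⁻ ξ, ‖f ξ‖ₑ ∂(condMehler hη s ω) := hf.enorm.lintegral_kernel
  have hlt : ∫⁻ ω, ∫⁻ ξ, ‖f ξ‖ₑ ∂(condMehler hη s ω) ∂P ≠ ∞ := by
    simp_rw [condMehler_apply]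
    rw [h]
    exact hi.2.ne
  filter_upwards [ae_lt_top hm hlt] with ω hω
  exact ⟨hf.aestronglyMeasurable, hω⟩

lemma measurable_mehlerOp_process {lam : Measure X} [SigmaFinite lam] {P : Measure Ω}
    {η : Ω → Measure X} (hη : IsPoissonProcess P η lam) {f : Measure X → ℝ}
    (hf : Measurable f) : Measurable fun z : I × Ω => mehlerOp lam z.1 f (η z.2) := by
  have h : Measurable ((fun z : I × Conf X => mehlerOp lam z.1 f (z.2 : Measure X)) ∘
      fun z : I × Ω => (z.1, (⟨η z.2, hη.isConfiguration z.2⟩ : Conf X))) :=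
    (measurable_mehlerOp lam hf).comp
      (measurable_fst.prodMk (hη.measurable_conf.comp measurable_snd))
  exact h

lemma measurable_mehlerOp_process_apply (hη : IsPoissonProcess P η lam) {f : Measure X → ℝ}
    (hf : Measurable f) (s : I) : Measurable fun ω => mehlerOp lam s f (η ω) := by
  have h : Measurable ((fun z : I × Ω => mehlerOp lam z.1 f (η z.2)) ∘ fun ω => (s, ω)) :=
    (measurable_mehlerOp_process hη hf).comp measurable_prodMk_left
  exact h

lemma measurable_mehlerOp_apply (lam : Measure X) [SigmaFinite lam] {f : Measure X → ℝ}
    (hf : Measurable f) (s : I) : Measurable fun μ : Conf X => mehlerOp lam s f (μ : Measure X) := by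
  have h : Measurable ((fun z : I × Conf X => mehlerOp lam z.1 f (z.2 : Measure X)) ∘
      fun μ => (s, μ)) := (measurable_mehlerOp lam hf).comp measurable_prodMk_left
  exact h

/-- The operator `P_s` as a quadratic form on `L²`: in the Fock space it is multiplication by `s ^
n` in degree `n`. -/
theorem integral_mehlerOp_mul (hη : IsPoissonProcess P η lam) (s : I) {f h : Measure X → ℝ}
    (hf : Measurable f) (hf2 : MemLp f 2 (P.map η)) (hh2 : MemLp h 2 (P.map η)) :
    ∫ ω, mehlerOp lam s f (η ω) * h (η ω) ∂P
      = inner ℝ (numMul lam (fun n => (s : ℝ) ^ n) (abs_pow_le_one s) (fockIso hη hf2.toLp))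
        (fockIso hη hh2.toLp) := by
  have hP := hη.isPoissonLaw.isProbabilityMeasure
  rw [← inner_jointMehler, inner_eq_integral]
  have h1 : ∫ ω, mehlerOp lam s f (η ω) * h (η ω) ∂P
      = ∫ z, f z.2 * h (η z.1) ∂(jointMehler hη s) := by
    rw [jointMehler, Measure.integral_compProd (integrable_jointMehler_mul hη s hf2 hh2)]
    refine integral_congr_ae ?_
    filter_upwards [ae_integrable_mehlerMeasure hη s hf (hf2.integrable (by norm_num))] with ω hω
    rw [integral_mul_const, mehlerOp_eq_integral lam hω]
    rfl
  rw [h1]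
  refine integral_congr_ae ?_
  filter_upwards [Lp.coeFn_compMeasurePreserving hf2.toLp (measurePreserving_snd_jointMehler hη s),
    Lp.coeFn_compMeasurePreserving hh2.toLp (measurePreserving_fst_jointMehler hη s),
    (measurePreserving_snd_jointMehler hη s).quasiMeasurePreserving.ae hf2.coeFn_toLp,
    (measurePreserving_fst_jointMehler hη s).quasiMeasurePreserving.ae hh2.coeFn_toLp]
    with z h2 h3 h4 h5
  exact (congrArg₂ (· * ·) (h2.trans h4) (h3.trans h5)).symm

/-! ### Contraction of centred functionals -/

lemma meanDiff_zero {P : Measure Ω} {η : Ω → Measure X} (f : Measure X → ℝ) (x : Fin 0 → X) :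
    meanDiff P η f ⟨0, x⟩ = ∫ ω, f (η ω) ∂P := by
  have h : ∀ ω, diffOp x f (η ω) = f (η ω) := fun ω => by
    rw [diffOp, Fintype.sum_subsingleton _ (∅ : Finset (Fin 0))]
    simp
  simp only [meanDiff, h]

lemma meanDiff_of_degree_zero {P : Measure Ω} {η : Ω → Measure X} {f : Measure X → ℝ}
    (h0 : ∫ ω, f (η ω) ∂P = 0) (z : Fock X) (hz : z.1 = 0) : meanDiff P η f z = 0 := by
  obtain ⟨n, x⟩ := z
  obtain rfl : n = 0 := hz
  rw [meanDiff_zero, h0]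

/-- A centred functional has no component of degree `0`, and `s ^ n ≤ s` in the other degrees. -/
lemma norm_numMul_pow_le (hη : IsPoissonProcess P η lam) (s : I) {f : Measure X → ℝ}
    (hf : Measurable f) (hf2 : MemLp f 2 (P.map η)) (h0 : ∫ ω, f (η ω) ∂P = 0) :
    ‖numMul lam (fun n => (s : ℝ) ^ n) (abs_pow_le_one s) (fockIso hη hf2.toLp)‖
      ≤ s * ‖hf2.toLp‖ := by
  rw [← (fockIso hη).norm_map hf2.toLp]
  refine Lp.norm_le_mul_norm_of_ae_le_mul ?_
  filter_upwards [coeFn_numMul _ (abs_pow_le_one s) (fockIso hη hf2.toLp),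
    fockIso_toLp hη hf hf2] with z h1 h2
  rw [h1, norm_mul, Real.norm_of_nonneg (pow_nonneg s.2.1 _), h2]
  rcases Nat.eq_zero_or_pos z.1 with hz | hz
  · simp [meanDiff_of_degree_zero h0 z hz]
  · gcongr
    exact pow_le_of_le_one s.2.1 s.2.2 hz.ne'

/-- On centred functionals, `P_s` has norm at most `s`; this makes `s⁻¹ P_s` integrable at `0`. -/
lemma lintegral_enorm_mehlerOp_le (hη : IsPoissonProcess P η lam) (s : I) {f : Measure X → ℝ}
    (hf : Measurable f) (hf2 : MemLp f 2 (P.map η)) (h0 : ∫ ω, f (η ω) ∂P = 0) :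
    ∫⁻ ω, ‖mehlerOp lam s f (η ω)‖ₑ ∂P ≤ ENNReal.ofReal (s * ‖hf2.toLp‖) := by
  have hP := hη.isPoissonLaw.isProbabilityMeasure
  obtain ⟨g, hg, hge⟩ := exists_measurable_extension (measurable_mehlerOp_apply lam hf s)
  -- Test `P_s f` against its sign.
  let h : Measure X → ℝ := fun μ => if 0 ≤ g μ then 1 else -1
  have hh : Measurable h :=
    Measurable.ite (measurableSet_le measurable_const hg) measurable_const measurable_const
  have hb : ∀ μ, ‖h μ‖ ≤ 1 := fun μ => by simp only [h]; split_ifs <;> simp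
  have hh2 : MemLp h 2 (P.map η) := MemLp.of_bound hh.aestronglyMeasurable 1 (ae_of_all _ hb)
  have h1 : ∀ ω, mehlerOp lam s f (η ω) * h (η ω) = ‖mehlerOp lam s f (η ω)‖ := by
    intro ω
    have h2 := hge ⟨η ω, hη.isConfiguration ω⟩
    simp only at h2
    simp only [h, h2]
    split_ifs with h3
    · rw [mul_one, Real.norm_of_nonneg h3]
    · rw [mul_neg_one, Real.norm_of_nonpos (not_le.1 h3).le]
  have hm := measurable_mehlerOp_process_apply hη hf s
  have hi : Integrable (fun ω => mehlerOp lam s f (η ω)) P := by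
    refine ⟨hm.aestronglyMeasurable, lt_of_le_of_lt
      (lintegral_mono fun ω => enorm_mehlerOp_le lam hf s (η ω)) ?_⟩
    rw [lintegral_mehlerMeasure hη s hf.enorm]
    exact (hf2.integrable (by norm_num)).2
  rw [← ofReal_integral_norm_eq_lintegral_enorm hi]
  refine ENNReal.ofReal_le_ofReal ?_
  rw [← integral_congr_ae (ae_of_all _ h1), integral_mehlerOp_mul hη s hf hf2 hh2]
  refine (real_inner_le_norm _ _).trans ?_
  have h4 : ‖fockIso hη hh2.toLp‖ ≤ 1 := by
    rw [(fockIso hη).norm_map, Lp.norm_toLp]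
    refine ENNReal.toReal_le_of_le_ofReal zero_le_one ?_
    refine (eLpNorm_le_of_ae_bound (ae_of_all _ hb)).trans ?_
    simp
  calc _ ≤ (s * ‖hf2.toLp‖) * 1 := mul_le_mul (norm_numMul_pow_le hη s hf hf2 h0) h4
        (norm_nonneg _) (mul_nonneg s.2.1 (norm_nonneg _))
    _ = _ := mul_one _

lemma integrable_inv_mul_mehlerOp (hη : IsPoissonProcess P η lam) {f : Measure X → ℝ}
    (hf : Measurable f) (hf2 : MemLp f 2 (P.map η)) (h0 : ∫ ω, f (η ω) ∂P = 0) :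
    Integrable (fun z : I × Ω => (z.1 : ℝ)⁻¹ * mehlerOp lam z.1 f (η z.2))
      ((volume : Measure I).prod P) := by
  have hs : Measurable fun z : I × Ω => (z.1 : ℝ)⁻¹ :=
    (measurable_subtype_coe.comp measurable_fst).inv
  have hm : Measurable fun z : I × Ω => (z.1 : ℝ)⁻¹ * mehlerOp lam z.1 f (η z.2) :=
    hs.mul (measurable_mehlerOp_process hη hf)
  refine ⟨hm.aestronglyMeasurable, ?_⟩
  rw [HasFiniteIntegral, lintegral_prod _ hm.enorm.aemeasurable]
  refine lt_of_le_of_lt (lintegral_mono fun s => ?_) (show ∫⁻ _ : I, ENNReal.ofReal ‖hf2.toLp‖ < ∞ by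
    simp)
  simp_rw [enorm_mul]
  rw [lintegral_const_mul _ (measurable_mehlerOp_process_apply hη hf s).enorm]
  refine (mul_le_mul_right (lintegral_enorm_mehlerOp_le hη s hf hf2 h0) _).trans ?_
  rw [Real.enorm_of_nonneg (inv_nonneg.2 s.2.1), ← ENNReal.ofReal_mul (inv_nonneg.2 s.2.1),
    ← mul_assoc]
  refine ENNReal.ofReal_le_ofReal (mul_le_of_le_one_left (norm_nonneg _) ?_)
  exact inv_mul_le_one

/-! ### Mehler's formula -/

lemma integral_inv_mul_pow (n : ℕ) (hn : n ≠ 0) :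
    ∫ s : I, (s : ℝ)⁻¹ * (s : ℝ) ^ n = (n : ℝ)⁻¹ := by
  obtain ⟨m, rfl⟩ := Nat.exists_eq_succ_of_ne_zero hn
  rw [integral_subtype measurableSet_Icc fun s : ℝ => s⁻¹ * s ^ (m + 1),
    integral_Icc_eq_integral_Ioc]
  have h1 : ∫ s in Set.Ioc (0 : ℝ) 1, s⁻¹ * s ^ (m + 1) = ∫ s in Set.Ioc (0 : ℝ) 1, s ^ m := by
    refine setIntegral_congr_fun measurableSet_Ioc fun s hs => ?_
    have : s ≠ 0 := hs.1.ne'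
    rw [pow_succ]
    field_simp
  rw [h1, ← intervalIntegral.integral_of_le zero_le_one, integral_pow]
  simp

/-- The integral `-∫ s⁻¹ P_s f ds`, as a functional of the configuration. -/
def mehlerIntegral (lam : Measure X) [SFinite lam] (f : Measure X → ℝ) (μ : Measure X) : ℝ :=
  -∫ s : I, (s : ℝ)⁻¹ * mehlerOp lam s f μ

lemma measurable_mehlerIntegral (lam : Measure X) [SigmaFinite lam] {f : Measure X → ℝ}
    (hf : Measurable f) : Measurable fun μ : Conf X => mehlerIntegral lam f (μ : Measure X) := by
  have hs : Measurable fun z : Conf X × I => (z.2 : ℝ)⁻¹ :=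
    (measurable_subtype_coe.comp measurable_snd).inv
  have hm : Measurable fun z : Conf X × I => (z.2 : ℝ)⁻¹ * mehlerOp lam z.2 f (z.1 : Measure X) :=
    hs.mul (show Measurable ((fun z : I × Conf X => mehlerOp lam z.1 f (z.2 : Measure X)) ∘
      fun z : Conf X × I => (z.2, z.1)) from (measurable_mehlerOp lam hf).comp measurable_swap)
  exact hm.stronglyMeasurable.integral_prod_right'.measurable.neg

lemma abs_inv_mul_pow_le (s : I) {n : ℕ} (hn : n ≠ 0) : |(s : ℝ)⁻¹ * (s : ℝ) ^ n| ≤ 1 := by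
  obtain ⟨m, rfl⟩ := Nat.exists_eq_succ_of_ne_zero hn
  rw [abs_of_nonneg (mul_nonneg (inv_nonneg.2 s.2.1) (pow_nonneg s.2.1 _)), Nat.succ_eq_add_one,
    pow_succ', ← mul_assoc]
  exact mul_le_one₀ inv_mul_le_one (pow_nonneg s.2.1 _) (pow_le_one₀ s.2.1 s.2.2)

/-- Mehler's formula, tested against an exponential functional: the integral `∫₀¹ s⁻¹ s ^ n ds` is
`1 / n`. -/
lemma integral_mehlerIntegral_mul_expFun (hη : IsPoissonProcess P η lam) {f : Measure X → ℝ}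
    (hf : Measurable f) (hf2 : MemLp f 2 (P.map η)) (h0 : ∫ ω, f (η ω) ∂P = 0)
    (v : SimpleFunc X ℝ≥0) :
    ∫ ω, mehlerIntegral lam f (η ω) * expFun v (η ω) ∂P
      = -∫ z, ((z.1 : ℝ)⁻¹ * meanDiff P η f z) * meanDiff P η (expFun v) z ∂(fockMeasure lam) := by
  have hP := hη.isPoissonLaw.isProbabilityMeasure
  have hvη : Measurable fun ω => expFun v (η ω) := (measurable_expFun v).comp hη.measurable
  have hi := integrable_inv_mul_mehlerOp hη hf hf2 h0
  have hi2 : Integrable (fun z : I × Ω => (z.1 : ℝ)⁻¹ * mehlerOp lam z.1 f (η z.2) *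
      expFun v (η z.2)) ((volume : Measure I).prod P) :=
    hi.mul_bdd (hvη.comp measurable_snd).aestronglyMeasurable
      (ae_of_all _ fun z => abs_expFun_le_one v _)
  have hT := hη.memLp_meanDiff hf hf2
  have hTv := hη.memLp_meanDiff (measurable_expFun v) (memLp_expFun (P.map η) v)
  have h1 : ∀ s : I, ∫ ω, mehlerOp lam s f (η ω) * expFun v (η ω) ∂P
      = ∫ z, ((s : ℝ) ^ z.1 * meanDiff P η f z) * meanDiff P η (expFun v) z ∂(fockMeasure lam) := by
    intro s
    rw [integral_mehlerOp_mul hη s hf hf2 (memLp_expFun (P.map η) v), inner_eq_integral]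
    refine integral_congr_ae ?_
    filter_upwards [coeFn_numMul _ (abs_pow_le_one s) (fockIso hη hf2.toLp),
      fockIso_toLp hη hf hf2,
      fockIso_toLp hη (measurable_expFun v) (memLp_expFun (P.map η) v)] with z h2 h3 h4
    rw [h2, h3, h4]
  -- Dominated by the product of the kernels: `s⁻¹ s ^ n ≤ 1` for `n ≥ 1`, and the kernel of the
  -- centred functional `f` vanishes in degree `0`.
  have hK : Integrable (fun p : I × Fock X => ((p.1 : ℝ)⁻¹ * (p.1 : ℝ) ^ p.2.1) *
      (meanDiff P η f p.2 * meanDiff P η (expFun v) p.2))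
      ((volume : Measure I).prod (fockMeasure lam)) := by
    have hmw : Measurable fun p : I × Fock X => (p.1 : ℝ)⁻¹ * (p.1 : ℝ) ^ p.2.1 := by
      have h5 : Measurable fun p : I × Fock X => (p.1 : ℝ) :=
        measurable_subtype_coe.comp measurable_fst
      have h6 : Measurable fun p : I × Fock X => p.2.1 :=
        (measurable_fock fun n => (measurable_const : Measurable fun _ : Fin n → X => n)).comp
          measurable_snd
      exact h5.inv.mul (h5.pow h6)
    have h7 := (hT.integrable_mul hTv).comp_snd (volume : Measure I)
    refine h7.mono (hmw.aestronglyMeasurable.mul h7.1) (ae_of_all _ fun p => ?_)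
    rw [norm_mul]
    by_cases hn : p.2.1 = 0
    · have := meanDiff_of_degree_zero h0 p.2 hn
      simp [this]
    · exact mul_le_of_le_one_left (norm_nonneg _) (abs_inv_mul_pow_le p.1 hn)
  calc ∫ ω, mehlerIntegral lam f (η ω) * expFun v (η ω) ∂P
      = -∫ ω, (∫ s : I, (s : ℝ)⁻¹ * mehlerOp lam s f (η ω) * expFun v (η ω)) ∂P := by
        rw [← integral_neg]
        refine integral_congr_ae (ae_of_all _ fun ω => ?_)
        simp only [mehlerIntegral, neg_mul]
        rw [integral_mul_const]
    _ = -∫ s : I, ∫ ω, (s : ℝ)⁻¹ * mehlerOp lam s f (η ω) * expFun v (η ω) ∂P := by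
        rw [integral_integral_swap (f := fun (s : I) ω =>
          (s : ℝ)⁻¹ * mehlerOp lam s f (η ω) * expFun v (η ω)) hi2]
    _ = -∫ s : I, ∫ z, ((s : ℝ)⁻¹ * (s : ℝ) ^ z.1) *
          (meanDiff P η f z * meanDiff P η (expFun v) z) ∂(fockMeasure lam) := by
        congr 1
        refine integral_congr_ae (ae_of_all _ fun s => ?_)
        simp only [mul_assoc]
        rw [integral_const_mul, h1, ← integral_const_mul]
        simp only [mul_assoc]
    _ = -∫ z, (∫ s : I, ((s : ℝ)⁻¹ * (s : ℝ) ^ z.1) *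
          (meanDiff P η f z * meanDiff P η (expFun v) z)) ∂(fockMeasure lam) := by
        rw [integral_integral_swap (f := fun (s : I) (z : Fock X) => ((s : ℝ)⁻¹ * (s : ℝ) ^ z.1) *
          (meanDiff P η f z * meanDiff P η (expFun v) z)) hK]
    _ = _ := by
        congr 1
        refine integral_congr_ae (ae_of_all _ fun z => ?_)
        simp only
        rw [integral_mul_const]
        by_cases hn : z.1 = 0
        · simp [meanDiff_of_degree_zero h0 z hn]
        · rw [integral_inv_mul_pow _ hn, mul_assoc]

/-- Mehler's formula. -/
theorem invOU_ae_eq_mehlerIntegral (hη : IsPoissonProcess P η lam) {f : Measure X → ℝ}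
    (hf : Measurable f) (hf2 : MemLp f 2 (P.map η)) (h0 : ∫ ω, f (η ω) ∂P = 0) :
    invOU P lam η f =ᵐ[P] fun ω => mehlerIntegral lam f (η ω) := by
  obtain ⟨g, hg, hge⟩ := exists_measurable_extension (measurable_mehlerIntegral lam hf)
  have hge' : ∀ ω, g (η ω) = mehlerIntegral lam f (η ω) := fun ω => hge ⟨η ω, hη.isConfiguration ω⟩
  have hgi : Integrable g (P.map η) := by
    rw [integrable_map_measure hg.aestronglyMeasurable hη.measurable.aemeasurable]
    have := (integrable_inv_mul_mehlerOp hη hf hf2 h0).integral_prod_right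
    refine this.neg.congr (ae_of_all _ fun ω => ?_)
    exact (hge' ω).symm
  set W := -numMul lam (fun n => (n : ℝ)⁻¹) abs_inv_natCast_le (fockIso hη hf2.toLp) with hW
  have hWz : ∀ᵐ z ∂(fockMeasure lam), W z = -((z.1 : ℝ)⁻¹ * meanDiff P η f z) := by
    filter_upwards [Lp.coeFn_neg (numMul lam (fun n => (n : ℝ)⁻¹) abs_inv_natCast_le
      (fockIso hη hf2.toLp)), coeFn_numMul (fun n => (n : ℝ)⁻¹) abs_inv_natCast_le
      (fockIso hη hf2.toLp), fockIso_toLp hη hf hf2] with z h1 h2 h3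
    rw [hW, h1, Pi.neg_apply, h2, h3]
  have h1 : g =ᵐ[P.map η] fockAdj hη W := by
    refine ae_eq_fockAdj hη W hgi fun v hv => ?_
    rw [integral_map (f := fun μ => g μ * expFun v μ) hη.measurable.aemeasurable
      (hg.mul (measurable_expFun v)).aestronglyMeasurable]
    simp_rw [hge']
    rw [integral_mehlerIntegral_mul_expFun hη hf hf2 h0 v, ← integral_neg]
    refine integral_congr_ae ?_
    filter_upwards [hWz] with z hz
    rw [hz, neg_mul]
  filter_upwards [invOU_ae_eq hη hf hf2, ae_of_ae_map hη.measurable.aemeasurable h1] with ω h2 h3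
  rw [h2, ← h3, hge']

end

section

variable {X : Type*} [MeasurableSpace X] {Ω : Type*} [MeasurableSpace Ω]

/-! ### First and second order differences -/

lemma diffOp_one (x : X) (f : Measure X → ℝ) (μ : Measure X) :
    diffOp ![x] f μ = f (μ + Measure.dirac x) - f μ := by
  have h : (Finset.univ : Finset (Finset (Fin 1))) = {∅, {0}} := by decide
  rw [diffOp, h, Finset.sum_pair (by decide)]
  simp
  ring

lemma diffOp_two (x y : X) (f : Measure X → ℝ) (μ : Measure X) :
    diffOp ![x, y] f μ = diffOp ![y] (diffOp ![x] f) μ := by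
  have h : (Finset.univ : Finset (Finset (Fin 2))) = {∅, {0}, {1}, {0, 1}} := by decide
  rw [diffOp, h, Finset.sum_insert (by decide), Finset.sum_insert (by decide),
    Finset.sum_pair (by decide), Finset.sum_pair (by decide)]
  simp only [diffOp_one, Finset.card_empty, Finset.card_singleton, Finset.sum_empty,
    Finset.sum_singleton, Finset.card_pair (show (0 : Fin 2) ≠ 1 by decide), Matrix.cons_val_zero,
    Matrix.cons_val_one, add_zero, add_right_comm μ (Measure.dirac y) (Measure.dirac x),
    ← add_assoc]
  norm_num
  ring

lemma diffOp_two_eq (x y : X) (f : Measure X → ℝ) :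
    diffOp ![x, y] f = diffOp ![y] (diffOp ![x] f) :=
  funext fun μ => diffOp_two x y f μ

lemma measurable_diffOp_apply {n : ℕ} {f : Measure X → ℝ} (hf : Measurable f) (x : Fin n → X) :
    Measurable (diffOp x f) := by
  have h : Measurable ((fun z : (Fin n → X) × Measure X => diffOp z.1 f z.2) ∘ fun μ => (x, μ)) :=
    (measurable_diffOp hf).comp measurable_prodMk_left
  exact h

lemma diffOp_const {n : ℕ} (hn : n ≠ 0) (x : Fin n → X) (c : ℝ) (μ : Measure X) :
    diffOp x (fun _ => c) μ = 0 := by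
  have h := Fin.sum_pow_mul_eq_add_pow (n := n) (1 : ℝ) (-1)
  simp only [one_pow, one_mul, add_neg_cancel, zero_pow hn] at h
  rw [diffOp, ← Finset.sum_mul, h, zero_mul]

lemma diffOp_sub_const {n : ℕ} (hn : n ≠ 0) (x : Fin n → X) (f : Measure X → ℝ) (c : ℝ) :
    diffOp x (fun μ => f μ - c) = diffOp x f := by
  funext μ
  have := diffOp_sub x f (fun _ => c) μ
  rw [diffOp_const hn, sub_zero] at this
  exact this

/-! ### Adding points to a Poisson process -/

variable {lam : Measure X} [SigmaFinite lam] {P : Measure Ω} [IsProbabilityMeasure P]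
  {η : Ω → Measure X}

/-- Transfer of an almost sure property to the law of `η`, for properties that are measurable on the
configuration space only, which need not be a measurable subset of the space of measures. -/
lemma IsPoissonProcess.ae_map_of_ae {lam : Measure X} {P : Measure Ω} {η : Ω → Measure X}
    (hη : IsPoissonProcess P η lam) {p : Measure X → Prop}
    (hp : MeasurableSet {μ : Conf X | p μ}) (h : ∀ᵐ ω ∂P, p (η ω)) :
    ∀ᵐ μ ∂(P.map η), IsConfiguration μ → p μ := by
  obtain ⟨t, ht, hte⟩ := hp
  have hiff : ∀ μ, IsConfiguration μ → (μ ∈ t ↔ p μ) := fun μ hμ =>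
    Set.ext_iff.1 hte (⟨μ, hμ⟩ : Conf X)
  have h1 : ∀ᵐ μ ∂(P.map η), μ ∈ t := by
    refine (ae_map_iff hη.measurable.aemeasurable (p := fun μ => μ ∈ t) ht).2 ?_
    filter_upwards [h] with ω hω
    exact (hiff _ (hη.isConfiguration ω)).2 hω
  filter_upwards [h1] with μ hμ hc
  exact (hiff μ hc).1 hμ

lemma IsPoissonProcess.quasiMeasurePreserving_add_dirac (hη : IsPoissonProcess P η lam) :
    Measure.QuasiMeasurePreserving (fun z : Ω × X => η z.1 + Measure.dirac z.2)
      (P.prod lam) (P.map η) := by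
  have hP := hη.isPoissonLaw.isProbabilityMeasure
  have h : MeasurePreserving η P (P.map η) := ⟨hη.measurable, rfl⟩
  exact hη.isPoissonLaw.quasiMeasurePreserving_add_dirac.comp
    (h.prod (MeasurePreserving.id lam)).quasiMeasurePreserving

/-- Null sets of the law of `η` stay null after adding two points; hence second differences do not
depend on the representative. -/
lemma IsPoissonProcess.quasiMeasurePreserving_add_dirac_add_dirac (hη : IsPoissonProcess P η lam) :
    Measure.QuasiMeasurePreserving
      (fun z : Ω × X × X => η z.1 + Measure.dirac z.2.1 + Measure.dirac z.2.2)
      (P.prod (lam.prod lam)) (P.map η) := by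
  have hP := hη.isPoissonLaw.isProbabilityMeasure
  have h1 := (measurePreserving_prodAssoc P lam lam).symm
  have h2 := QuasiMeasurePreserving.prodMap hη.quasiMeasurePreserving_add_dirac
    (MeasurePreserving.id lam).quasiMeasurePreserving
  exact (hη.isPoissonLaw.quasiMeasurePreserving_add_dirac.comp h2).comp h1.quasiMeasurePreserving

lemma IsPoissonProcess.ae_add_dirac (hη : IsPoissonProcess P η lam) {p : Measure X → Prop}
    (h : ∀ᵐ μ ∂(P.map η), IsConfiguration μ → p μ) :
    ∀ᵐ z ∂(P.prod lam), p (η z.1) ∧ p (η z.1 + Measure.dirac z.2) := by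
  have h1 : ∀ᵐ ω ∂P, p (η ω) := by
    filter_upwards [ae_of_ae_map hη.measurable.aemeasurable h] with ω hω
    exact hω (hη.isConfiguration ω)
  filter_upwards [Measure.quasiMeasurePreserving_fst.ae h1,
    hη.quasiMeasurePreserving_add_dirac.ae h] with z h2 h3
  exact ⟨h2, h3 ((hη.isConfiguration _).add_dirac _)⟩

lemma IsPoissonProcess.ae_add_dirac_add_dirac (hη : IsPoissonProcess P η lam)
    {p : Measure X → Prop} (h : ∀ᵐ μ ∂(P.map η), IsConfiguration μ → p μ) :
    ∀ᵐ z ∂(P.prod (lam.prod lam)), p (η z.1) ∧ p (η z.1 + Measure.dirac z.2.1) ∧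
      p (η z.1 + Measure.dirac z.2.2) ∧
      p (η z.1 + Measure.dirac z.2.1 + Measure.dirac z.2.2) := by
  have h1 := hη.ae_add_dirac h
  have hfst := (QuasiMeasurePreserving.prodMap (MeasurePreserving.id P).quasiMeasurePreserving
    (Measure.quasiMeasurePreserving_fst (μ := lam) (ν := lam))).ae h1
  have hsnd := (QuasiMeasurePreserving.prodMap (MeasurePreserving.id P).quasiMeasurePreserving
    (Measure.quasiMeasurePreserving_snd (μ := lam) (ν := lam))).ae h1
  filter_upwards [hfst, hsnd, hη.quasiMeasurePreserving_add_dirac_add_dirac.ae h] with z h2 h3 h4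
  exact ⟨h2.1, h2.2, h3.2, h4 (((hη.isConfiguration _).add_dirac _).add_dirac _)⟩

/-! ### Commutation of `P_s` with differences -/

/-- Integrability with respect to the law after adding `x` controls the shifted functional. -/
lemma integrable_diffOp_mehlerMeasure {s : I} (hs : (s : ℝ) ≠ 0) {f : Measure X → ℝ}
    (hf : Measurable f) {μ : Measure X} (hμ : IsConfiguration μ) {x : X}
    (h0 : Integrable f (mehlerMeasure lam s μ))
    (h1 : Integrable f (mehlerMeasure lam s (μ + Measure.dirac x))) :
    Integrable (diffOp ![x] f) (mehlerMeasure lam s μ) ∧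
      diffOp ![x] (mehlerOp lam s f) μ = s * mehlerOp lam s (diffOp ![x] f) μ := by
  have hmx : Measurable fun ξ : Measure X => ξ + Measure.dirac x := measurable_id.add_const _
  have hs0 : 0 < (s : ℝ) := lt_of_le_of_ne s.2.1 hs.symm
  have h2 := h1
  rw [mehlerMeasure_add_dirac lam s hμ x, integrable_add_measure] at h2
  have h3 : Integrable f ((mehlerMeasure lam s μ).map fun ξ => ξ + Measure.dirac x) := by
    refine (integrable_smul_measure ?_ ENNReal.ofReal_ne_top).1 h2.1
    simpa using hs0
  have h4 : Integrable (fun ξ => f (ξ + Measure.dirac x)) (mehlerMeasure lam s μ) :=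
    (integrable_map_measure hf.aestronglyMeasurable hmx.aemeasurable).1 h3
  have hd : diffOp ![x] f = fun ξ => f (ξ + Measure.dirac x) - f ξ :=
    funext fun ξ => diffOp_one x f ξ
  have hi : Integrable (diffOp ![x] f) (mehlerMeasure lam s μ) := hd ▸ h4.sub h0
  refine ⟨hi, ?_⟩
  rw [diffOp_one, mehlerOp_eq_integral lam h0, mehlerOp_eq_integral lam h1,
    mehlerOp_eq_integral lam hi, mehlerMeasure_add_dirac lam s hμ x,
    integral_add_measure h2.1 h2.2, integral_smul_measure, integral_smul_measure,
    integral_map hmx.aemeasurable hf.aestronglyMeasurable, hd, integral_sub h4 h0,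
    ENNReal.toReal_ofReal s.2.1, ENNReal.toReal_ofReal (by linarith [s.2.2])]
  simp only [smul_eq_mul]
  ring

/-- The configurations at which the integrals in Mehler's formula converge absolutely. -/
structure IsMehlerRegular (lam : Measure X) [SFinite lam] (f : Measure X → ℝ) (μ : Measure X) :
    Prop where
  ae_integrable : ∀ᵐ s : I, Integrable f (mehlerMeasure lam s μ)
  integrable : Integrable fun s : I => (s : ℝ)⁻¹ * mehlerOp lam s f μ

lemma ae_unitInterval_ne_zero : ∀ᵐ s : I, (s : ℝ) ≠ 0 := by
  have h1 : ∀ᵐ s : I, s ∉ ({0} : Set I) :=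
    measure_eq_zero_iff_ae_notMem.1 (measure_singleton (0 : I))
  filter_upwards [h1] with s hs h2
  exact hs (Subtype.ext h2)

/-- The factor `s` from `D_x P_s = s P_s D_x` cancels the factor `s⁻¹` in Mehler's formula. -/
lemma diffOp_one_mehlerIntegral {f : Measure X → ℝ} (hf : Measurable f) {μ : Measure X}
    (hμ : IsConfiguration μ) {x : X} (h0 : IsMehlerRegular lam f μ)
    (h1 : IsMehlerRegular lam f (μ + Measure.dirac x)) :
    Integrable (fun s : I => mehlerOp lam s (diffOp ![x] f) μ) ∧
      -diffOp ![x] (mehlerIntegral lam f) μ = ∫ s : I, mehlerOp lam s (diffOp ![x] f) μ := by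
  have he : (fun s : I => (s : ℝ)⁻¹ * mehlerOp lam s f (μ + Measure.dirac x)
      - (s : ℝ)⁻¹ * mehlerOp lam s f μ) =ᵐ[volume] fun s => mehlerOp lam s (diffOp ![x] f) μ := by
    filter_upwards [h0.ae_integrable, h1.ae_integrable, ae_unitInterval_ne_zero] with s h2 h3 hs
    have h4 := (integrable_diffOp_mehlerMeasure hs hf hμ h2 h3).2
    rw [diffOp_one] at h4
    rw [← mul_sub, h4, inv_mul_cancel_left₀ hs]
  refine ⟨(h1.integrable.sub h0.integrable).congr he, ?_⟩
  rw [diffOp_one, mehlerIntegral, mehlerIntegral, ← integral_congr_ae he,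
    integral_sub h1.integrable h0.integrable]
  ring

/-- The difference in `y` of the formula for first differences; the second commutation contributes a
factor `s` that is no longer cancelled. -/
lemma diffOp_two_mehlerIntegral {f : Measure X → ℝ} (hf : Measurable f) {μ : Measure X}
    (hμ : IsConfiguration μ) {x y : X} (h0 : IsMehlerRegular lam f μ)
    (hx : IsMehlerRegular lam f (μ + Measure.dirac x))
    (hy : IsMehlerRegular lam f (μ + Measure.dirac y))
    (hxy : IsMehlerRegular lam f (μ + Measure.dirac x + Measure.dirac y)) :
    Integrable (fun s : I => (s : ℝ) * mehlerOp lam s (diffOp ![x, y] f) μ) ∧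
      -diffOp ![x, y] (mehlerIntegral lam f) μ
        = ∫ s : I, (s : ℝ) * mehlerOp lam s (diffOp ![x, y] f) μ := by
  rw [add_right_comm] at hxy
  have h1 := diffOp_one_mehlerIntegral hf hμ h0 hx
  have h2 := diffOp_one_mehlerIntegral hf (hμ.add_dirac y) hy hxy
  have he : (fun s : I => mehlerOp lam s (diffOp ![x] f) (μ + Measure.dirac y)
      - mehlerOp lam s (diffOp ![x] f) μ) =ᵐ[volume]
      fun s => (s : ℝ) * mehlerOp lam s (diffOp ![x, y] f) μ := by
    filter_upwards [h0.ae_integrable, hx.ae_integrable, hy.ae_integrable, hxy.ae_integrable,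
      ae_unitInterval_ne_zero] with s i0 ix iy ixy hs
    have h4 := integrable_diffOp_mehlerMeasure hs (measurable_diffOp_apply hf ![x]) hμ
      (integrable_diffOp_mehlerMeasure hs hf hμ i0 ix).1
      (integrable_diffOp_mehlerMeasure hs hf (hμ.add_dirac y) iy ixy).1
    rw [diffOp_two_eq, ← h4.2, diffOp_one]
  refine ⟨(h2.1.sub h1.1).congr he, ?_⟩
  rw [diffOp_two, diffOp_one, ← integral_congr_ae he, integral_sub h2.1 h1.1, ← h1.2, ← h2.2]
  ring

/-! ### Differences of the inverse Ornstein–Uhlenbeck generator -/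

/-- The law of `η` is also invariant under the mixture of the operators `P_s` over `s`. -/
lemma lintegral_lintegral_mehlerMeasure (hη : IsPoissonProcess P η lam) {h : Measure X → ℝ≥0∞}
    (hh : Measurable h) :
    ∫⁻ ω, (∫⁻ s : I, ∫⁻ ξ, h ξ ∂(mehlerMeasure lam s (η ω))) ∂P = ∫⁻ ω, h (η ω) ∂P := by
  have hm : Measurable fun z : I × Conf X => ∫⁻ ξ, h ξ ∂(mehlerKernel lam z) := hh.lintegral_kernel
  have hm2 : Measurable ((fun z : I × Conf X => ∫⁻ ξ, h ξ ∂(mehlerKernel lam z)) ∘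
      fun z : Ω × I => (z.2, (⟨η z.1, hη.isConfiguration z.1⟩ : Conf X))) :=
    hm.comp (measurable_snd.prodMk (hη.measurable_conf.comp measurable_fst))
  have h1 := lintegral_lintegral_swap (μ := P) (ν := (volume : Measure I))
    (f := fun ω s => ∫⁻ ξ, h ξ ∂(mehlerMeasure lam s (η ω))) hm2.aemeasurable
  rw [h1]
  simp_rw [fun s => lintegral_mehlerMeasure hη s hh]
  rw [lintegral_const, measure_univ, mul_one, lintegral_map hh hη.measurable]

/-- For the law of `η`, almost every configuration is regular and satisfies Mehler's formula. Stated
for the law and not for `η`, this can be transported to `η + δ_x` and `η + δ_x + δ_y`. -/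
lemma IsPoissonProcess.ae_isMehlerRegular (hη : IsPoissonProcess P η lam) {f g : Measure X → ℝ}
    (hf : Measurable f) (hf2 : MemLp f 2 (P.map η)) (h0 : ∫ ω, f (η ω) ∂P = 0)
    (hg : IsRepresentative P η g (invOU P lam η f)) :
    ∀ᵐ μ ∂(P.map η), IsConfiguration μ →
      IsMehlerRegular lam f μ ∧ g μ = mehlerIntegral lam f μ := by
  have hP := hη.isPoissonLaw.isProbabilityMeasure
  have hK : Measurable fun z : Conf X × I => ∫⁻ ξ, ‖f ξ‖ₑ ∂(mehlerMeasure lam z.2 (z.1 : Measure X)) := by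
    have hm : Measurable ((fun z : I × Conf X => ∫⁻ ξ, ‖f ξ‖ₑ ∂(mehlerKernel lam z)) ∘
        fun z : Conf X × I => (z.2, z.1)) := hf.enorm.lintegral_kernel.comp measurable_swap
    exact hm
  have hO : Measurable fun z : Conf X × I => (z.2 : ℝ)⁻¹ * mehlerOp lam z.2 f (z.1 : Measure X) := by
    have hm : Measurable ((fun z : I × Conf X => mehlerOp lam z.1 f (z.2 : Measure X)) ∘
      fun z : Conf X × I => (z.2, z.1)) := (measurable_mehlerOp lam hf).comp measurable_swap
    exact ((measurable_subtype_coe.comp measurable_snd).inv).mul hm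
  let p : Measure X → Prop := fun μ =>
    ((∫⁻ s : I, ∫⁻ ξ, ‖f ξ‖ₑ ∂(mehlerMeasure lam s μ)) < ∞ ∧
      (∫⁻ s : I, ‖(s : ℝ)⁻¹ * mehlerOp lam s f μ‖ₑ) < ∞) ∧ g μ = mehlerIntegral lam f μ
  have hp : MeasurableSet {μ : Conf X | p μ} :=
    ((measurableSet_lt hK.lintegral_prod_right' measurable_const).inter
      (measurableSet_lt hO.enorm.lintegral_prod_right' measurable_const)).inter
      (measurableSet_eq_fun (hg.measurable.comp measurable_subtype_coe)
        (measurable_mehlerIntegral lam hf))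
  have h1 : ∀ᵐ ω ∂P, (∫⁻ s : I, ∫⁻ ξ, ‖f ξ‖ₑ ∂(mehlerMeasure lam s (η ω))) < ∞ := by
    have hm : Measurable ((fun μ : Conf X => ∫⁻ s : I, ∫⁻ ξ, ‖f ξ‖ₑ ∂(mehlerMeasure lam s (μ : Measure X)))
        ∘ fun ω => (⟨η ω, hη.isConfiguration ω⟩ : Conf X)) :=
      hK.lintegral_prod_right'.comp hη.measurable_conf
    refine ae_lt_top hm ?_
    refine ne_of_eq_of_ne (lintegral_lintegral_mehlerMeasure hη hf.enorm) ?_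
    rw [← lintegral_map hf.enorm hη.measurable]
    exact (hf2.integrable (by norm_num)).2.ne
  have h2 : ∀ᵐ ω ∂P, p (η ω) := by
    filter_upwards [h1, (integrable_inv_mul_mehlerOp hη hf hf2 h0).prod_left_ae, hg.ae_eq,
      invOU_ae_eq_mehlerIntegral hη hf hf2 h0] with ω i1 i2 i3 i4
    exact ⟨⟨i1, i2.2⟩, i3.symm.trans i4⟩
  filter_upwards [hη.ae_map_of_ae hp h2] with μ hμ hc
  obtain ⟨⟨i1, i2⟩, i3⟩ := hμ hc
  refine ⟨⟨?_, ?_, i2⟩, i3⟩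
  · have hKm : Measurable ((fun z : Conf X × I => ∫⁻ ξ, ‖f ξ‖ₑ ∂(mehlerMeasure lam z.2 (z.1 : Measure X)))
        ∘ fun s => ((⟨μ, hc⟩ : Conf X), s)) := hK.comp measurable_prodMk_left
    filter_upwards [ae_lt_top hKm i1.ne] with s hs
    exact ⟨hf.aestronglyMeasurable, hs⟩
  · have hOm : Measurable ((fun z : Conf X × I => (z.2 : ℝ)⁻¹ * mehlerOp lam z.2 f (z.1 : Measure X))
        ∘ fun s => ((⟨μ, hc⟩ : Conf X), s)) := hO.comp measurable_prodMk_left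
    exact hOm.aestronglyMeasurable

/-- First differences of `L⁻¹ f(η)`, for an arbitrary representative `g` of `L⁻¹ f(η)`. -/
theorem ae_diffOp_one_invOU (hη : IsPoissonProcess P η lam) {f g : Measure X → ℝ}
    (hf : Measurable f) (hf2 : MemLp f 2 (P.map η)) (h0 : ∫ ω, f (η ω) ∂P = 0)
    (hg : IsRepresentative P η g (invOU P lam η f)) :
    ∀ᵐ z ∂(P.prod lam), Integrable (fun s : I => mehlerOp lam s (diffOp ![z.2] f) (η z.1)) ∧
      -diffOp ![z.2] g (η z.1) = ∫ s : I, mehlerOp lam s (diffOp ![z.2] f) (η z.1) := by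
  filter_upwards [hη.ae_add_dirac (hη.ae_isMehlerRegular hf hf2 h0 hg)] with z hz
  have h := diffOp_one_mehlerIntegral hf (hη.isConfiguration z.1) hz.1.1 hz.2.1
  refine ⟨h.1, ?_⟩
  rw [← h.2, diffOp_one, diffOp_one, hz.1.2, hz.2.2]

/-- Second differences of `L⁻¹ f(η)`, for an arbitrary representative `g` of `L⁻¹ f(η)`. -/
theorem ae_diffOp_two_invOU (hη : IsPoissonProcess P η lam) {f g : Measure X → ℝ}
    (hf : Measurable f) (hf2 : MemLp f 2 (P.map η)) (h0 : ∫ ω, f (η ω) ∂P = 0)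
    (hg : IsRepresentative P η g (invOU P lam η f)) :
    ∀ᵐ z ∂(P.prod (lam.prod lam)),
      Integrable (fun s : I => (s : ℝ) * mehlerOp lam s (diffOp ![z.2.1, z.2.2] f) (η z.1)) ∧
      -diffOp ![z.2.1, z.2.2] g (η z.1)
        = ∫ s : I, (s : ℝ) * mehlerOp lam s (diffOp ![z.2.1, z.2.2] f) (η z.1) := by
  filter_upwards [hη.ae_add_dirac_add_dirac (hη.ae_isMehlerRegular hf hf2 h0 hg)] with z hz
  obtain ⟨z0, zx, zy, zxy⟩ := hz
  have h := diffOp_two_mehlerIntegral hf (hη.isConfiguration z.1) z0.1 zx.1 zy.1 zxy.1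
  rw [add_right_comm] at zxy
  refine ⟨h.1, ?_⟩
  rw [← h.2]
  simp only [diffOp_two, diffOp_one]
  rw [z0.2, zx.2, zy.2, zxy.2]

/-! ### Moment inequalities -/

/-- Jensen's inequality for powers, with values in `[0, ∞]`. -/
lemma lintegral_rpow_le {Z : Type*} [MeasurableSpace Z] {ν : Measure Z} [IsProbabilityMeasure ν]
    {h : Z → ℝ≥0∞} (hh : AEMeasurable h ν) {p : ℝ} (hp : 1 ≤ p) :
    (∫⁻ z, h z ∂ν) ^ p ≤ ∫⁻ z, h z ^ p ∂ν := by
  have h1 := eLpNorm'_le_eLpNorm'_of_exponent_le zero_lt_one hp ν hh.aestronglyMeasurable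
  have hp0 : 0 < p := by linarith
  simp only [eLpNorm', enorm_eq_self, ENNReal.rpow_one, div_one] at h1
  rw [one_div, ENNReal.le_rpow_inv_iff hp0] at h1
  exact h1

/-- Jensen's inequality for mixtures of the operators `P_s` with weights bounded by `1`; the
right-hand side does not involve the mixture since it preserves the law of `η`. -/
lemma lintegral_enorm_rpow_le (hη : IsPoissonProcess P η lam) {h : Measure X → ℝ}
    (hh : Measurable h) {c : I → ℝ} (hc : ∀ s, |c s| ≤ 1) {Y : Ω → ℝ}
    (hY : ∀ᵐ ω ∂P, -Y ω = ∫ s : I, c s * mehlerOp lam s h (η ω)) {p : ℝ} (hp : 1 ≤ p) :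
    ∫⁻ ω, ‖Y ω‖ₑ ^ p ∂P ≤ ∫⁻ ω, ‖h (η ω)‖ₑ ^ p ∂P := by
  have hp0 : 0 ≤ p := by linarith
  rw [← lintegral_lintegral_mehlerMeasure hη (hh.enorm.pow_const p)]
  refine lintegral_mono_ae ?_
  filter_upwards [hY] with ω hω
  have hm : Measurable ((fun z : I × Conf X => ∫⁻ ξ, ‖h ξ‖ₑ ∂(mehlerKernel lam z)) ∘
      fun s => (s, (⟨η ω, hη.isConfiguration ω⟩ : Conf X))) :=
    hh.enorm.lintegral_kernel.comp measurable_prodMk_right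
  have h1 : ‖Y ω‖ₑ ≤ ∫⁻ s : I, ∫⁻ ξ, ‖h ξ‖ₑ ∂(mehlerMeasure lam s (η ω)) := by
    rw [← enorm_neg, hω]
    refine (enorm_integral_le_lintegral_enorm _).trans (lintegral_mono fun s => ?_)
    rw [enorm_mul]
    refine (mul_le_of_le_one_left zero_le ?_).trans (enorm_mehlerOp_le lam hh s (η ω))
    rw [← ofReal_norm]
    simpa using hc s
  calc ‖Y ω‖ₑ ^ p ≤ (∫⁻ s : I, ∫⁻ ξ, ‖h ξ‖ₑ ∂(mehlerMeasure lam s (η ω))) ^ p :=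
        ENNReal.rpow_le_rpow h1 hp0
    _ ≤ ∫⁻ s : I, (∫⁻ ξ, ‖h ξ‖ₑ ∂(mehlerMeasure lam s (η ω))) ^ p :=
        lintegral_rpow_le hm.aemeasurable hp
    _ ≤ _ := lintegral_mono fun s => lintegral_rpow_le hh.enorm.aemeasurable hp

/-- Constants have vanishing differences of all orders `n ≥ 1`. -/
lemma invOU_sub_const {lam : Measure X} [SigmaFinite lam] {P : Measure Ω} {η : Ω → Measure X}
    (f : Measure X → ℝ) (c : ℝ) :
    invOU P lam η (fun μ => f μ - c) = invOU P lam η f := by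
  have h : ∀ n : ℕ, n ≠ 0 → chaosKernel P η (fun μ => f μ - c) n = chaosKernel P η f n := by
    intro n hn
    funext x
    rw [chaosKernel, chaosKernel, diffOp_sub_const hn]
  have h1 : invOUPartial P lam η (fun μ => f μ - c) = invOUPartial P lam η f := by
    funext m ω
    refine congrArg Neg.neg (Finset.sum_congr rfl fun n hn => ?_)
    rw [h n (by have := (Finset.mem_Icc.1 hn).1; omega)]
  rw [invOU, invOU, h1]

/-- The moment inequalities for first and second differences of `L⁻¹ f(η)`, without centring. -/
theorem ae_lintegral_diffOp_invOU_le (hη : IsPoissonProcess P η lam) {f g : Measure X → ℝ}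
    (hf : Measurable f) (hf2 : MemLp f 2 (P.map η))
    (hg : IsRepresentative P η g (invOU P lam η f)) {p : ℝ} (hp : 1 ≤ p) :
    (∀ᵐ x ∂lam, ∫⁻ ω, ‖diffOp ![x] g (η ω)‖ₑ ^ p ∂P ≤ ∫⁻ ω, ‖diffOp ![x] f (η ω)‖ₑ ^ p ∂P) ∧
      (∀ᵐ z ∂(lam.prod lam), ∫⁻ ω, ‖diffOp ![z.1, z.2] g (η ω)‖ₑ ^ p ∂P
        ≤ ∫⁻ ω, ‖diffOp ![z.1, z.2] f (η ω)‖ₑ ^ p ∂P) := by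
  have hP := hη.isPoissonLaw.isProbabilityMeasure
  -- Centring `f` changes neither its differences nor `L⁻¹`.
  set c := ∫ ω, f (η ω) ∂P with hc
  have hfi : Integrable (fun ω => f (η ω)) P :=
    (hf2.integrable (by norm_num)).comp_measurable hη.measurable
  have hcf : Measurable fun μ => f μ - c := hf.sub_const c
  have hcf2 : MemLp (fun μ => f μ - c) 2 (P.map η) := hf2.sub (memLp_const c)
  have hc0 : ∫ ω, (f (η ω) - c) ∂P = 0 := by
    rw [integral_sub hfi (integrable_const c), integral_const, probReal_univ, one_smul, hc, sub_self]
  have hcg : IsRepresentative P η g (invOU P lam η fun μ => f μ - c) := by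
    rw [invOU_sub_const]
    exact hg
  constructor
  · have h := Measure.ae_ae_of_ae_prod
      (Measure.measurePreserving_swap.quasiMeasurePreserving.ae
        (ae_diffOp_one_invOU hη hcf hcf2 hc0 hcg))
    filter_upwards [h] with x hx
    refine lintegral_enorm_rpow_le hη (measurable_diffOp_apply hf ![x]) (c := fun _ => 1)
      (fun s => by simp) ?_ hp
    filter_upwards [hx] with ω hω
    have := hω.2
    simp only [Prod.fst_swap, Prod.snd_swap, diffOp_sub_const one_ne_zero] at this
    simpa using this
  · have h := Measure.ae_ae_of_ae_prod
      (Measure.measurePreserving_swap.quasiMeasurePreserving.ae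
        (ae_diffOp_two_invOU hη hcf hcf2 hc0 hcg))
    filter_upwards [h] with z hz
    refine lintegral_enorm_rpow_le hη (measurable_diffOp_apply hf ![z.1, z.2])
      (c := fun s : I => (s : ℝ)) (fun s => by simpa using abs_pow_le_one s 1) ?_ hp
    filter_upwards [hz] with ω hω
    have := hω.2
    simp only [Prod.fst_swap, Prod.snd_swap, diffOp_sub_const two_ne_zero] at this
    exact this

end

end PoissonMehler

end

/-- Mehler's formula for functionals of a general Poisson process, with its consequences for
difference operators. -/
theorem theorem3p2 {X : Type*} [MeasurableSpace X] (lam : Measure X) [SigmaFinite lam]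
    {Ω : Type*} [MeasurableSpace Ω] (P : Measure Ω) [IsProbabilityMeasure P]
    (η : Ω → Measure X) (hη : IsPoissonProcess P η lam)
    (F : Ω → ℝ) (hF : MemLp F 2 P)
    (f : Measure X → ℝ) (hf : IsRepresentative P η f F) :
    -- the objects in the definition of `L⁻¹F` are well defined, and `L⁻¹F` belongs to `L²_η`
    ((∀ n : ℕ, 1 ≤ n →
        (∀ᵐ x ∂(Measure.pi fun _ : Fin n => lam), Integrable (fun ω => diffOp x f (η ω)) P) ∧
        MemLp (chaosKernel P η f n) 2 (Measure.pi fun _ : Fin n => lam) ∧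
        IsL2Limit P (wienerItoApprox lam η (chaosKernel P η f n))
          (wienerIto P lam η (chaosKernel P η f n))) ∧
      IsL2Limit P (invOUPartial P lam η f) (invOU P lam η f) ∧
      ∃ g : Measure X → ℝ, IsRepresentative P η g (invOU P lam η f)) ∧
    (∫ ω, F ω ∂P = 0 →
      -- Mehler's formula
      (∀ᵐ ω ∂P, Integrable (fun s : unitInterval => (s : ℝ)⁻¹ * mehlerOp lam s f (η ω)) ∧
        invOU P lam η f ω = -∫ s : unitInterval, (s : ℝ)⁻¹ * mehlerOp lam s f (η ω)) ∧
      -- the first and second order differences of `L⁻¹F`, for any representative of `L⁻¹F`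
      ∀ g : Measure X → ℝ, IsRepresentative P η g (invOU P lam η f) →
        (∀ᵐ z ∂(P.prod lam),
          Integrable (fun s : unitInterval => mehlerOp lam s (diffOp ![z.2] f) (η z.1)) ∧
          -diffOp ![z.2] g (η z.1)
            = ∫ s : unitInterval, mehlerOp lam s (diffOp ![z.2] f) (η z.1)) ∧
        (∀ᵐ z ∂(P.prod (lam.prod lam)),
          Integrable (fun s : unitInterval =>
            (s : ℝ) * mehlerOp lam s (diffOp ![z.2.1, z.2.2] f) (η z.1)) ∧
          -diffOp ![z.2.1, z.2.2] g (η z.1)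
            = ∫ s : unitInterval,
                (s : ℝ) * mehlerOp lam s (diffOp ![z.2.1, z.2.2] f) (η z.1))) ∧
    -- the moment inequalities
    (∀ g : Measure X → ℝ, IsRepresentative P η g (invOU P lam η f) → ∀ p : ℝ, 1 ≤ p →
      (∀ᵐ x ∂lam, ∫⁻ ω, ‖diffOp ![x] g (η ω)‖ₑ ^ p ∂P ≤ ∫⁻ ω, ‖diffOp ![x] f (η ω)‖ₑ ^ p ∂P) ∧
      (∀ᵐ z ∂(lam.prod lam), ∫⁻ ω, ‖diffOp ![z.1, z.2] g (η ω)‖ₑ ^ p ∂P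
        ≤ ∫⁻ ω, ‖diffOp ![z.1, z.2] f (η ω)‖ₑ ^ p ∂P)) := by
  have hfm := hf.measurable
  have hf2 : MemLp f 2 (P.map η) :=
    (memLp_map_measure_iff hfm.aestronglyMeasurable hη.measurable.aemeasurable).2
      ((memLp_congr_ae hf.ae_eq).1 hF)
  refine ⟨⟨fun n _ => ⟨hη.ae_integrable_diffOp hfm hf2 n, ?_,
    (isL2Limit_wienerItoApprox hη hfm hf2 n).l2Limit⟩, (isL2Limit_invOUPartial hη hfm hf2).l2Limit,
    _, (Lp.stronglyMeasurable _).measurable, invOU_ae_eq hη hfm hf2⟩, fun h0 => ?_,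
    fun g hg p hp => ae_lintegral_diffOp_invOU_le hη hfm hf2 hg hp⟩
  · exact (memLp_fock_level (measurable_meanDiff hη.measurable hfm)
      (hη.memLp_meanDiff hfm hf2) n).const_mul _
  · rw [integral_congr_ae hf.ae_eq] at h0
    refine ⟨?_, fun g hg => ⟨ae_diffOp_one_invOU hη hfm hf2 h0 hg,
      ae_diffOp_two_invOU hη hfm hf2 h0 hg⟩⟩
    filter_upwards [(integrable_inv_mul_mehlerOp hη hfm hf2 h0).prod_left_ae,
      invOU_ae_eq_mehlerIntegral hη hfm hf2 h0] with ω h1 h2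
    exact ⟨h1, h2⟩
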